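/- Let $(\zeta_i)_{i\ge 0}$ be i.i.d. random vectors with values in $\mathbb Z^2$ on a probability space $(\Omega,\mathbb P)$, with zero mean, finite second moment and nonsingular covariance matrix $\Sigma$, and aperiodic: the vectors $\ell$ with $\mathbb P(\zeta_0=\ell)>0$ generate the group $\mathbb Z^2$. Let $Z_0=0$, $Z_n=\zeta_0+\dots+\zeta_{n-1}$, and put $C_0=(\pi\sqrt{\det\Sigma})^{-1}$. Let $T_1,T_2$ be commuting invertible measure preserving transformations of a probability space $(E,\mu)$, let $T^\ell f(x)=f(T_1^{\ell_1}T_2^{\ell_2}x)$ for $\ell=(\ell_1,\ell_2)\in\mathbb Z^2$, and let $f\in L^2(E,\mu)$ be a real function with a continuous spectral density, i.e. there is a continuous real function $\varphi_f$ on $\mathbb T^2=(\mathbb R/\mathbb Z)^2$ with $$\int_E T^k f\cdot f\,d\mu=\int_{\mathbb T^2}e^{2\pi i\langle k,t\rangle}\varphi_f(t)\,dt\qquad\text{for all }k\in\mathbb Z^2,$$ where $dt$ is the Haar probability measure. Then for $\mathbb P$-almost every $\omega$ the following holds: for all $s\ge 1$, all real numbers $a_1,\dots,a_s$ and all subdivisions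 $0=t_0<t_1<\dots<t_s=1$, $$\frac{1}{C_0\,n\ln n}\,\Big\|\sum_{j=1}^s a_j\sum_{k=\lfloor nt_{j-1}\rfloor}^{\lfloor nt_j\rfloor}T^{Z_k(\omega)}f\Big\|_{L^2(\mu)}^2\;\longrightarrow\;\varphi_f(0)\sum_{j=1}^s a_j^2\,(t_j-t_{j-1})\qquad(n\to\infty).$$ -/

import Mathlib

open MeasureTheory ProbabilityTheory Filter Topology

noncomputable section

namespace QuenchedRW

/-- The random walk with steps `ζ 0, ζ 1, …`, started at the origin:
`Z 0 = 0` and `Z n = ζ 0 + ⋯ + ζ (n - 1)`. -/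
def walk {Ω : Type*} (ζ : ℕ → Ω → (Fin 2 → ℤ)) (n : ℕ) (ω : Ω) : Fin 2 → ℤ :=
  ∑ i ∈ Finset.range n, ζ i ω

/-- A step distribution is aperiodic if the vectors of positive probability generate the group
`ℤ²`. -/
def IsAperiodic {Ω : Type*} [MeasurableSpace Ω] (P : Measure Ω) (ξ : Ω → (Fin 2 → ℤ)) : Prop :=
  AddSubgroup.closure {l : Fin 2 → ℤ | 0 < P {ω | ξ ω = l}} = ⊤

/-- The covariance matrix of a random vector with values in `ℤ²`. -/
def covMatrix {Ω : Type*} [MeasurableSpace Ω] (P : Measure Ω) (ξ : Ω → (Fin 2 → ℤ)) :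
    Matrix (Fin 2) (Fin 2) ℝ :=
  Matrix.of fun i j => covariance (fun ω => (ξ ω i : ℝ)) (fun ω => (ξ ω j : ℝ)) P

/-- The constant `C₀ = (π √(det S))⁻¹` attached to a planar walk with step covariance `S`. -/
def selfIntersectionConst (S : Matrix (Fin 2) (Fin 2) ℝ) : ℝ :=
  (Real.pi * Real.sqrt S.det)⁻¹

/-- The map `T^l = T₁^{l₁} T₂^{l₂}`, for `l ∈ ℤ²`. -/
def zAction {E : Type*} [MeasurableSpace E] (T₁ T₂ : E ≃ᵐ E) (l : Fin 2 → ℤ) (x : E) : E :=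
  ((T₁.toEquiv : Equiv.Perm E) ^ (l 0)) (((T₂.toEquiv : Equiv.Perm E) ^ (l 1)) x)

/-- The Haar probability measure `dt` on the torus `𝕋² = (ℝ/ℤ)²`. -/
def torusHaar : Measure (UnitAddTorus (Fin 2)) :=
  Measure.pi fun _ => AddCircle.haarAddCircle

/-- The function `φ` on `𝕋²` is a continuous spectral density of the real function `f`:
`∫ (T^k f) f dμ = ∫ e^{2π i ⟨k, t⟩} φ(t) dt` for all `k ∈ ℤ²`. Here `mFourier k` is the character
`t ↦ e^{2π i ⟨k, t⟩}`. -/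
def IsContinuousSpectralDensity {E : Type*} [MeasurableSpace E] (μ : Measure E)
    (T₁ T₂ : E ≃ᵐ E) (f : E → ℝ) (φ : UnitAddTorus (Fin 2) → ℝ) : Prop :=
  Continuous φ ∧ ∀ k : Fin 2 → ℤ,
    ((∫ x, f (zAction T₁ T₂ k x) * f x ∂μ : ℝ) : ℂ) =
      ∫ t, UnitAddTorus.mFourier k t * (φ t : ℂ) ∂torusHaar

/-- The weighted block sum `∑_{j=1}^s a_j ∑_{k=⌊n t_{j-1}⌋}^{⌊n t_j⌋} T^{Z_k(ω)} f (x)`; the index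
`j : Fin s` stands for the `j + 1` of the formula. -/
def blockSum {Ω E : Type*} [MeasurableSpace E] (ζ : ℕ → Ω → (Fin 2 → ℤ))
    (T₁ T₂ : E ≃ᵐ E) (f : E → ℝ) {s : ℕ} (a : Fin s → ℝ) (t : Fin (s + 1) → ℝ)
    (n : ℕ) (ω : Ω) (x : E) : ℝ :=
  ∑ j : Fin s, a j * ∑ k ∈ Finset.Icc ⌊(n : ℝ) * t j.castSucc⌋₊ ⌊(n : ℝ) * t j.succ⌋₊,
    f (zAction T₁ T₂ (walk ζ k ω) x)

end QuenchedRW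

end

/-! The squared norm of a weighted sum of the `T^{Z_k} f` is the integral of `φ` against
`|trigPoly|²`, a nonnegative trigonometric polynomial on the torus. Its Fourier coefficient at `m`
is a weighted count of pairs of times `(i, j)` with `Z_i - Z_j = -m`. After division by `C₀ n log n`
every coefficient tends to the same number `S = ∑ a_j² (t_j - t_{j-1})`. By Weyl's criterion these
densities converge weakly to `S` times the point mass at `0`, and testing against the continuous `φ`
gives `S φ(0)`. Everything thus rests on almost sure asymptotics of the pair counts, which involve
the walk alone.

Mean. The expected count in an interval of length `n` is a sum of truncated Green functions. Fourier
inversion writes these as integrals of `∑ χ^m`, where `χ` is the characteristic function of a step.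
Near the origin `χ^m` is compared with a Gaussian of integral proportional to `1/m`; away from it
aperiodicity keeps `1 - χ` off zero and the geometric sum stays bounded. The mean is therefore
asymptotic to `C₀ n log n` for each displacement (`tendsto_meanCount`).

Variance. Halving an interval splits its count into the counts of the halves, which are independent,
and cross counts between the halves. The cross counts have second moment `O(n²)`: past and future of
the midpoint are independent, their two-point functions are dominated by products of Green
functions, and `∑_x G_n(x)² = O(n)`. Induction on the length gives variance `O(n²)`
(`exists_variance_pairCount_le`), smaller than the squared mean by a factor `log² n`.

Almost sure statement. Along `n = c^k` that factor is of order `k²`, so the normalised variances are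
summable and the counts converge almost surely, simultaneously for all displacements and all
rational `c`, `s`, `t`. Monotonicity then yields a sharp lower bound for each block with real end
points and a sharp upper bound for the whole square. Since the lower bounds already add up to the
upper one, the counts of single blocks converge and those between distinct blocks are negligible
(`HasGeometricAsymptotics.tendsto_block`). -/

noncomputable section

/-! ### Characteristic functions on `ℤ²` and Fourier inversion -/

namespace QuenchedRW

open scoped ComplexConjugate

/-- The character `l ↦ e^{i ⟨θ, l⟩}` of `ℤ²`. -/
def chr (θ : ℝ × ℝ) (l : Fin 2 → ℤ) : ℂ :=
  Complex.exp (((θ.1 * l 0 + θ.2 * l 1 : ℝ) : ℂ) * Complex.I)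

/-- The characteristic function of a random vector with values in `ℤ²`. -/
def chf {Ω : Type*} [MeasurableSpace Ω] (P : Measure Ω) (X : Ω → Fin 2 → ℤ) (θ : ℝ × ℝ) : ℂ :=
  ∫ ω, chr θ (X ω) ∂P

/-- The fundamental domain `[-π, π]²` of the dual torus. -/
def dualBox : Set (ℝ × ℝ) := Set.Icc (-Real.pi) Real.pi ×ˢ Set.Icc (-Real.pi) Real.pi

theorem norm_chr (θ : ℝ × ℝ) (l : Fin 2 → ℤ) : ‖chr θ l‖ = 1 :=
  Complex.norm_exp_ofReal_mul_I _

theorem chr_add (θ : ℝ × ℝ) (l m : Fin 2 → ℤ) : chr θ (l + m) = chr θ l * chr θ m := by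
  rw [chr, chr, chr, ← Complex.exp_add]
  congr 1
  push_cast [Pi.add_apply]
  ring

theorem chr_zero (θ : ℝ × ℝ) : chr θ 0 = 1 := by simp [chr]

theorem chr_neg (θ : ℝ × ℝ) (l : Fin 2 → ℤ) : chr θ (-l) = conj (chr θ l) := by
  rw [chr, chr, ← Complex.exp_conj]
  congr 1
  simp only [map_mul, Complex.conj_ofReal, Complex.conj_I]
  push_cast [Pi.neg_apply]
  ring

theorem chr_sum {ι : Type*} (θ : ℝ × ℝ) (S : Finset ι) (g : ι → Fin 2 → ℤ) :
    chr θ (∑ i ∈ S, g i) = ∏ i ∈ S, chr θ (g i) := by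
  classical
  induction S using Finset.induction_on with
  | empty => simp [chr_zero]
  | insert a S ha ih => rw [Finset.sum_insert ha, Finset.prod_insert ha, chr_add, ih]

theorem continuous_chr (l : Fin 2 → ℤ) : Continuous fun θ : ℝ × ℝ => chr θ l := by
  unfold chr; fun_prop

theorem measurable_chr (θ : ℝ × ℝ) : Measurable (chr θ) := measurable_of_countable _

theorem isCompact_dualBox : IsCompact dualBox := isCompact_Icc.prod isCompact_Icc

theorem integral_exp_int (k : ℤ) :
    ∫ x in Set.Icc (-Real.pi) Real.pi, Complex.exp (((x * k : ℝ) : ℂ) * Complex.I) =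
      if k = 0 then 2 * (Real.pi : ℂ) else 0 := by
  rw [integral_Icc_eq_integral_Ioc, ← intervalIntegral.integral_of_le (by linarith [Real.pi_pos])]
  split_ifs with hk
  · subst hk
    simp
    ring
  · have hc : (k : ℂ) * Complex.I ≠ 0 := by simp [hk]
    have h1 : ∀ x : ℝ, Complex.exp (((x * k : ℝ) : ℂ) * Complex.I) =
        Complex.exp ((k : ℂ) * Complex.I * x) := by
      intro x; congr 1; push_cast; ring
    simp_rw [h1]
    rw [integral_exp_mul_complex hc, div_eq_zero_iff]
    left
    rw [sub_eq_zero, Complex.exp_eq_exp_iff_exists_int]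
    exact ⟨k, by push_cast; ring⟩

theorem integral_chr (l : Fin 2 → ℤ) :
    ∫ θ in dualBox, chr θ l = if l = 0 then (2 * (Real.pi : ℂ)) ^ 2 else 0 := by
  have h : ∀ θ : ℝ × ℝ, chr θ l = Complex.exp (((θ.1 * l 0 : ℝ) : ℂ) * Complex.I) *
      Complex.exp (((θ.2 * l 1 : ℝ) : ℂ) * Complex.I) := by
    intro θ
    rw [chr, ← Complex.exp_add]
    congr 1
    push_cast
    ring
  simp_rw [h, dualBox]
  rw [Measure.volume_eq_prod, setIntegral_prod_mul
    (fun x : ℝ => Complex.exp (((x * l 0 : ℝ) : ℂ) * Complex.I))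
    (fun x : ℝ => Complex.exp (((x * l 1 : ℝ) : ℂ) * Complex.I)), integral_exp_int, integral_exp_int]
  have : l = 0 ↔ l 0 = 0 ∧ l 1 = 0 := by
    rw [funext_iff, Fin.forall_fin_two]; rfl
  simp only [this]
  split_ifs <;> simp_all
  ring

section Prob

variable {Ω : Type*} [MeasurableSpace Ω] {P : Measure Ω}

theorem integrable_chr [IsFiniteMeasure P] {X : Ω → Fin 2 → ℤ} (hX : Measurable X)
    (θ : ℝ × ℝ) : Integrable (fun ω => chr θ (X ω)) P :=
  Integrable.of_bound ((measurable_chr θ).comp hX).aestronglyMeasurable 1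
    (ae_of_all _ fun _ => (norm_chr _ _).le)

theorem norm_chf_le [IsProbabilityMeasure P] (X : Ω → Fin 2 → ℤ) (θ : ℝ × ℝ) :
    ‖chf P X θ‖ ≤ 1 := by
  refine (norm_integral_le_integral_norm _).trans ?_
  simp [norm_chr]

theorem continuous_chf [IsFiniteMeasure P] {X : Ω → Fin 2 → ℤ} (hX : Measurable X) :
    Continuous (chf P X) := by
  refine continuous_of_dominated (bound := fun _ => 1)
    (fun θ => (integrable_chr hX θ).aestronglyMeasurable)
    (fun θ => ae_of_all _ fun _ => (norm_chr _ _).le) (integrable_const _)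
    (ae_of_all _ fun ω => continuous_chr _)

/-- Fourier inversion for the law of a random vector with values in `ℤ²`. -/
theorem prob_eq_integral_chf [IsProbabilityMeasure P] {X : Ω → Fin 2 → ℤ} (hX : Measurable X)
    (l : Fin 2 → ℤ) :
    ((2 * Real.pi) ^ 2 * P.real {ω | X ω = l} : ℂ) =
      ∫ θ in dualBox, chf P X θ * chr θ (-l) := by
  have h1 : ∀ θ, chf P X θ * chr θ (-l) = ∫ ω, chr θ (X ω - l) ∂P := by
    intro θ
    rw [chf, ← integral_mul_const]
    simp_rw [sub_eq_add_neg, chr_add]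
  simp_rw [h1]
  have hmeas : Measurable (Function.uncurry fun (θ : ℝ × ℝ) (ω : Ω) => chr θ (X ω - l)) := by
    have hX0 : Measurable fun ω => ((X ω 0 : ℤ) : ℝ) :=
      (measurable_of_countable (fun v : Fin 2 → ℤ => ((v 0 : ℤ) : ℝ))).comp hX
    have hX1 : Measurable fun ω => ((X ω 1 : ℤ) : ℝ) :=
      (measurable_of_countable (fun v : Fin 2 → ℤ => ((v 1 : ℤ) : ℝ))).comp hX
    simp only [Function.uncurry_def, chr, Pi.sub_apply]
    push_cast
    fun_prop
  have : IsFiniteMeasure ((volume : Measure (ℝ × ℝ)).restrict dualBox) :=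
    ⟨by simpa using isCompact_dualBox.measure_lt_top⟩
  rw [integral_integral_swap (Integrable.of_bound hmeas.aestronglyMeasurable 1
    (ae_of_all _ fun _ => (norm_chr _ _).le))]
  simp_rw [integral_chr, sub_eq_zero]
  have h2 : ∀ ω, (if X ω = l then (2 * (Real.pi : ℂ)) ^ 2 else 0) =
      Set.indicator {ω | X ω = l} (fun _ => (2 * (Real.pi : ℂ)) ^ 2) ω := by
    intro ω; simp [Set.indicator_apply]
  simp_rw [h2]
  have hms : MeasurableSet {ω | X ω = l} := hX (measurableSet_singleton l)
  rw [integral_indicator hms, setIntegral_const]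
  rw [Complex.real_smul]
  ring

theorem chf_comp_neg (X : Ω → Fin 2 → ℤ) (θ : ℝ × ℝ) :
    chf P (fun ω => -X ω) θ = conj (chf P X θ) := by
  rw [chf, chf, ← integral_conj]
  simp_rw [chr_neg]

theorem chf_eq_of_identDistrib {X Y : Ω → Fin 2 → ℤ} (h : IdentDistrib X Y P P) :
    chf P X = chf P Y := by
  funext θ
  exact (h.comp (measurable_chr θ)).integral_eq

theorem chf_sum_comp {ζ : ℕ → Ω → Fin 2 → ℤ} (hmeas : ∀ i, Measurable (ζ i))
    (hindep : iIndepFun ζ P) (U : Finset ℕ) (g : ℕ → (Fin 2 → ℤ) → (Fin 2 → ℤ)) (θ : ℝ × ℝ) :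
    chf P (fun ω => ∑ i ∈ U, g i (ζ i ω)) θ = ∏ i ∈ U, chf P (fun ω => g i (ζ i ω)) θ := by
  simp_rw [chf, chr_sum]
  have h := iIndepFun.integral_fun_prod_comp (X := fun (i : U) => ζ i)
    (f := fun (i : U) v => chr θ (g i v))
    (hindep.precomp (g := ((↑) : U → ℕ)) Subtype.val_injective)
    (fun i => (hmeas i).aemeasurable)
    (fun i => (measurable_of_countable _).aestronglyMeasurable)
  simp_rw [← Finset.prod_coe_sort U]
  exact h

theorem chf_sum {ζ : ℕ → Ω → Fin 2 → ℤ} (hmeas : ∀ i, Measurable (ζ i))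
    (hindep : iIndepFun ζ P) (hident : ∀ i, IdentDistrib (ζ i) (ζ 0) P P) (U : Finset ℕ)
    (θ : ℝ × ℝ) :
    chf P (fun ω => ∑ i ∈ U, ζ i ω) θ = chf P (ζ 0) θ ^ U.card := by
  rw [chf_sum_comp hmeas hindep U (fun _ v => v)]
  simp_rw [fun i => chf_eq_of_identDistrib (hident i)]
  simp

/-- Flipping the sign of a step conjugates its characteristic function. These mixed powers are the
terms in the expansion of `|∑ χ^m|²`, needed for the square sum of the Green function. -/
theorem chf_sum_sub_sum {ζ : ℕ → Ω → Fin 2 → ℤ} (hmeas : ∀ i, Measurable (ζ i))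
    (hindep : iIndepFun ζ P) (hident : ∀ i, IdentDistrib (ζ i) (ζ 0) P P) {U V : Finset ℕ}
    (hUV : Disjoint U V) (θ : ℝ × ℝ) :
    chf P (fun ω => ∑ i ∈ U, ζ i ω - ∑ i ∈ V, ζ i ω) θ =
      chf P (ζ 0) θ ^ U.card * conj (chf P (ζ 0) θ) ^ V.card := by
  have h : ∀ ω, ∑ i ∈ U, ζ i ω - ∑ i ∈ V, ζ i ω =
      ∑ i ∈ U ∪ V, if i ∈ U then ζ i ω else -ζ i ω := by
    intro ω
    rw [Finset.sum_union hUV, sub_eq_add_neg, ← Finset.sum_neg_distrib]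
    congr 1
    · exact Finset.sum_congr rfl fun i hi => by rw [if_pos hi]
    · exact Finset.sum_congr rfl fun i hi => by rw [if_neg (Finset.disjoint_right.1 hUV hi)]
  simp_rw [h]
  rw [chf_sum_comp hmeas hindep (U ∪ V) (fun i v => if i ∈ U then v else -v),
    Finset.prod_union hUV]
  congr 1
  · rw [← Finset.prod_const]
    refine Finset.prod_congr rfl fun i hi => ?_
    simp_rw [if_pos hi]
    exact congrFun (chf_eq_of_identDistrib (hident i)) θ
  · rw [← Finset.prod_const]
    refine Finset.prod_congr rfl fun i hi => ?_
    simp_rw [if_neg (Finset.disjoint_right.1 hUV hi)]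
    rw [chf_comp_neg, chf_eq_of_identDistrib (hident i)]

end Prob

end QuenchedRW

/-! ### The covariance form and the expansion of the characteristic function at the origin -/

namespace QuenchedRW

/-- The quadratic form with matrix `S`. -/
def quadForm (S : Matrix (Fin 2) (Fin 2) ℝ) (θ : ℝ × ℝ) : ℝ :=
  S 0 0 * θ.1 ^ 2 + 2 * S 0 1 * θ.1 * θ.2 + S 1 1 * θ.2 ^ 2

theorem continuous_quadForm (S : Matrix (Fin 2) (Fin 2) ℝ) : Continuous (quadForm S) := by
  unfold quadForm; fun_prop

/-- Cubic for small `u`, quadratic for large `u`. The purely cubic bound would require a third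
moment of the step; this one is dominated by the second moment and still gives a remainder of order
`o(|θ|²)`. -/
theorem norm_exp_mul_I_taylor_le (u : ℝ) :
    ‖Complex.exp (u * Complex.I) - 1 - u * Complex.I + u ^ 2 / 2‖ ≤ 4 * u ^ 2 * min 1 |u| := by
  rcases le_total |u| 1 with h | h
  · have h1 : ‖(u : ℂ) * Complex.I‖ ≤ 1 := by simpa using h
    have h2 := Complex.exp_bound h1 (n := 3) (by norm_num)
    have h3 : Complex.exp (u * Complex.I) - 1 - u * Complex.I + u ^ 2 / 2 =
        Complex.exp (u * Complex.I) -
          ∑ m ∈ Finset.range 3, ((u : ℂ) * Complex.I) ^ m / (m.factorial : ℂ) := by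
      simp [Finset.sum_range_succ, mul_pow]
      ring
    rw [h3, min_eq_right h]
    refine h2.trans ?_
    have h4 : ‖(u : ℂ) * Complex.I‖ = |u| := by simp
    have h5 : |u| ^ 3 = u ^ 2 * |u| := by rw [← sq_abs u]; ring
    have : (0 : ℝ) ≤ u ^ 2 * |u| := by positivity
    rw [h4, h5]
    norm_num [Nat.factorial]
    nlinarith
  · rw [min_eq_left h, mul_one]
    have h1 : ‖Complex.exp (u * Complex.I) - 1 - u * Complex.I + u ^ 2 / 2‖ ≤
        ‖Complex.exp (u * Complex.I)‖ + ‖(1 : ℂ)‖ + ‖(u : ℂ) * Complex.I‖ + ‖(u : ℂ) ^ 2 / 2‖ :=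
      (norm_add_le _ _).trans (add_le_add_left ((norm_sub_le _ _).trans
        (add_le_add_left (norm_sub_le _ _) _)) _)
    refine h1.trans ?_
    rw [Complex.norm_exp_ofReal_mul_I]
    simp only [norm_one, norm_mul, Complex.norm_real, Complex.norm_I, mul_one, norm_div, norm_pow,
      Real.norm_eq_abs, Complex.norm_ofNat]
    rw [← sq_abs u]
    nlinarith

section Step

variable {Ω : Type*} [MeasurableSpace Ω] {P : Measure Ω} {X : Ω → Fin 2 → ℤ}

theorem integrable_mul_coord (hL2 : ∀ c : Fin 2, MemLp (fun ω => (X ω c : ℝ)) 2 P) (i j : Fin 2) :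
    Integrable (fun ω => (X ω i : ℝ) * (X ω j : ℝ)) P :=
  (hL2 i).integrable_mul (hL2 j)

theorem covMatrix_apply (hmean : ∀ c : Fin 2, ∫ ω, (X ω c : ℝ) ∂P = 0) (i j : Fin 2) :
    covMatrix P X i j = ∫ ω, (X ω i : ℝ) * (X ω j : ℝ) ∂P := by
  simp only [covMatrix, Matrix.of_apply, covariance, hmean, sub_zero]

theorem quadForm_covMatrix (hL2 : ∀ c : Fin 2, MemLp (fun ω => (X ω c : ℝ)) 2 P)
    (hmean : ∀ c : Fin 2, ∫ ω, (X ω c : ℝ) ∂P = 0) (θ : ℝ × ℝ) :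
    quadForm (covMatrix P X) θ = ∫ ω, (θ.1 * X ω 0 + θ.2 * X ω 1) ^ 2 ∂P := by
  have h : ∀ ω, (θ.1 * X ω 0 + θ.2 * X ω 1) ^ 2 =
      θ.1 ^ 2 * ((X ω 0 : ℝ) * (X ω 0 : ℝ)) + 2 * θ.1 * θ.2 * ((X ω 0 : ℝ) * (X ω 1 : ℝ)) +
        θ.2 ^ 2 * ((X ω 1 : ℝ) * (X ω 1 : ℝ)) := fun ω => by ring
  simp_rw [h]
  have hi := fun i j => integrable_mul_coord hL2 i j
  have hi1 : Integrable (fun ω => θ.1 ^ 2 * ((X ω 0 : ℝ) * (X ω 0 : ℝ)) +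
      2 * θ.1 * θ.2 * ((X ω 0 : ℝ) * (X ω 1 : ℝ))) P :=
    ((hi 0 0).const_mul _).add ((hi 0 1).const_mul _)
  rw [integral_add hi1 ((hi 1 1).const_mul _),
    integral_add ((hi 0 0).const_mul _) ((hi 0 1).const_mul _)]
  simp only [integral_const_mul, ← covMatrix_apply hmean, quadForm]
  ring

theorem covMatrix_symm (hmean : ∀ c : Fin 2, ∫ ω, (X ω c : ℝ) ∂P = 0) :
    covMatrix P X 1 0 = covMatrix P X 0 1 := by
  rw [covMatrix_apply hmean, covMatrix_apply hmean]
  simp_rw [mul_comm]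

theorem covMatrix_det_pos (hL2 : ∀ c : Fin 2, MemLp (fun ω => (X ω c : ℝ)) 2 P)
    (hmean : ∀ c : Fin 2, ∫ ω, (X ω c : ℝ) ∂P = 0) (hcov : (covMatrix P X).det ≠ 0) :
    0 < (covMatrix P X).det ∧ 0 < covMatrix P X 0 0 ∧ 0 < covMatrix P X 1 1 := by
  set S := covMatrix P X with hS
  have hq : ∀ x y : ℝ, 0 ≤ S 0 0 * x ^ 2 + 2 * S 0 1 * x * y + S 1 1 * y ^ 2 := by
    intro x y
    have := quadForm_covMatrix hL2 hmean (x, y)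
    simp only [quadForm] at this
    rw [hS, this]
    positivity
  have hs : S 1 0 = S 0 1 := covMatrix_symm hmean
  have hdet : S.det = S 0 0 * S 1 1 - S 0 1 ^ 2 := by
    rw [Matrix.det_fin_two, hs]; ring
  have h0 : 0 ≤ S 0 0 := by simpa using hq 1 0
  have h1 : 0 ≤ S 1 1 := by simpa using hq 0 1
  have hnn : 0 ≤ S.det := by
    rw [hdet]
    rcases h0.eq_or_lt with h | h
    · have h2 := hq (-(S 1 1 + 1) * S 0 1) (S 0 1 ^ 2)
      -- When `S 0 0 = 0`, the form at this vector equals `-(S 1 1 + 2) * S 0 1 ^ 2`, so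
      -- nonnegativity forces `S 0 1 = 0`.
      have h3 := hq (-(S 1 1 + 1)) (S 0 1)
      rw [← h] at h3 ⊢
      nlinarith [sq_nonneg (S 0 1)]
    -- At this vector the form equals `S 0 0` times the determinant.
    · have h2 := hq (S 0 1) (-(S 0 0))
      have h3 : 0 ≤ S 0 0 * (S 0 0 * S 1 1 - S 0 1 ^ 2) := by nlinarith
      exact nonneg_of_mul_nonneg_right h3 h
  have hpos : 0 < S.det := lt_of_le_of_ne hnn (Ne.symm hcov)
  refine ⟨hpos, lt_of_le_of_ne h0 fun h => ?_, lt_of_le_of_ne h1 fun h => ?_⟩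
  · rw [hdet, ← h] at hpos; nlinarith [sq_nonneg (S 0 1)]
  · rw [hdet, ← h] at hpos; nlinarith [sq_nonneg (S 0 1)]

/-- By Cayley–Hamilton the trace times the form at `θ` is `det S * |θ|² + |S θ|²`, so `det / trace`
serves as the constant. -/
theorem exists_quadForm_lower (hL2 : ∀ c : Fin 2, MemLp (fun ω => (X ω c : ℝ)) 2 P)
    (hmean : ∀ c : Fin 2, ∫ ω, (X ω c : ℝ) ∂P = 0) (hcov : (covMatrix P X).det ≠ 0) :
    ∃ c > 0, ∀ θ : ℝ × ℝ, c * (θ.1 ^ 2 + θ.2 ^ 2) ≤ quadForm (covMatrix P X) θ := by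
  obtain ⟨hD, ha, hd⟩ := covMatrix_det_pos hL2 hmean hcov
  set S := covMatrix P X with hS
  have hs : S 1 0 = S 0 1 := covMatrix_symm hmean
  have hdet : S.det = S 0 0 * S 1 1 - S 0 1 ^ 2 := by
    rw [Matrix.det_fin_two, hs]; ring
  refine ⟨S.det / (S 0 0 + S 1 1), by positivity, fun θ => ?_⟩
  rw [div_mul_eq_mul_div, div_le_iff₀ (by positivity), hdet, quadForm]
  nlinarith [sq_nonneg (S 0 0 * θ.1 + S 0 1 * θ.2), sq_nonneg (S 0 1 * θ.1 + S 1 1 * θ.2)]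

theorem exists_quadForm_upper (S : Matrix (Fin 2) (Fin 2) ℝ) :
    ∃ C > 0, ∀ θ : ℝ × ℝ, quadForm S θ ≤ C * (θ.1 ^ 2 + θ.2 ^ 2) := by
  refine ⟨|S 0 0| + |S 0 1| + |S 1 1| + 1, by positivity, fun θ => ?_⟩
  have h0 := mul_le_mul_of_nonneg_right (le_abs_self (S 0 0)) (sq_nonneg θ.1)
  have h1 := mul_le_mul_of_nonneg_right (le_abs_self (S 1 1)) (sq_nonneg θ.2)
  have h2 : 2 * S 0 1 * θ.1 * θ.2 ≤ |S 0 1| * (θ.1 ^ 2 + θ.2 ^ 2) := by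
    rcases abs_cases (S 0 1) with ⟨h, h'⟩ | ⟨h, h'⟩ <;> rw [h]
    · nlinarith [mul_nonneg h' (sq_nonneg (θ.1 - θ.2))]
    · nlinarith [mul_nonneg (neg_nonneg.2 h'.le) (sq_nonneg (θ.1 + θ.2))]
  rw [quadForm]
  nlinarith [mul_nonneg (abs_nonneg (S 0 0)) (sq_nonneg θ.2),
    mul_nonneg (abs_nonneg (S 1 1)) (sq_nonneg θ.1), sq_nonneg θ.1, sq_nonneg θ.2]

/-- Dominated convergence with the second moment as majorant; the integrand vanishes at `h = 0`.
This is the source of the `o(|θ|²)` remainder. -/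
theorem tendsto_truncated_second_moment (hX : Measurable X)
    (hL2 : ∀ c : Fin 2, MemLp (fun ω => (X ω c : ℝ)) 2 P) :
    Tendsto (fun h : ℝ => ∫ ω, (|(X ω 0 : ℝ)| + |(X ω 1 : ℝ)|) ^ 2 *
      min 1 (|h| * (|(X ω 0 : ℝ)| + |(X ω 1 : ℝ)|)) ∂P) (𝓝 0) (𝓝 0) := by
  have hint : Integrable (fun ω => (|(X ω 0 : ℝ)| + |(X ω 1 : ℝ)|) ^ 2) P :=
    ((hL2 0).abs.add (hL2 1).abs).integrable_sq
  have hX' : ∀ c, Measurable fun ω => (X ω c : ℝ) := fun c =>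
    (measurable_of_countable (fun v : Fin 2 → ℤ => ((v c : ℤ) : ℝ))).comp hX
  have hX0 := hX' 0
  have hX1 := hX' 1
  have hc : Continuous (fun h : ℝ => ∫ ω, (|(X ω 0 : ℝ)| + |(X ω 1 : ℝ)|) ^ 2 *
      min 1 (|h| * (|(X ω 0 : ℝ)| + |(X ω 1 : ℝ)|)) ∂P) := by
    refine continuous_of_dominated (bound := fun ω => (|(X ω 0 : ℝ)| + |(X ω 1 : ℝ)|) ^ 2)
      (fun h => ?_) (fun h => ae_of_all _ fun ω => ?_) hint (ae_of_all _ fun ω => ?_)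
    · have : Measurable fun ω => (|(X ω 0 : ℝ)| + |(X ω 1 : ℝ)|) ^ 2 *
        min 1 (|h| * (|(X ω 0 : ℝ)| + |(X ω 1 : ℝ)|)) := by fun_prop
      exact this.aestronglyMeasurable
    · rw [Real.norm_of_nonneg (by positivity)]
      exact mul_le_of_le_one_right (by positivity) (min_le_left _ _)
    · fun_prop
  simpa using hc.tendsto 0

/-- Second order Taylor expansion of a characteristic function at the origin. -/
theorem exists_chf_taylor [IsProbabilityMeasure P] (hX : Measurable X)
    (hL2 : ∀ c : Fin 2, MemLp (fun ω => (X ω c : ℝ)) 2 P)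
    (hmean : ∀ c : Fin 2, ∫ ω, (X ω c : ℝ) ∂P = 0) {η : ℝ} (hη : 0 < η) :
    ∃ δ > 0, ∀ θ : ℝ × ℝ, |θ.1| ≤ δ → |θ.2| ≤ δ →
      ‖chf P X θ - (1 - quadForm (covMatrix P X) θ / 2 : ℝ)‖ ≤ η * (θ.1 ^ 2 + θ.2 ^ 2) := by
  have hev := (tendsto_truncated_second_moment (P := P) hX hL2).eventually
    (gt_mem_nhds (show (0 : ℝ) < η / 4 by positivity))
  obtain ⟨δ, hδ, hball⟩ := Metric.eventually_nhds_iff.1 hev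
  refine ⟨δ / 2, by positivity, fun θ h0 h1 => ?_⟩
  set h := max |θ.1| |θ.2| with hh
  have hnn : 0 ≤ h := (abs_nonneg _).trans (le_max_left _ _)
  have hlt := hball (y := h) (by
    rw [Real.dist_eq, sub_zero, abs_of_nonneg hnn]
    exact (max_le h0 h1).trans_lt (by linarith))
  have hi : ∀ c, Integrable (fun ω => (X ω c : ℝ)) P := fun c => (hL2 c).integrable (by norm_num)
  have hu : Integrable (fun ω => θ.1 * (X ω 0 : ℝ) + θ.2 * (X ω 1 : ℝ)) P :=
    ((hi 0).const_mul _).add ((hi 1).const_mul _)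
  have hu2 : Integrable (fun ω => (θ.1 * (X ω 0 : ℝ) + θ.2 * (X ω 1 : ℝ)) ^ 2) P :=
    (((hL2 0).const_mul θ.1).add ((hL2 1).const_mul θ.2)).integrable_sq
  have hmean' : ∫ ω, (θ.1 * (X ω 0 : ℝ) + θ.2 * (X ω 1 : ℝ)) ∂P = 0 := by
    rw [integral_add ((hi 0).const_mul _) ((hi 1).const_mul _), integral_const_mul,
      integral_const_mul, hmean, hmean]
    simp
  have key : chf P X θ - (1 - quadForm (covMatrix P X) θ / 2 : ℝ) =
      ∫ ω, (chr θ (X ω) - 1 - ((θ.1 * X ω 0 + θ.2 * X ω 1 : ℝ) : ℂ) * Complex.I +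
        ((θ.1 * X ω 0 + θ.2 * X ω 1 : ℝ) : ℂ) ^ 2 / 2) ∂P := by
    have e2 : Integrable (fun ω => ((θ.1 * X ω 0 + θ.2 * X ω 1 : ℝ) : ℂ) ^ 2 / 2) P := by
      have := (hu2.ofReal (𝕜 := ℂ)).div_const 2
      simpa using this
    have e1 : Integrable (fun ω => ((θ.1 * X ω 0 + θ.2 * X ω 1 : ℝ) : ℂ) * Complex.I) P :=
      (hu.ofReal (𝕜 := ℂ)).mul_const _
    have e0 := integrable_chr (P := P) hX θ
    have e3 : Integrable (fun ω => chr θ (X ω) - 1) P := e0.sub (integrable_const _)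
    have e4 : Integrable (fun ω => chr θ (X ω) - 1 -
      ((θ.1 * X ω 0 + θ.2 * X ω 1 : ℝ) : ℂ) * Complex.I) P := e3.sub e1
    rw [integral_add e4 e2, integral_sub e3 e1, integral_sub e0 (integrable_const _),
      integral_mul_const, integral_complex_ofReal, hmean', integral_div]
    simp_rw [← Complex.ofReal_pow]
    rw [integral_complex_ofReal, ← quadForm_covMatrix hL2 hmean, chf]
    simp
    ring
  rw [key]
  have hint : Integrable (fun ω => (|(X ω 0 : ℝ)| + |(X ω 1 : ℝ)|) ^ 2 *
      min 1 (|h| * (|(X ω 0 : ℝ)| + |(X ω 1 : ℝ)|))) P := by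
    have hint : Integrable (fun ω => (|(X ω 0 : ℝ)| + |(X ω 1 : ℝ)|) ^ 2) P :=
      ((hL2 0).abs.add (hL2 1).abs).integrable_sq
    refine hint.mono ?_ (ae_of_all _ fun ω => ?_)
    · have hX' : ∀ c, Measurable fun ω => (X ω c : ℝ) := fun c =>
        (measurable_of_countable (fun v : Fin 2 → ℤ => ((v c : ℤ) : ℝ))).comp hX
      have hX0 := hX' 0
      have hX1 := hX' 1
      have : Measurable fun ω => (|(X ω 0 : ℝ)| + |(X ω 1 : ℝ)|) ^ 2 *
        min 1 (|h| * (|(X ω 0 : ℝ)| + |(X ω 1 : ℝ)|)) := by fun_prop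
      exact this.aestronglyMeasurable
    · rw [Real.norm_of_nonneg (by positivity), Real.norm_of_nonneg (by positivity)]
      exact mul_le_of_le_one_right (by positivity) (min_le_left _ _)
  have hb : ‖∫ ω, (chr θ (X ω) - 1 - ((θ.1 * X ω 0 + θ.2 * X ω 1 : ℝ) : ℂ) * Complex.I +
        ((θ.1 * X ω 0 + θ.2 * X ω 1 : ℝ) : ℂ) ^ 2 / 2) ∂P‖ ≤
      ∫ ω, 4 * h ^ 2 * ((|(X ω 0 : ℝ)| + |(X ω 1 : ℝ)|) ^ 2 *
      min 1 (|h| * (|(X ω 0 : ℝ)| + |(X ω 1 : ℝ)|))) ∂P := by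
    refine norm_integral_le_of_norm_le (hint.const_mul _) (ae_of_all _ fun ω => ?_)
    refine (norm_exp_mul_I_taylor_le _).trans ?_
    have habs : |θ.1 * (X ω 0 : ℝ) + θ.2 * (X ω 1 : ℝ)| ≤
        h * (|(X ω 0 : ℝ)| + |(X ω 1 : ℝ)|) := by
      refine (abs_add_le _ _).trans ?_
      rw [abs_mul, abs_mul, mul_add]
      gcongr
      · exact le_max_left _ _
      · exact le_max_right _ _
    have hsq : (θ.1 * (X ω 0 : ℝ) + θ.2 * (X ω 1 : ℝ)) ^ 2 ≤
        h ^ 2 * (|(X ω 0 : ℝ)| + |(X ω 1 : ℝ)|) ^ 2 := by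
      rw [← mul_pow, ← sq_abs]
      gcongr
    rw [abs_of_nonneg hnn]
    calc _ ≤ 4 * (h ^ 2 * (|(X ω 0 : ℝ)| + |(X ω 1 : ℝ)|) ^ 2) *
          min 1 (h * (|(X ω 0 : ℝ)| + |(X ω 1 : ℝ)|)) := by gcongr
      _ = _ := by ring
  refine hb.trans ?_
  rw [integral_const_mul]
  have hh2 : h ^ 2 ≤ θ.1 ^ 2 + θ.2 ^ 2 := by
    rcases max_cases |θ.1| |θ.2| with ⟨e, _⟩ | ⟨e, _⟩ <;> rw [hh, e, sq_abs] <;>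
      nlinarith [sq_nonneg θ.1, sq_nonneg θ.2]
  calc 4 * h ^ 2 * _ ≤ 4 * h ^ 2 * (η / 4) := by gcongr
    _ = η * h ^ 2 := by ring
    _ ≤ _ := by gcongr

end Step

end QuenchedRW

/-! ### The characteristic function near the origin and away from it -/

namespace QuenchedRW

section Step

variable {Ω : Type*} [MeasurableSpace Ω] {P : Measure Ω} {X : Ω → Fin 2 → ℤ}

/-- Gaussian control of a characteristic function near the origin. -/
theorem exists_chf_near [IsProbabilityMeasure P] (hX : Measurable X)
    (hL2 : ∀ c : Fin 2, MemLp (fun ω => (X ω c : ℝ)) 2 P)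
    (hmean : ∀ c : Fin 2, ∫ ω, (X ω c : ℝ) ∂P = 0) (hcov : (covMatrix P X).det ≠ 0) :
    ∃ c > 0, (∀ θ : ℝ × ℝ, c * (θ.1 ^ 2 + θ.2 ^ 2) ≤ quadForm (covMatrix P X) θ / 2) ∧
      ∀ η > 0, ∃ δ > 0, δ ≤ 1 ∧ ∀ θ : ℝ × ℝ, |θ.1| ≤ δ → |θ.2| ≤ δ →
        ‖chf P X θ‖ ≤ Real.exp (-(c * (θ.1 ^ 2 + θ.2 ^ 2))) ∧
        ‖chf P X θ - (Real.exp (-(quadForm (covMatrix P X) θ / 2)) : ℝ)‖ ≤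
          η * (θ.1 ^ 2 + θ.2 ^ 2) := by
  obtain ⟨c₀, hc₀, hlow⟩ := exists_quadForm_lower hL2 hmean hcov
  obtain ⟨C, hC, hup⟩ := exists_quadForm_upper (covMatrix P X)
  refine ⟨c₀ / 4, by positivity, fun θ => ?_, fun η hη => ?_⟩
  · have := hlow θ
    have : 0 ≤ c₀ * (θ.1 ^ 2 + θ.2 ^ 2) := by positivity
    linarith
  obtain ⟨δ₀, hδ₀, hT⟩ := exists_chf_taylor (P := P) hX hL2 hmean
    (η := min (η / 2) (c₀ / 4)) (by positivity)
  -- `κ` bounds the form `q` on the box. The bound `κ ≤ 1` keeps `1 - q / 2` nonnegative and the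
  -- expansion of `exp` valid; `κ ≤ η / (2 * C)` makes the quadratic remainder at most half of the
  -- allowed error `η * r`.
  set κ := min 1 (η / (2 * C)) with hκ
  have hκ0 : 0 < κ := by positivity
  refine ⟨min (min 1 δ₀) (min (1 / (2 * C)) (κ / (2 * C))), by positivity,
    (min_le_left _ _).trans (min_le_left _ _), fun θ h1 h2 => ?_⟩
  set r := θ.1 ^ 2 + θ.2 ^ 2 with hr
  set q := quadForm (covMatrix P X) θ with hq
  have hr0 : 0 ≤ r := by positivity
  have hδ1 : min (min 1 δ₀) (min (1 / (2 * C)) (κ / (2 * C))) ≤ δ₀ :=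
    (min_le_left _ _).trans (min_le_right _ _)
  have ht := hT θ (h1.trans hδ1) (h2.trans hδ1)
  rw [← hr, ← hq] at ht
  have sq_le : ∀ x : ℝ, |x| ≤ min (min 1 δ₀) (min (1 / (2 * C)) (κ / (2 * C))) →
      x ^ 2 ≤ κ / (2 * C) := by
    intro x hx
    have hx1 : |x| ≤ 1 := hx.trans ((min_le_left _ _).trans (min_le_left _ _))
    have hx2 : |x| ≤ κ / (2 * C) := hx.trans ((min_le_right _ _).trans (min_le_right _ _))
    rw [← sq_abs]
    nlinarith [abs_nonneg x]
  have hrC : C * r ≤ κ := by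
    have e1 := sq_le _ h1
    have e2 := sq_le _ h2
    have : r ≤ κ / C := by
      have : κ / (2 * C) + κ / (2 * C) = κ / C := by field_simp; ring
      linarith
    calc C * r ≤ C * (κ / C) := by gcongr
      _ = κ := by field_simp
  have hqu : q ≤ C * r := hup θ
  have hql : c₀ * r ≤ q := hlow θ
  have hq0 : 0 ≤ q := le_trans (by positivity) hql
  have hκ1 : κ ≤ 1 := min_le_left _ _
  have hκ2 : κ * (2 * C) ≤ η := by
    calc κ * (2 * C) ≤ η / (2 * C) * (2 * C) := by gcongr; exact min_le_right _ _
      _ = η := by field_simp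
  constructor
  -- The main term loses `q / 2 ≥ c₀ * r / 2`. The Taylor error costs at most `c₀ * r / 4`, which
  -- leaves a net decay of `c₀ * r / 4`.
  · have h3 : ‖chf P X θ‖ ≤ ‖((1 - q / 2 : ℝ) : ℂ)‖ + c₀ / 4 * r := by
      have e : chf P X θ = ((1 - q / 2 : ℝ) : ℂ) + (chf P X θ - ((1 - q / 2 : ℝ) : ℂ)) := by ring
      rw [e]
      refine (norm_add_le _ _).trans ?_
      gcongr
      exact ht.trans (by gcongr; exact min_le_right _ _)
    rw [Complex.norm_real, Real.norm_of_nonneg (by linarith)] at h3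
    have h4 := Real.add_one_le_exp (-(c₀ / 4 * r))
    linarith
  · have h5 : |Real.exp (-(q / 2)) - 1 - (-(q / 2))| ≤ (-(q / 2)) ^ 2 :=
      Real.abs_exp_sub_one_sub_id_le (by rw [abs_neg, abs_of_nonneg (by positivity)]; linarith)
    have h6 : (-(q / 2)) ^ 2 ≤ η / 2 * r := by
      have : q ^ 2 ≤ κ * (C * r) := by
        rw [sq]
        exact mul_le_mul (hqu.trans hrC) hqu hq0 hκ0.le
      have : κ * (C * r) = κ * (2 * C) * r / 2 := by ring
      have : κ * (2 * C) * r ≤ η * r := by gcongr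
      nlinarith [mul_nonneg hη.le hr0]
    have e : chf P X θ - (Real.exp (-(q / 2)) : ℝ) = (chf P X θ - ((1 - q / 2 : ℝ) : ℂ)) -
        ((Real.exp (-(q / 2)) - 1 - (-(q / 2)) : ℝ) : ℂ) := by push_cast; ring
    rw [e]
    refine (norm_sub_le _ _).trans ?_
    rw [Complex.norm_real, Real.norm_eq_abs]
    have : ‖chf P X θ - ((1 - q / 2 : ℝ) : ℂ)‖ ≤ η / 2 * r :=
      ht.trans (by gcongr; exact min_le_left _ _)
    linarith

/-- The values lie on the unit circle, and `1` is an extreme point of the disc: a mean equal to `1`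
forces almost every value to be `1`. -/
theorem chr_eq_one_of_chf_eq_one [IsProbabilityMeasure P] (hX : Measurable X) {θ : ℝ × ℝ}
    (h : chf P X θ = 1) : ∀ᵐ ω ∂P, chr θ (X ω) = 1 := by
  have hint := integrable_chr (P := P) hX θ
  have h0 : ∫ ω, (1 - (chr θ (X ω)).re) ∂P = 0 := by
    have hre : Integrable (fun ω => (chr θ (X ω)).re) P := hint.re
    have : ∫ ω, (chr θ (X ω)).re ∂P = (chf P X θ).re := integral_re hint
    rw [integral_sub (integrable_const _) hre, this, h]
    simp
  have hre : ∀ ω, (chr θ (X ω)).re ≤ 1 := fun ω =>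
    (Complex.re_le_norm _).trans (norm_chr _ _).le
  rw [integral_eq_zero_iff_of_nonneg (fun ω => sub_nonneg.2 (hre ω))
    ((integrable_const _).sub hint.re)] at h0
  filter_upwards [h0] with ω hω
  have h1 : (chr θ (X ω)).re = 1 := (sub_eq_zero.1 hω).symm
  have h2 := Complex.sq_norm_sub_sq_re (chr θ (X ω))
  rw [norm_chr, h1] at h2
  refine Complex.ext h1 ?_
  simpa using h2.symm

/-- The vectors on which the character `θ` is trivial form a subgroup. It contains every vector of
positive probability, hence is everything by aperiodicity; the two basis vectors then force both
coordinates of `θ` to vanish. -/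
theorem eq_zero_of_chf_eq_one [IsProbabilityMeasure P] (hX : Measurable X)
    (haper : IsAperiodic P X) {θ : ℝ × ℝ} (hθ : θ ∈ dualBox) (h : chf P X θ = 1) : θ = 0 := by
  have hae := chr_eq_one_of_chf_eq_one hX h
  let K : AddSubgroup (Fin 2 → ℤ) :=
    { carrier := {l | chr θ l = 1}
      zero_mem' := chr_zero θ
      add_mem' := fun {a b} ha hb => by
        simp only [Set.mem_ofPred_eq] at *
        rw [chr_add, ha, hb, one_mul]
      neg_mem' := fun {a} ha => by
        simp only [Set.mem_ofPred_eq] at *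
        rw [chr_neg, ha, map_one] }
  have hK : K = ⊤ := by
    rw [eq_top_iff, ← haper, AddSubgroup.closure_le]
    intro l hl
    change chr θ l = 1
    by_contra hne
    have h0 : P {ω | X ω = l} = 0 := by
      refine measure_mono_null (fun ω hω => ?_) hae
      have : X ω = l := hω
      simpa [this] using hne
    exact (ne_of_gt hl) h0
  have hall : ∀ l, chr θ l = 1 := fun l => by
    have : l ∈ K := hK ▸ AddSubgroup.mem_top l
    exact this
  have hz : ∀ x : ℝ, x ∈ Set.Icc (-Real.pi) Real.pi →
      Complex.exp ((x : ℂ) * Complex.I) = 1 → x = 0 := by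
    intro x hx hx1
    obtain ⟨n, hn⟩ := Complex.exp_eq_one_iff.1 hx1
    have hn' : x = n * (2 * Real.pi) := by
      have : (x : ℂ) * Complex.I = ((n * (2 * Real.pi) : ℝ) : ℂ) * Complex.I := by
        rw [hn]; push_cast; ring
      exact_mod_cast mul_right_cancel₀ Complex.I_ne_zero this
    have hpi := Real.pi_pos
    rw [hn', Set.mem_Icc] at hx
    have h1 : (-1 : ℝ) < n := by nlinarith
    have h2 : (n : ℝ) < 1 := by nlinarith
    have h1' : -1 < n := by exact_mod_cast h1
    have h2' : n < 1 := by exact_mod_cast h2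
    have : n = 0 := by omega
    rw [hn', this]; simp
  refine Prod.ext (hz _ hθ.1 ?_) (hz _ hθ.2 ?_)
  · simpa [chr] using hall (Pi.single 0 1)
  · simpa [chr] using hall (Pi.single 1 1)

/-- Compactness and `eq_zero_of_chf_eq_one`. Only `1 - χ` is kept away from zero: for a walk such as
the simple one `|χ| = 1` also occurs off the origin. For this reason the far region is later treated
through whole geometric sums and never power by power. -/
theorem exists_chf_far [IsProbabilityMeasure P] (hX : Measurable X) (haper : IsAperiodic P X)
    {δ : ℝ} (hδ : 0 < δ) :
    ∃ c > 0, ∀ θ ∈ dualBox, ¬ (|θ.1| ≤ δ ∧ |θ.2| ≤ δ) → c ≤ ‖1 - chf P X θ‖ := by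
  set K : Set (ℝ × ℝ) := dualBox ∩ {θ | δ ≤ max |θ.1| |θ.2|} with hKdef
  have hK : IsCompact K :=
    isCompact_dualBox.inter_right (isClosed_le continuous_const (by fun_prop))
  have hmem : ∀ θ ∈ dualBox, ¬ (|θ.1| ≤ δ ∧ |θ.2| ≤ δ) → θ ∈ K := by
    intro θ hθ h
    refine ⟨hθ, ?_⟩
    rw [← max_le_iff, not_le] at h
    exact h.le
  have hcont : ContinuousOn (fun θ => ‖1 - chf P X θ‖) K :=
    (continuous_const.sub (continuous_chf hX)).norm.continuousOn
  rcases K.eq_empty_or_nonempty with he | hne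
  · exact ⟨1, one_pos, fun θ hθ h => absurd (hmem θ hθ h) (by simp [he])⟩
  · obtain ⟨θ₀, hθ₀, hmin⟩ := hK.exists_isMinOn hne hcont
    refine ⟨‖1 - chf P X θ₀‖, ?_, fun θ hθ h => hmin (hmem θ hθ h)⟩
    rw [gt_iff_lt, norm_pos_iff, sub_ne_zero]
    intro h1
    have := eq_zero_of_chf_eq_one hX haper hθ₀.1 h1.symm
    have h2 := hθ₀.2
    simp [this] at h2
    linarith

end Step

end QuenchedRW

/-! ### Gaussian integrals and elementary sums -/

namespace QuenchedRW

/-- The square `[-δ, δ]²`. -/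
def nearBox (δ : ℝ) : Set (ℝ × ℝ) := Set.Icc (-δ) δ ×ˢ Set.Icc (-δ) δ

theorem mem_nearBox {δ : ℝ} {θ : ℝ × ℝ} : θ ∈ nearBox δ ↔ |θ.1| ≤ δ ∧ |θ.2| ≤ δ := by
  simp only [nearBox, Set.mem_prod, Set.mem_Icc, abs_le]

theorem isCompact_nearBox (δ : ℝ) : IsCompact (nearBox δ) := isCompact_Icc.prod isCompact_Icc

theorem nearBox_subset_dualBox {δ : ℝ} (hδ : δ ≤ 1) : nearBox δ ⊆ dualBox := by
  have h : Set.Icc (-δ) δ ⊆ Set.Icc (-Real.pi) Real.pi :=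
    Set.Icc_subset_Icc (by linarith [Real.pi_gt_three]) (by linarith [Real.pi_gt_three])
  exact Set.prod_mono h h

theorem integrable_exp_neg_mul_normSq {a : ℝ} (ha : 0 < a) :
    Integrable (fun θ : ℝ × ℝ => Real.exp (-(a * (θ.1 ^ 2 + θ.2 ^ 2)))) := by
  have h := (integrable_exp_neg_mul_sq ha).mul_prod (integrable_exp_neg_mul_sq ha)
  rw [← Measure.volume_eq_prod] at h
  refine h.congr (ae_of_all _ fun θ => ?_)
  simp only [← Real.exp_add]
  ring_nf

theorem integral_exp_neg_mul_normSq {a : ℝ} (ha : 0 < a) :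
    ∫ θ : ℝ × ℝ, Real.exp (-(a * (θ.1 ^ 2 + θ.2 ^ 2))) = Real.pi / a := by
  have h : ∀ θ : ℝ × ℝ, Real.exp (-(a * (θ.1 ^ 2 + θ.2 ^ 2))) =
      Real.exp (-a * θ.1 ^ 2) * Real.exp (-a * θ.2 ^ 2) := fun θ => by
    rw [← Real.exp_add]; ring_nf
  simp_rw [h]
  rw [Measure.volume_eq_prod, integral_prod_mul (fun x : ℝ => Real.exp (-a * x ^ 2))
    (fun x : ℝ => Real.exp (-a * x ^ 2)), integral_gaussian]
  exact Real.mul_self_sqrt (by positivity)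

theorem integrable_exp_neg_quadForm {S : Matrix (Fin 2) (Fin 2) ℝ} {c : ℝ} (hc : 0 < c)
    (hS : ∀ θ : ℝ × ℝ, c * (θ.1 ^ 2 + θ.2 ^ 2) ≤ quadForm S θ / 2) {m : ℝ} (hm : 0 < m) :
    Integrable (fun θ : ℝ × ℝ => Real.exp (-(m * (quadForm S θ / 2)))) := by
  have hcont := continuous_quadForm S
  refine (integrable_exp_neg_mul_normSq (mul_pos hm hc)).mono'
    (by fun_prop) (ae_of_all _ fun θ => ?_)
  rw [Real.norm_of_nonneg (Real.exp_pos _).le, mul_assoc]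
  gcongr
  exact hS θ

theorem integral_exp_neg_quadForm {S : Matrix (Fin 2) (Fin 2) ℝ} (hsymm : S 1 0 = S 0 1)
    (hdet : 0 < S.det) (hd : 0 < S 1 1) {c : ℝ} (hc : 0 < c)
    (hS : ∀ θ : ℝ × ℝ, c * (θ.1 ^ 2 + θ.2 ^ 2) ≤ quadForm S θ / 2) {m : ℝ} (hm : 0 < m) :
    ∫ θ : ℝ × ℝ, Real.exp (-(m * (quadForm S θ / 2))) = 2 * Real.pi / (m * √S.det) := by
  have hD : S.det = S 0 0 * S 1 1 - S 0 1 ^ 2 := by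
    rw [Matrix.det_fin_two, hsymm]; ring
  have hi := integrable_exp_neg_quadForm hc hS hm
  rw [Measure.volume_eq_prod] at hi ⊢
  rw [integral_prod _ hi]
  have hinner : ∀ x : ℝ, ∫ y : ℝ, Real.exp (-(m * (quadForm S (x, y) / 2))) =
      Real.exp (-(m * S.det / (2 * S 1 1)) * x ^ 2) * √(Real.pi / (m * S 1 1 / 2)) := by
    intro x
    -- Completing the square in `y` leaves `det S / S 1 1` as the coefficient of `x²`.
    have h : ∀ y : ℝ, Real.exp (-(m * (quadForm S (x, y) / 2))) =
        Real.exp (-(m * S.det / (2 * S 1 1)) * x ^ 2) *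
          Real.exp (-(m * S 1 1 / 2) * (y + S 0 1 * x / S 1 1) ^ 2) := by
      intro y
      rw [← Real.exp_add]
      congr 1
      rw [hD, quadForm]
      field_simp
      ring
    simp_rw [h]
    rw [integral_const_mul, integral_add_right_eq_self
      (fun y : ℝ => Real.exp (-(m * S 1 1 / 2) * y ^ 2)), integral_gaussian]
  simp_rw [hinner]
  rw [integral_mul_const, integral_gaussian, ← Real.sqrt_mul (by positivity)]
  have : Real.pi / (m * S.det / (2 * S 1 1)) * (Real.pi / (m * S 1 1 / 2)) =
      (2 * Real.pi / m) ^ 2 / S.det := by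
    field_simp
  rw [this, Real.sqrt_div (by positivity), Real.sqrt_sq (by positivity)]
  field_simp

theorem norm_pow_sub_pow_le {x y : ℂ} {B : ℝ} (hx : ‖x‖ ≤ B) (hy : ‖y‖ ≤ B) (m : ℕ) :
    ‖x ^ (m + 1) - y ^ (m + 1)‖ ≤ (m + 1) * B ^ m * ‖x - y‖ := by
  have hB : 0 ≤ B := (norm_nonneg _).trans hx
  induction m with
  | zero => simp
  | succ m ih =>
    have e : x ^ (m + 1 + 1) - y ^ (m + 1 + 1) =
        x * (x ^ (m + 1) - y ^ (m + 1)) + (x - y) * y ^ (m + 1) := by ring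
    rw [e]
    refine (norm_add_le _ _).trans ?_
    rw [norm_mul, norm_mul, norm_pow]
    calc ‖x‖ * ‖x ^ (m + 1) - y ^ (m + 1)‖ + ‖x - y‖ * ‖y‖ ^ (m + 1)
        ≤ B * ((m + 1) * B ^ m * ‖x - y‖) + ‖x - y‖ * B ^ (m + 1) := by gcongr
      _ = _ := by push_cast; ring

theorem norm_chr_sub_one_le (θ : ℝ × ℝ) (l : Fin 2 → ℤ) :
    ‖chr θ l - 1‖ ≤ |θ.1| * |(l 0 : ℝ)| + |θ.2| * |(l 1 : ℝ)| := by
  rw [chr, mul_comm]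
  refine Real.norm_exp_I_mul_ofReal_sub_one_le.trans ?_
  rw [Real.norm_eq_abs, ← abs_mul, ← abs_mul]
  exact abs_add_le _ _

theorem norm_geom_sum_le {x : ℂ} (hx : ‖x‖ ≤ 1) {c : ℝ} (hc : 0 < c) (h : c ≤ ‖1 - x‖) (n : ℕ) :
    ‖∑ m ∈ Finset.range n, x ^ m‖ ≤ 2 / c := by
  have h1 : (∑ m ∈ Finset.range n, x ^ m) * (1 - x) = 1 - x ^ n := geom_sum_mul_neg x n
  have h2 : ‖(1 : ℂ) - x ^ n‖ ≤ 2 := by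
    refine (norm_sub_le _ _).trans ?_
    rw [norm_one, norm_pow]
    linarith [pow_le_one₀ (n := n) (norm_nonneg x) hx]
  rw [← h1, norm_mul] at h2
  rw [le_div_iff₀ hc]
  exact (mul_le_mul_of_nonneg_left h (norm_nonneg _)).trans h2

/-- Going from `n` to `n + 1` adds a row, a column and a corner, each of total at most `1`. The pair
`(0, 0)` contributes nothing because `0⁻¹ = 0`; it is accounted for separately where the bound is
used. -/
theorem sum_inv_add_le (n : ℕ) :
    ∑ i ∈ Finset.range n, ∑ j ∈ Finset.range n, ((i : ℝ) + j)⁻¹ ≤ 3 * n := by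
  induction n with
  | zero => simp
  | succ n ih =>
    rw [Finset.sum_range_succ]
    simp_rw [Finset.sum_range_succ _ n]
    rw [Finset.sum_add_distrib]
    have h1 : ∑ i ∈ Finset.range n, ((i : ℝ) + n)⁻¹ ≤ 1 := by
      rcases Nat.eq_zero_or_pos n with rfl | hn
      · simp
      have hn' : (0 : ℝ) < n := by exact_mod_cast hn
      calc ∑ i ∈ Finset.range n, ((i : ℝ) + n)⁻¹ ≤ ∑ i ∈ Finset.range n, (n : ℝ)⁻¹ := by
            gcongr with i
            linarith [Nat.cast_nonneg (α := ℝ) i]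
        _ = 1 := by simp; field_simp
    have h2 : ∑ j ∈ Finset.range n, ((n : ℝ) + j)⁻¹ ≤ 1 := by
      simpa only [add_comm] using h1
    have h3 : ((n : ℝ) + n)⁻¹ ≤ 1 := by
      rcases Nat.eq_zero_or_pos n with rfl | hn
      · simp
      have hn' : (1 : ℝ) ≤ n := by exact_mod_cast hn
      exact inv_le_one_of_one_le₀ (by linarith)
    push_cast
    linarith

end QuenchedRW

/-! ### Powers of the characteristic function against Gaussians -/

namespace QuenchedRW

/-- In the application `r = |θ|²`, `q` is half the covariance form and `w` is a character value.
Telescoping the power costs a factor `(m + 1) * r`, absorbed by half of the Gaussian decay through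
`x * exp (-x) ≤ 1`; the other half survives to be integrated. The factor `exp (2 * c)` pays for
replacing the exponent `m` by `m + 1`, using `r ≤ 2`. -/
theorem norm_pow_mul_sub_exp_le {x w : ℂ} {c r q η : ℝ} (hc : 0 < c) (hr : 0 ≤ r) (hr2 : r ≤ 2)
    (hη : 0 ≤ η) (hx : ‖x‖ ≤ Real.exp (-(c * r))) (hq : c * r ≤ q)
    (hxq : ‖x - (Real.exp (-q) : ℝ)‖ ≤ η * r) (hw : ‖w‖ = 1) (hw1 : ‖w - 1‖ ≤ η) (m : ℕ) :
    ‖x ^ (m + 1) * w - (Real.exp (-((m + 1 : ℕ) * q)) : ℝ)‖ ≤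
      η * (2 * Real.exp (2 * c) / c + 1) * Real.exp (-(c * (m + 1 : ℕ) / 2 * r)) := by
  set y : ℂ := ((Real.exp (-q) : ℝ) : ℂ) with hy
  set M : ℝ := ((m + 1 : ℕ) : ℝ) with hM
  have hM1 : M = m + 1 := by rw [hM]; push_cast; ring
  have hMpos : 0 < M := by rw [hM1]; positivity
  have hynorm : ‖y‖ ≤ Real.exp (-(c * r)) := by
    rw [hy, Complex.norm_real, Real.norm_of_nonneg (Real.exp_pos _).le]
    gcongr
  have hypow : y ^ (m + 1) = (Real.exp (-(M * q)) : ℝ) := by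
    rw [hy, ← Complex.ofReal_pow, ← Real.exp_nat_mul]
    congr 2
    rw [hM]; ring
  have h1 : ‖x ^ (m + 1) - y ^ (m + 1)‖ ≤
      η * (2 * Real.exp (2 * c) / c) * Real.exp (-(c * M / 2 * r)) := by
    refine (norm_pow_sub_pow_le hx hynorm m).trans ?_
    rw [← hM1, ← Real.exp_nat_mul]
    have h2 : Real.exp ((m : ℝ) * -(c * r)) ≤
        Real.exp (2 * c) * (Real.exp (-(c * M / 2 * r)) * Real.exp (-(c * M / 2 * r))) := by
      rw [← Real.exp_add, ← Real.exp_add]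
      gcongr
      rw [hM1]
      nlinarith
    have h3 : c * M / 2 * r * Real.exp (-(c * M / 2 * r)) ≤ 1 := by
      have := Real.add_one_le_exp (c * M / 2 * r)
      rw [Real.exp_neg, ← div_eq_mul_inv, div_le_one (Real.exp_pos _)]
      linarith
    calc M * Real.exp ((m : ℝ) * -(c * r)) * ‖x - y‖
        ≤ M * (Real.exp (2 * c) * (Real.exp (-(c * M / 2 * r)) * Real.exp (-(c * M / 2 * r)))) *
          (η * r) := by gcongr
      _ = η * (2 * Real.exp (2 * c) / c) * Real.exp (-(c * M / 2 * r)) *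
          (c * M / 2 * r * Real.exp (-(c * M / 2 * r))) := by field_simp
      _ ≤ η * (2 * Real.exp (2 * c) / c) * Real.exp (-(c * M / 2 * r)) * 1 := by gcongr
      _ = _ := mul_one _
  have h4 : ‖y ^ (m + 1) * (w - 1)‖ ≤ η * Real.exp (-(c * M / 2 * r)) := by
    rw [norm_mul, hypow, Complex.norm_real, Real.norm_of_nonneg (Real.exp_pos _).le, mul_comm]
    refine mul_le_mul hw1 (Real.exp_le_exp.2 ?_) (Real.exp_pos _).le hη
    nlinarith [mul_le_mul_of_nonneg_left hq hMpos.le, mul_nonneg hMpos.le (mul_nonneg hc.le hr)]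
  have e : x ^ (m + 1) * w - (Real.exp (-(M * q)) : ℝ) =
      (x ^ (m + 1) - y ^ (m + 1)) * w + y ^ (m + 1) * (w - 1) := by rw [← hypow]; ring
  rw [e]
  refine (norm_add_le _ _).trans ?_
  rw [norm_mul, hw, mul_one]
  calc _ ≤ η * (2 * Real.exp (2 * c) / c) * Real.exp (-(c * M / 2 * r)) +
        η * Real.exp (-(c * M / 2 * r)) := add_le_add h1 h4
    _ = _ := by ring

theorem setIntegral_exp_neg_mul_normSq_le {a : ℝ} (ha : 0 < a) (s : Set (ℝ × ℝ)) :
    ∫ θ in s, Real.exp (-(a * (θ.1 ^ 2 + θ.2 ^ 2))) ≤ Real.pi / a := by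
  rw [← integral_exp_neg_mul_normSq ha]
  exact setIntegral_le_integral (integrable_exp_neg_mul_normSq ha)
    (ae_of_all _ fun θ => (Real.exp_pos _).le)

/-- Half of the exponent is estimated by its value at `|θ|² = δ²`, the other half is integrated. The
resulting tails are summable in `m`. -/
theorem integral_compl_nearBox_exp_neg_quadForm_le {S : Matrix (Fin 2) (Fin 2) ℝ} {c : ℝ}
    (hc : 0 < c) (hS : ∀ θ : ℝ × ℝ, c * (θ.1 ^ 2 + θ.2 ^ 2) ≤ quadForm S θ / 2) {m : ℝ}
    (hm : 1 ≤ m) {δ : ℝ} (hδ : 0 < δ) :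
    ∫ θ in (nearBox δ)ᶜ, Real.exp (-(m * (quadForm S θ / 2))) ≤
      2 * Real.pi / c * Real.exp (-(c * δ ^ 2 / 2 * m)) := by
  have hm0 : 0 < m := by linarith
  have ha : 0 < c * m / 2 := by positivity
  have h1 : ∫ θ in (nearBox δ)ᶜ, Real.exp (-(m * (quadForm S θ / 2))) ≤
      ∫ θ in (nearBox δ)ᶜ, Real.exp (-(c * δ ^ 2 / 2 * m)) *
        Real.exp (-(c * m / 2 * (θ.1 ^ 2 + θ.2 ^ 2))) := by
    refine setIntegral_mono_on (integrable_exp_neg_quadForm hc hS hm0).integrableOn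
      ((integrable_exp_neg_mul_normSq ha).const_mul _).integrableOn
      (isCompact_nearBox δ).measurableSet.compl fun θ hθ => ?_
    rw [← Real.exp_add]
    gcongr
    have hr : δ ^ 2 ≤ θ.1 ^ 2 + θ.2 ^ 2 := by
      rw [Set.mem_compl_iff, mem_nearBox, not_and_or, not_le, not_le] at hθ
      rcases hθ with h | h
      · nlinarith [sq_abs θ.1, sq_nonneg θ.2]
      · nlinarith [sq_abs θ.2, sq_nonneg θ.1]
    have h2 := mul_le_mul_of_nonneg_left (hS θ) hm0.le
    have h3 := mul_le_mul_of_nonneg_left hr (show 0 ≤ c * m / 2 by positivity)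
    nlinarith
  refine h1.trans ?_
  rw [integral_const_mul, mul_comm]
  gcongr
  refine (setIntegral_exp_neg_mul_normSq_le ha _).trans ?_
  rw [div_le_div_iff₀ ha hc]
  nlinarith [mul_pos Real.pi_pos hc]

theorem sum_exp_neg_mul_le {a : ℝ} (ha : 0 < a) (n : ℕ) :
    ∑ m ∈ Finset.range n, Real.exp (-(a * (m + 1 : ℕ))) ≤ (1 - Real.exp (-a))⁻¹ := by
  have h1 : Real.exp (-a) < 1 := by rw [Real.exp_lt_one_iff]; linarith
  have h : ∀ m : ℕ, Real.exp (-(a * (m + 1 : ℕ))) ≤ Real.exp (-a) ^ m := by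
    intro m
    rw [← Real.exp_nat_mul]
    gcongr
    push_cast
    nlinarith
  refine (Finset.sum_le_sum fun m _ => h m).trans ?_
  rw [← tsum_geometric_of_lt_one (Real.exp_pos _).le h1]
  exact (summable_geometric_of_lt_one (Real.exp_pos _).le h1).sum_le_tsum _
    fun _ _ => by positivity

section Step

variable {Ω : Type*} [MeasurableSpace Ω] {P : Measure Ω} {X : Ω → Fin 2 → ℤ}

theorem integrableOn_chf_pow [IsProbabilityMeasure P] (hX : Measurable X) (m : ℕ)
    (l : Fin 2 → ℤ) {s : Set (ℝ × ℝ)} (hs : IsCompact s) :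
    IntegrableOn (fun θ => chf P X θ ^ m * chr θ l) s :=
  (((continuous_chf hX).pow m).mul (continuous_chr l)).continuousOn.integrableOn_compact hs

theorem volume_dualBox_real : (volume : Measure (ℝ × ℝ)).real dualBox = (2 * Real.pi) ^ 2 := by
  rw [dualBox, Measure.volume_eq_prod, measureReal_prod_prod, Real.volume_real_Icc_of_le
    (by linarith [Real.pi_pos])]
  ring

theorem norm_setIntegral_geom_le [IsProbabilityMeasure P] {δ c : ℝ} (hc : 0 < c)
    (hfar : ∀ θ ∈ dualBox, ¬ (|θ.1| ≤ δ ∧ |θ.2| ≤ δ) → c ≤ ‖1 - chf P X θ‖)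
    (l : Fin 2 → ℤ) (n : ℕ) :
    ‖∫ θ in dualBox \ nearBox δ, (∑ m ∈ Finset.range n, chf P X θ ^ m) * chr θ l‖ ≤
      2 / c * (2 * Real.pi) ^ 2 := by
  have hfin : (volume : Measure (ℝ × ℝ)) (dualBox \ nearBox δ) < ⊤ :=
    (measure_mono Set.sdiff_subset).trans_lt isCompact_dualBox.measure_lt_top
  refine (norm_setIntegral_le_of_norm_le_const (C := 2 / c) hfin fun θ hθ => ?_).trans ?_
  · rw [norm_mul, norm_chr, mul_one]
    exact norm_geom_sum_le (norm_chf_le _ _) hc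
      (hfar θ hθ.1 fun h => hθ.2 (mem_nearBox.2 h)) n
  · rw [← volume_dualBox_real]
    gcongr
    · exact isCompact_dualBox.measure_lt_top.ne
    · exact Set.sdiff_subset

end Step

end QuenchedRW

/-! ### Fourier integrals of the Green function -/

namespace QuenchedRW

section Step

variable {Ω : Type*} [MeasurableSpace Ω] {P : Measure Ω} {X : Ω → Fin 2 → ℤ}

/-- Main term of the Green function of a planar walk, in terms of its characteristic function. -/
theorem exists_norm_integral_geom_sub_le [IsProbabilityMeasure P] (hX : Measurable X)
    (haper : IsAperiodic P X) (hL2 : ∀ c : Fin 2, MemLp (fun ω => (X ω c : ℝ)) 2 P)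
    (hmean : ∀ c : Fin 2, ∫ ω, (X ω c : ℝ) ∂P = 0) (hcov : (covMatrix P X).det ≠ 0)
    (l : Fin 2 → ℤ) :
    ∃ C > 0, ∀ η > 0, ∃ K, ∀ n : ℕ,
      ‖(∫ θ in dualBox, (∑ m ∈ Finset.range (n + 1), chf P X θ ^ m) * chr θ l) -
        ((2 * Real.pi / √(covMatrix P X).det * ∑ m ∈ Finset.range n, ((m : ℝ) + 1)⁻¹ : ℝ) : ℂ)‖ ≤
        η * C * ∑ m ∈ Finset.range n, ((m : ℝ) + 1)⁻¹ + K := by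
  obtain ⟨c, hc, hlow, hnear⟩ := exists_chf_near (P := P) hX hL2 hmean hcov
  obtain ⟨hD, -, hd⟩ := covMatrix_det_pos hL2 hmean hcov
  have hsymm := covMatrix_symm (P := P) (X := X) hmean
  set S := covMatrix P X with hS
  set A : ℝ := 2 * Real.exp (2 * c) / c + 1 with hA
  have hA0 : 0 < A := by positivity
  -- This constant is fixed before `η`; only the additive `K` depends on `η`. Letting `η` tend to
  -- zero then makes the error negligible against the harmonic sum.
  refine ⟨A * (2 * Real.pi / c), by positivity, fun η hη => ?_⟩
  obtain ⟨δ₀, hδ₀, hδ₀1, hN₀⟩ := hnear η hη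
  set L : ℝ := |(l 0 : ℝ)| + |(l 1 : ℝ)| + 1 with hL
  have hL0 : 0 < L := by positivity
  -- The second bound keeps the character `chr θ l` within `η` of `1` on the box.
  set δ := min δ₀ (η / L) with hδdef
  have hδ : 0 < δ := by positivity
  have hδ1 : δ ≤ 1 := (min_le_left _ _).trans hδ₀1
  have hN : ∀ θ ∈ nearBox δ, ‖chf P X θ‖ ≤ Real.exp (-(c * (θ.1 ^ 2 + θ.2 ^ 2))) ∧
        ‖chf P X θ - (Real.exp (-(quadForm S θ / 2)) : ℝ)‖ ≤ η * (θ.1 ^ 2 + θ.2 ^ 2) ∧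
        ‖chr θ l - 1‖ ≤ η ∧ θ.1 ^ 2 + θ.2 ^ 2 ≤ 2 := by
    intro θ hθ
    obtain ⟨h1, h2⟩ := mem_nearBox.1 hθ
    obtain ⟨h3, h4⟩ := hN₀ θ (h1.trans (min_le_left _ _)) (h2.trans (min_le_left _ _))
    refine ⟨h3, h4, (norm_chr_sub_one_le θ l).trans ?_, ?_⟩
    · calc |θ.1| * |(l 0 : ℝ)| + |θ.2| * |(l 1 : ℝ)|
          ≤ η / L * |(l 0 : ℝ)| + η / L * |(l 1 : ℝ)| := by
            gcongr
            · exact h1.trans (min_le_right _ _)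
            · exact h2.trans (min_le_right _ _)
        _ ≤ η / L * L := by rw [← mul_add]; gcongr; rw [hL]; linarith
        _ = η := by field_simp
    · nlinarith [sq_abs θ.1, sq_abs θ.2, abs_nonneg θ.1, abs_nonneg θ.2, h1.trans hδ1, h2.trans hδ1]
  obtain ⟨c', hc', hfar⟩ := exists_chf_far (P := P) hX haper hδ
  set a : ℝ := c * δ ^ 2 / 2 with ha
  have ha0 : 0 < a := by positivity
  -- The three summands come from the geometric sum far from the origin, from the zeroth power on
  -- the near box, and from the Gaussian tails outside that box.
  refine ⟨2 / c' * (2 * Real.pi) ^ 2 + (2 * Real.pi) ^ 2 +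
    2 * Real.pi / c * (1 - Real.exp (-a))⁻¹, fun n => ?_⟩
  have hmsN : MeasurableSet (nearBox δ) := (isCompact_nearBox δ).measurableSet
  have hcontχ : Continuous (chf P X) := continuous_chf hX
  have hcontl := continuous_chr l
  have hterm : ∀ m : ℕ, ‖(∫ θ in nearBox δ, chf P X θ ^ (m + 1) * chr θ l) -
      ((2 * Real.pi / √S.det * ((m : ℝ) + 1)⁻¹ : ℝ) : ℂ)‖ ≤
      η * (A * (2 * Real.pi / c)) * ((m : ℝ) + 1)⁻¹ +
        2 * Real.pi / c * Real.exp (-(a * (m + 1 : ℕ))) := by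
    intro m
    have hm1 : (1 : ℝ) ≤ (m + 1 : ℕ) := by push_cast; linarith [Nat.cast_nonneg (α := ℝ) m]
    have hm0 : (0 : ℝ) < (m + 1 : ℕ) := by linarith
    have hgauss := integral_exp_neg_quadForm hsymm hD hd hc hlow hm0
    have hgi := integrable_exp_neg_quadForm hc hlow hm0
    have hsplit := integral_add_compl hmsN hgi
    rw [hgauss] at hsplit
    have hval : ((2 * Real.pi / √S.det * ((m : ℝ) + 1)⁻¹ : ℝ) : ℂ) =
        (∫ θ in nearBox δ, ((Real.exp (-((m + 1 : ℕ) * (quadForm S θ / 2))) : ℝ) : ℂ)) +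
        ((∫ θ in (nearBox δ)ᶜ, Real.exp (-((m + 1 : ℕ) * (quadForm S θ / 2))) : ℝ) : ℂ) := by
      rw [integral_complex_ofReal, ← Complex.ofReal_add, hsplit]
      congr 1
      push_cast
      field_simp
    have hi1 : IntegrableOn (fun θ => chf P X θ ^ (m + 1) * chr θ l) (nearBox δ) :=
      integrableOn_chf_pow hX _ _ (isCompact_nearBox δ)
    have hi2 : IntegrableOn (fun θ => ((Real.exp (-((m + 1 : ℕ) * (quadForm S θ / 2))) : ℝ) : ℂ))
        (nearBox δ) := hgi.integrableOn.ofReal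
    rw [hval, ← sub_sub, ← integral_sub hi1 hi2]
    refine (norm_sub_le _ _).trans (add_le_add ?_ ?_)
    · have hb : ‖∫ θ in nearBox δ, (chf P X θ ^ (m + 1) * chr θ l -
          ((Real.exp (-((m + 1 : ℕ) * (quadForm S θ / 2))) : ℝ) : ℂ))‖ ≤
          ∫ θ in nearBox δ, η * A *
            Real.exp (-(c * (m + 1 : ℕ) / 2 * (θ.1 ^ 2 + θ.2 ^ 2))) := by
        refine norm_integral_le_of_norm_le
          ((integrable_exp_neg_mul_normSq (by positivity)).const_mul _).integrableOn
          ((ae_restrict_iff' hmsN).2 (ae_of_all _ fun θ hθ => ?_))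
        obtain ⟨h3, h4, h5, h6⟩ := hN θ hθ
        exact norm_pow_mul_sub_exp_le hc (by positivity) h6 hη.le h3 (hlow θ) h4 (norm_chr _ _) h5 m
      refine hb.trans ?_
      rw [integral_const_mul]
      calc η * A * _ ≤ η * A * (Real.pi / (c * (m + 1 : ℕ) / 2)) := by
            gcongr
            exact setIntegral_exp_neg_mul_normSq_le (by positivity) _
        _ = _ := by push_cast; field_simp
    · rw [Complex.norm_real, Real.norm_of_nonneg (integral_nonneg fun θ => (Real.exp_pos _).le)]
      exact integral_compl_nearBox_exp_neg_quadForm_le hc hlow hm1 hδ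
  have hsum : ∫ θ in dualBox, (∑ m ∈ Finset.range (n + 1), chf P X θ ^ m) * chr θ l =
      (∫ θ in dualBox \ nearBox δ, (∑ m ∈ Finset.range (n + 1), chf P X θ ^ m) * chr θ l) +
      ((∑ m ∈ Finset.range n, ∫ θ in nearBox δ, chf P X θ ^ (m + 1) * chr θ l) +
        ∫ θ in nearBox δ, chr θ l) := by
    have hsub := nearBox_subset_dualBox hδ1
    have hic : IntegrableOn (fun θ => (∑ m ∈ Finset.range (n + 1), chf P X θ ^ m) * chr θ l)
        dualBox := by
      refine Continuous.continuousOn ?_ |>.integrableOn_compact isCompact_dualBox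
      fun_prop
    rw [← Set.sdiff_union_of_subset hsub, setIntegral_union Set.disjoint_sdiff_left hmsN
      (hic.mono_set Set.sdiff_subset) (hic.mono_set hsub), Set.sdiff_union_of_subset hsub]
    congr 1
    have e : ∀ θ, (∑ m ∈ Finset.range (n + 1), chf P X θ ^ m) * chr θ l =
        (∑ m ∈ Finset.range n, chf P X θ ^ (m + 1) * chr θ l) + chr θ l := by
      intro θ
      rw [Finset.sum_range_succ', pow_zero, add_mul, one_mul, Finset.sum_mul]
    simp_rw [e]
    rw [integral_add (integrable_finsetSum _ fun m _ =>
      integrableOn_chf_pow hX _ _ (isCompact_nearBox δ))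
      (hcontl.continuousOn.integrableOn_compact (isCompact_nearBox δ)),
      integral_finsetSum _ fun m _ => integrableOn_chf_pow hX _ _ (isCompact_nearBox δ)]
  have hzero : ‖∫ θ in nearBox δ, chr θ l‖ ≤ (2 * Real.pi) ^ 2 := by
    refine (norm_setIntegral_le_of_norm_le_const (C := 1)
      (isCompact_nearBox δ).measure_lt_top fun θ _ => (norm_chr _ _).le).trans ?_
    rw [← volume_dualBox_real, one_mul]
    exact measureReal_mono (nearBox_subset_dualBox hδ1) isCompact_dualBox.measure_lt_top.ne
  have hS1 : ‖(∑ m ∈ Finset.range n, ∫ θ in nearBox δ, chf P X θ ^ (m + 1) * chr θ l) -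
      ((2 * Real.pi / √S.det * ∑ m ∈ Finset.range n, ((m : ℝ) + 1)⁻¹ : ℝ) : ℂ)‖ ≤
      η * (A * (2 * Real.pi / c)) * ∑ m ∈ Finset.range n, ((m : ℝ) + 1)⁻¹ +
        2 * Real.pi / c * (1 - Real.exp (-a))⁻¹ := by
    rw [Finset.mul_sum, Complex.ofReal_sum, ← Finset.sum_sub_distrib]
    refine (norm_sum_le _ _).trans ((Finset.sum_le_sum fun m _ => hterm m).trans ?_)
    rw [Finset.sum_add_distrib, ← Finset.mul_sum, ← Finset.mul_sum]
    gcongr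
    exact sum_exp_neg_mul_le ha0 n
  rw [hsum]
  have e2 : ∀ u v w z : ℂ, u + (v + w) - z = u + ((v - z) + w) := fun u v w z => by ring
  rw [e2]
  refine (norm_add_le _ _).trans ?_
  have h1 := norm_setIntegral_geom_le (P := P) (X := X) hc' hfar l (n + 1)
  have h2 := norm_add_le ((∑ m ∈ Finset.range n, ∫ θ in nearBox δ, chf P X θ ^ (m + 1) * chr θ l) -
      ((2 * Real.pi / √S.det * ∑ m ∈ Finset.range n, ((m : ℝ) + 1)⁻¹ : ℝ) : ℂ))
      (∫ θ in nearBox δ, chr θ l)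
  linarith

/-- This is the Parseval side of `∑_x G_n(x)² = O(n)`. Near the origin the square is at most
`∑_{i,j} exp (-c (i + j) |θ|²)`, whose terms integrate to `O(1 / (i + j))` and sum to `O(n)`. Far
from the origin the integrand is bounded. -/
theorem exists_integral_norm_geom_sq_le [IsProbabilityMeasure P] (hX : Measurable X)
    (haper : IsAperiodic P X) (hL2 : ∀ c : Fin 2, MemLp (fun ω => (X ω c : ℝ)) 2 P)
    (hmean : ∀ c : Fin 2, ∫ ω, (X ω c : ℝ) ∂P = 0) (hcov : (covMatrix P X).det ≠ 0) :
    ∃ K > 0, ∀ n : ℕ,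
      ∫ θ in dualBox, ‖∑ m ∈ Finset.range n, chf P X θ ^ m‖ ^ 2 ≤ K * n := by
  obtain ⟨c, hc, hlow, hnear⟩ := exists_chf_near (P := P) hX hL2 hmean hcov
  obtain ⟨δ, hδ, hδ1, hN⟩ := hnear 1 one_pos
  obtain ⟨c', hc', hfar⟩ := exists_chf_far (P := P) hX haper hδ
  have hcontχ : Continuous (chf P X) := continuous_chf hX
  have hmsN : MeasurableSet (nearBox δ) := (isCompact_nearBox δ).measurableSet
  refine ⟨(2 / c') ^ 2 * (2 * Real.pi) ^ 2 + (2 * Real.pi) ^ 2 + Real.pi / c * 3, by positivity,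
    fun n => ?_⟩
  rcases Nat.eq_zero_or_pos n with rfl | hn
  · simp
  have hn1 : (1 : ℝ) ≤ n := by exact_mod_cast hn
  have hsub := nearBox_subset_dualBox hδ1
  have hic : IntegrableOn (fun θ => ‖∑ m ∈ Finset.range n, chf P X θ ^ m‖ ^ 2) dualBox := by
    refine Continuous.continuousOn ?_ |>.integrableOn_compact isCompact_dualBox
    fun_prop
  rw [← Set.sdiff_union_of_subset hsub, setIntegral_union Set.disjoint_sdiff_left hmsN
      (hic.mono_set Set.sdiff_subset) (hic.mono_set hsub)]
  have hF : ∫ θ in dualBox \ nearBox δ, ‖∑ m ∈ Finset.range n, chf P X θ ^ m‖ ^ 2 ≤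
      (2 / c') ^ 2 * (2 * Real.pi) ^ 2 := by
    have hfin : (volume : Measure (ℝ × ℝ)) (dualBox \ nearBox δ) < ⊤ :=
      (measure_mono Set.sdiff_subset).trans_lt isCompact_dualBox.measure_lt_top
    refine (Real.le_norm_self _).trans ((norm_setIntegral_le_of_norm_le_const
      (C := (2 / c') ^ 2) hfin fun θ hθ => ?_).trans ?_)
    · rw [Real.norm_of_nonneg (by positivity)]
      gcongr
      exact norm_geom_sum_le (norm_chf_le _ _) hc' (hfar θ hθ.1 fun h => hθ.2 (mem_nearBox.2 h)) n
    · rw [← volume_dualBox_real]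
      gcongr
      · exact isCompact_dualBox.measure_lt_top.ne
      · exact Set.sdiff_subset
  have hpt : ∀ θ ∈ nearBox δ, ‖∑ m ∈ Finset.range n, chf P X θ ^ m‖ ^ 2 ≤
      ∑ i ∈ Finset.range n, ∑ j ∈ Finset.range n,
        Real.exp (-(c * (i + j) * (θ.1 ^ 2 + θ.2 ^ 2))) := by
    intro θ hθ
    obtain ⟨h1, h2⟩ := mem_nearBox.1 hθ
    have h3 := (hN θ h1 h2).1
    have h4 : ‖∑ m ∈ Finset.range n, chf P X θ ^ m‖ ≤
        ∑ m ∈ Finset.range n, Real.exp (-(c * (θ.1 ^ 2 + θ.2 ^ 2))) ^ m := by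
      refine (norm_sum_le _ _).trans (Finset.sum_le_sum fun m _ => ?_)
      rw [norm_pow]
      gcongr
    refine (pow_le_pow_left₀ (norm_nonneg _) h4 2).trans ?_
    rw [sq, Finset.sum_mul_sum]
    refine Finset.sum_le_sum fun i _ => Finset.sum_le_sum fun j _ => ?_
    rw [← pow_add, ← Real.exp_nat_mul]
    gcongr
    push_cast
    linarith
  have hint : ∀ i j : ℕ, IntegrableOn
      (fun θ : ℝ × ℝ => Real.exp (-(c * (i + j) * (θ.1 ^ 2 + θ.2 ^ 2)))) (nearBox δ) := by
    intro i j
    refine Continuous.continuousOn ?_ |>.integrableOn_compact (isCompact_nearBox δ)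
    fun_prop
  have hij : ∀ i j : ℕ, ∫ θ in nearBox δ, Real.exp (-(c * (i + j) * (θ.1 ^ 2 + θ.2 ^ 2))) ≤
      (if i = 0 ∧ j = 0 then (2 * Real.pi) ^ 2 else 0) + Real.pi / c * ((i : ℝ) + j)⁻¹ := by
    intro i j
    split_ifs with h
    · obtain ⟨rfl, rfl⟩ := h
      simp only [Nat.cast_zero, add_zero, mul_zero, zero_mul, neg_zero, Real.exp_zero, inv_zero]
      rw [setIntegral_const, smul_eq_mul, mul_one, ← volume_dualBox_real]
      exact measureReal_mono hsub isCompact_dualBox.measure_lt_top.ne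
    · have hpos : (0 : ℝ) < i + j := by
        have : 0 < i + j := by omega
        exact_mod_cast this
      refine (setIntegral_exp_neg_mul_normSq_le (by positivity) _).trans (le_of_eq ?_)
      field_simp
      ring
  have hNr : ∫ θ in nearBox δ, ‖∑ m ∈ Finset.range n, chf P X θ ^ m‖ ^ 2 ≤
      (2 * Real.pi) ^ 2 + Real.pi / c * (3 * n) := by
    refine (setIntegral_mono_on (hic.mono_set hsub) (integrable_finsetSum _ fun i _ =>
      integrable_finsetSum _ fun j _ => hint i j) hmsN hpt).trans ?_
    rw [integral_finsetSum _ fun i _ => integrable_finsetSum _ fun j _ => hint i j]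
    simp_rw [integral_finsetSum _ fun j _ => hint _ j]
    refine (Finset.sum_le_sum fun i _ => Finset.sum_le_sum fun j _ => hij i j).trans ?_
    simp_rw [Finset.sum_add_distrib, ← Finset.mul_sum]
    gcongr
    · simp_rw [ite_and]
      simp [hn]
    · exact sum_inv_add_le n
  calc _ ≤ (2 / c') ^ 2 * (2 * Real.pi) ^ 2 + ((2 * Real.pi) ^ 2 + Real.pi / c * (3 * n)) :=
        add_le_add hF hNr
    _ ≤ (2 / c') ^ 2 * (2 * Real.pi) ^ 2 * n + ((2 * Real.pi) ^ 2 * n + Real.pi / c * (3 * n)) := by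
        refine add_le_add (le_mul_of_one_le_right (by positivity) hn1)
          (add_le_add_left (le_mul_of_one_le_right (by positivity) hn1) _)
    _ = _ := by ring

end Step

end QuenchedRW

/-! ### Hitting probabilities and the square sum of the Green function -/

namespace QuenchedRW

open scoped ENNReal ComplexConjugate

/-- The standing assumptions on the steps of the planar walk. -/
structure IsPlanarWalk {Ω : Type*} [MeasurableSpace Ω] (P : Measure Ω)
    (ζ : ℕ → Ω → (Fin 2 → ℤ)) : Prop where
  meas : ∀ i, Measurable (ζ i)
  indep : iIndepFun ζ P
  ident : ∀ i, IdentDistrib (ζ i) (ζ 0) P P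
  aper : IsAperiodic P (ζ 0)
  memLp : ∀ c : Fin 2, MemLp (fun ω => (ζ 0 ω c : ℝ)) 2 P
  mean : ∀ c : Fin 2, ∫ ω, (ζ 0 ω c : ℝ) ∂P = 0
  cov : (covMatrix P (ζ 0)).det ≠ 0

/-- The probability that the walk is at `l` at time `m`. -/
def hitProb {Ω : Type*} [MeasurableSpace Ω] (P : Measure Ω) (ζ : ℕ → Ω → (Fin 2 → ℤ))
    (m : ℕ) (l : Fin 2 → ℤ) : ℝ≥0∞ := P {ω | walk ζ m ω = l}

/-- The truncated Green function of the walk. -/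
def green {Ω : Type*} [MeasurableSpace Ω] (P : Measure Ω) (ζ : ℕ → Ω → (Fin 2 → ℤ))
    (n : ℕ) (l : Fin 2 → ℤ) : ℝ≥0∞ := ∑ m ∈ Finset.range n, hitProb P ζ m l

namespace IsPlanarWalk

variable {Ω : Type*} [MeasurableSpace Ω] {P : Measure Ω} {ζ : ℕ → Ω → (Fin 2 → ℤ)}

theorem isProbabilityMeasure (h : IsPlanarWalk P ζ) : IsProbabilityMeasure P :=
  h.indep.isProbabilityMeasure

theorem measurable_sum (h : IsPlanarWalk P ζ) (U : Finset ℕ) :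
    Measurable fun ω => ∑ i ∈ U, ζ i ω :=
  Finset.measurable_fun_sum U fun i _ => h.meas i

theorem measurable_walk (h : IsPlanarWalk P ζ) (n : ℕ) : Measurable (walk ζ n) :=
  h.measurable_sum _

theorem indepFun_sum_sum (h : IsPlanarWalk P ζ) {U V : Finset ℕ} (hUV : Disjoint U V) :
    IndepFun (fun ω => ∑ i ∈ U, ζ i ω) (fun ω => ∑ i ∈ V, ζ i ω) P := by
  have h1 := h.indep.indepFun_finset U V hUV h.meas
  have h2 := h1.comp (φ := fun v : U → (Fin 2 → ℤ) => ∑ i, v i)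
    (ψ := fun v : V → (Fin 2 → ℤ) => ∑ i, v i) (by fun_prop) (by fun_prop)
  convert! h2 using 1
  · funext ω; exact (Finset.sum_coe_sort U (fun i => ζ i ω)).symm
  · funext ω; exact (Finset.sum_coe_sort V (fun i => ζ i ω)).symm

/-- Both laws have the characteristic function `χ ^ U.card`, so Fourier inversion identifies them:
only the number of steps matters. -/
theorem prob_sum (h : IsPlanarWalk P ζ) (U : Finset ℕ) (l : Fin 2 → ℤ) :
    P {ω | ∑ i ∈ U, ζ i ω = l} = hitProb P ζ U.card l := by
  have := h.isProbabilityMeasure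
  have h1 := prob_eq_integral_chf (P := P) (h.measurable_sum U) l
  have h2 := prob_eq_integral_chf (P := P) (h.measurable_walk U.card) l
  have h3 : chf P (walk ζ U.card) = chf P (fun ω => ∑ i ∈ U, ζ i ω) := by
    funext θ
    rw [chf_sum h.meas h.indep h.ident]
    have := chf_sum h.meas h.indep h.ident (Finset.range U.card) θ
    rw [Finset.card_range] at this
    exact this
  rw [h3, ← h1] at h2
  have hpi : ((2 * Real.pi) ^ 2 : ℂ) ≠ 0 := by
    have := Real.pi_ne_zero
    simp [this]
  have h4 : P.real {ω | walk ζ U.card ω = l} = P.real {ω | ∑ i ∈ U, ζ i ω = l} := by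
    exact_mod_cast mul_left_cancel₀ hpi h2
  rw [hitProb, ← measureReal_eq_measureReal_iff]
  exact h4.symm

theorem prob_sum_inter_sum (h : IsPlanarWalk P ζ) {U V : Finset ℕ} (hUV : Disjoint U V)
    (x y : Fin 2 → ℤ) :
    P {ω | ∑ i ∈ U, ζ i ω = x ∧ ∑ i ∈ V, ζ i ω = y} =
      hitProb P ζ U.card x * hitProb P ζ V.card y := by
  rw [← h.prob_sum, ← h.prob_sum]
  exact (h.indepFun_sum_sum hUV).measure_inter_preimage_eq_mul _ _
    (measurableSet_singleton x) (measurableSet_singleton y)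

theorem green_toReal (h : IsPlanarWalk P ζ) (n : ℕ) (l : Fin 2 → ℤ) :
    ((2 * Real.pi) ^ 2 * (green P ζ n l).toReal : ℂ) =
      ∫ θ in dualBox, (∑ m ∈ Finset.range n, chf P (ζ 0) θ ^ m) * chr θ (-l) := by
  have := h.isProbabilityMeasure
  have h1 : (green P ζ n l).toReal = ∑ m ∈ Finset.range n, P.real {ω | walk ζ m ω = l} := by
    simp only [green, hitProb]
    rw [ENNReal.toReal_sum fun m _ => measure_ne_top P {ω | walk ζ m ω = l}]
    rfl
  rw [h1]
  push_cast
  rw [Finset.mul_sum]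
  simp_rw [prob_eq_integral_chf (P := P) (h.measurable_walk _) l, Finset.sum_mul]
  rw [integral_finsetSum _ fun m _ => integrableOn_chf_pow (h.meas 0) _ _ isCompact_dualBox]
  refine Finset.sum_congr rfl fun m _ => ?_
  congr 1
  funext θ
  have := chf_sum h.meas h.indep h.ident (Finset.range m) θ
  rw [Finset.card_range] at this
  rw [← this]
  rfl

/-- Disjoint stretches of `i` and `j` steps behave as independent walks, and the sum over a common
position is the probability that they end at the same point. -/
theorem tsum_hitProb_mul (h : IsPlanarWalk P ζ) (i j : ℕ) :
    ∑' x, hitProb P ζ i x * hitProb P ζ j x =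
      P {ω | ∑ k ∈ Finset.range i, ζ k ω - ∑ k ∈ Finset.Ico i (i + j), ζ k ω = 0} := by
  have hdisj : Disjoint (Finset.range i) (Finset.Ico i (i + j)) := by
    rw [Finset.range_eq_Ico]; exact Finset.Ico_disjoint_Ico_consecutive 0 i (i + j)
  have h1 : ∀ x, hitProb P ζ i x * hitProb P ζ j x =
      P {ω | ∑ k ∈ Finset.range i, ζ k ω = x ∧ ∑ k ∈ Finset.Ico i (i + j), ζ k ω = x} := by
    intro x
    rw [h.prob_sum_inter_sum hdisj]
    simp
  simp_rw [h1]
  rw [← measure_iUnion]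
  · congr 1
    ext ω
    simp [sub_eq_zero, eq_comm]
  · intro x y hxy
    refine Set.disjoint_left.2 fun ω hx hy => hxy ?_
    exact hx.1.symm.trans hy.1
  · intro x
    exact (h.measurable_sum _ (measurableSet_singleton x)).inter
      (h.measurable_sum _ (measurableSet_singleton x))

/-- The square sum of the truncated Green function grows at most linearly. -/
theorem exists_tsum_green_sq_le (h : IsPlanarWalk P ζ) :
    ∃ K : ℝ, 0 < K ∧ ∀ n : ℕ, ∑' x, green P ζ n x ^ 2 ≤ ENNReal.ofReal (K * n) := by
  have := h.isProbabilityMeasure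
  obtain ⟨K, hK, hb⟩ := exists_integral_norm_geom_sq_le (h.meas 0) h.aper h.memLp h.mean h.cov
  refine ⟨K, hK, fun n => ?_⟩
  have h1 : ∑' x, green P ζ n x ^ 2 = ∑ i ∈ Finset.range n, ∑ j ∈ Finset.range n,
      P {ω | ∑ k ∈ Finset.range i, ζ k ω - ∑ k ∈ Finset.Ico i (i + j), ζ k ω = 0} := by
    simp_rw [← h.tsum_hitProb_mul, green, sq, Finset.sum_mul_sum]
    rw [Summable.tsum_finsetSum fun _ _ => ENNReal.summable]
    refine Finset.sum_congr rfl fun i _ => ?_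
    rw [Summable.tsum_finsetSum fun _ _ => ENNReal.summable]
  have hcontχ : Continuous (chf P (ζ 0)) := continuous_chf (h.meas 0)
  -- Parseval: each probability is the integral of `χ^i * conj χ^j`, and these products assemble to
  -- `|∑ χ^m|²`.
  have h2 : ((∑ i ∈ Finset.range n, ∑ j ∈ Finset.range n, (2 * Real.pi) ^ 2 *
      P.real {ω | ∑ k ∈ Finset.range i, ζ k ω - ∑ k ∈ Finset.Ico i (i + j), ζ k ω = 0} : ℝ) : ℂ) =
      ((∫ θ in dualBox, ‖∑ m ∈ Finset.range n, chf P (ζ 0) θ ^ m‖ ^ 2 : ℝ) : ℂ) := by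
    have hi : ∀ i j : ℕ, IntegrableOn
        (fun θ => chf P (ζ 0) θ ^ i * conj (chf P (ζ 0) θ) ^ j) dualBox := by
      intro i j
      refine Continuous.continuousOn ?_ |>.integrableOn_compact isCompact_dualBox
      exact (hcontχ.pow i).mul ((Complex.continuous_conj.comp hcontχ).pow j)
    rw [← integral_complex_ofReal]
    have e : ∀ θ, ((‖∑ m ∈ Finset.range n, chf P (ζ 0) θ ^ m‖ ^ 2 : ℝ) : ℂ) =
        ∑ i ∈ Finset.range n, ∑ j ∈ Finset.range n,
          chf P (ζ 0) θ ^ i * conj (chf P (ζ 0) θ) ^ j := by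
      intro θ
      rw [← Finset.sum_mul_sum]
      push_cast
      rw [← Complex.mul_conj', map_sum]
      simp_rw [map_pow]
    simp_rw [e]
    rw [integral_finsetSum _ fun i _ => integrable_finsetSum _ fun j _ => hi i j]
    push_cast
    refine Finset.sum_congr rfl fun i _ => ?_
    rw [integral_finsetSum _ fun j _ => hi i j]
    refine Finset.sum_congr rfl fun j _ => ?_
    have hdisj : Disjoint (Finset.range i) (Finset.Ico i (i + j)) := by
      rw [Finset.range_eq_Ico]; exact Finset.Ico_disjoint_Ico_consecutive 0 i (i + j)
    have hm : Measurable fun ω =>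
        ∑ k ∈ Finset.range i, ζ k ω - ∑ k ∈ Finset.Ico i (i + j), ζ k ω :=
      (h.measurable_sum _).sub (h.measurable_sum _)
    rw [prob_eq_integral_chf (P := P) hm 0]
    simp_rw [chf_sum_sub_sum h.meas h.indep h.ident hdisj, neg_zero, chr_zero, mul_one]
    simp
  have h3 := Complex.ofReal_injective h2
  rw [h1]
  have h4 : ∑ i ∈ Finset.range n, ∑ j ∈ Finset.range n,
      P.real {ω | ∑ k ∈ Finset.range i, ζ k ω - ∑ k ∈ Finset.Ico i (i + j), ζ k ω = 0} ≤ K * n := by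
    refine le_trans ?_ (h3.le.trans (hb n))
    refine Finset.sum_le_sum fun i _ => Finset.sum_le_sum fun j _ => ?_
    refine le_mul_of_one_le_left measureReal_nonneg ?_
    nlinarith [Real.pi_gt_three]
  refine le_trans (le_of_eq ?_) (ENNReal.ofReal_le_ofReal h4)
  rw [ENNReal.ofReal_sum_of_nonneg fun i _ => Finset.sum_nonneg fun j _ => measureReal_nonneg]
  refine Finset.sum_congr rfl fun i _ => ?_
  rw [ENNReal.ofReal_sum_of_nonneg fun j _ => measureReal_nonneg]
  exact Finset.sum_congr rfl fun j _ => (ofReal_measureReal).symm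

end IsPlanarWalk

end QuenchedRW

/-! ### Harmonic sums and the mean of the pair counts -/

namespace QuenchedRW

open Asymptotics

/-- The harmonic numbers, as reals. -/
def realHarmonic (n : ℕ) : ℝ := ∑ m ∈ Finset.range n, ((m : ℝ) + 1)⁻¹

theorem realHarmonic_eq (n : ℕ) : realHarmonic n = (harmonic n : ℝ) := by
  simp [realHarmonic, harmonic]

theorem realHarmonic_nonneg (n : ℕ) : 0 ≤ realHarmonic n :=
  Finset.sum_nonneg fun _ _ => by positivity

theorem tendsto_log_natCast_atTop : Tendsto (fun n : ℕ => Real.log n) atTop atTop :=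
  Real.tendsto_log_atTop.comp tendsto_natCast_atTop_atTop

theorem tendsto_realHarmonic_div_log :
    Tendsto (fun n : ℕ => realHarmonic n / Real.log n) atTop (𝓝 1) := by
  have hlog := tendsto_log_natCast_atTop
  have hup : Tendsto (fun n : ℕ => 1 / Real.log n + 1) atTop (𝓝 1) := by
    simpa using (tendsto_const_nhds (x := (1 : ℝ)).div_atTop hlog).add_const 1
  refine tendsto_of_tendsto_of_tendsto_of_le_of_le' tendsto_const_nhds hup ?_ ?_
  · filter_upwards [hlog.eventually_gt_atTop 0, eventually_gt_atTop 0] with n hn hn0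
    rw [le_div_iff₀ hn, one_mul, realHarmonic_eq]
    refine le_trans ?_ (log_add_one_le_harmonic n)
    have : (0 : ℝ) < n := by exact_mod_cast hn0
    exact Real.log_le_log this (by push_cast; linarith)
  · filter_upwards [hlog.eventually_gt_atTop 0] with n hn
    rw [div_le_iff₀ hn, realHarmonic_eq, add_mul, one_mul, div_mul_cancel₀ _ hn.ne']
    exact harmonic_le_one_add_log n

theorem tendsto_realHarmonic_atTop : Tendsto realHarmonic atTop atTop := by
  refine tendsto_atTop_mono' _ ?_ tendsto_log_natCast_atTop
  filter_upwards [eventually_gt_atTop 0] with n hn0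
  rw [realHarmonic_eq]
  refine le_trans ?_ (log_add_one_le_harmonic n)
  have : (0 : ℝ) < n := by exact_mod_cast hn0
  exact Real.log_le_log this (by push_cast; linarith)

theorem sum_realHarmonic (n : ℕ) :
    ∑ j ∈ Finset.range n, realHarmonic j = n * realHarmonic n - n := by
  induction n with
  | zero => simp
  | succ n ih =>
    rw [Finset.sum_range_succ, ih]
    have : realHarmonic (n + 1) = realHarmonic n + ((n : ℝ) + 1)⁻¹ := Finset.sum_range_succ _ _
    rw [this]
    have : (n : ℝ) + 1 ≠ 0 := by positivity
    push_cast
    field_simp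
    ring

/-- A sequence asymptotic to `c` times the harmonic numbers has partial sums asymptotic to
`c n log n`. -/
theorem tendsto_sum_div_mul_log {a : ℕ → ℝ} {c : ℝ}
    (ha : Tendsto (fun n => a n / realHarmonic n) atTop (𝓝 c)) :
    Tendsto (fun n : ℕ => (∑ j ∈ Finset.range n, a j) / (n * Real.log n)) atTop (𝓝 c) := by
  have hpos : ∀ᶠ n in atTop, 0 < realHarmonic n := tendsto_realHarmonic_atTop.eventually_gt_atTop 0
  have ho : (fun n => a n - c * realHarmonic n) =o[atTop] realHarmonic := by
    rw [isLittleO_iff_tendsto' (hpos.mono fun n hn h0 => absurd h0 hn.ne')]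
    have : Tendsto (fun n => a n / realHarmonic n - c) atTop (𝓝 0) := by
      simpa using ha.sub_const c
    refine this.congr' (hpos.mono fun n hn => ?_)
    field_simp
  have hsumtop : Tendsto (fun n => ∑ j ∈ Finset.range n, realHarmonic j) atTop atTop := by
    refine tendsto_atTop_mono' _ ?_ (tendsto_natCast_atTop_atTop (R := ℝ))
    filter_upwards [tendsto_realHarmonic_atTop.eventually_ge_atTop 2] with n hn
    rw [sum_realHarmonic]
    nlinarith [Nat.cast_nonneg (α := ℝ) n]
  have hS := ho.sum_range realHarmonic_nonneg hsumtop
  have hlogpos : ∀ᶠ n : ℕ in atTop, 0 < (n : ℝ) * Real.log n := by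
    filter_upwards [tendsto_log_natCast_atTop.eventually_gt_atTop 0, eventually_gt_atTop 0]
      with n hn hn0
    exact mul_pos (by exact_mod_cast hn0) hn
  have hratio : Tendsto (fun n : ℕ => (∑ j ∈ Finset.range n, realHarmonic j) / (n * Real.log n))
      atTop (𝓝 1) := by
    have h1 : Tendsto (fun n : ℕ => realHarmonic n / Real.log n - 1 / Real.log n) atTop (𝓝 1) := by
      simpa using tendsto_realHarmonic_div_log.sub
        (tendsto_const_nhds (x := (1 : ℝ)).div_atTop tendsto_log_natCast_atTop)
    refine h1.congr' ?_
    filter_upwards [tendsto_log_natCast_atTop.eventually_gt_atTop 0, eventually_gt_atTop 0]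
      with n hn hn0
    have : (0 : ℝ) < n := by exact_mod_cast hn0
    rw [sum_realHarmonic]
    field_simp
  have hS0 := hS.tendsto_div_nhds_zero
  have h2 := (hS0.mul hratio).add (hratio.const_mul c)
  simp only [mul_one, zero_add] at h2
  refine h2.congr' ?_
  filter_upwards [hsumtop.eventually_gt_atTop 0, hlogpos] with n hn hl
  rw [Finset.sum_sub_distrib, ← Finset.mul_sum]
  field_simp
  ring

namespace IsPlanarWalk

variable {Ω : Type*} [MeasurableSpace Ω] {P : Measure Ω} {ζ : ℕ → Ω → (Fin 2 → ℤ)}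

/-- The Fourier main term `2π / √det` is divided by the `(2π)²` of the inversion formula. The limit
does not depend on `l`, which is ultimately why the limiting spectral weight sits at the origin.
Times `0, …, n` are matched with `n` harmonic terms, time `0` being part of the bounded error. -/
theorem tendsto_green_div (h : IsPlanarWalk P ζ) (l : Fin 2 → ℤ) :
    Tendsto (fun n => (green P ζ (n + 1) l).toReal / realHarmonic n) atTop
      (𝓝 ((2 * Real.pi * √(covMatrix P (ζ 0)).det)⁻¹)) := by
  have := h.isProbabilityMeasure
  obtain ⟨C, hC, hb⟩ := exists_norm_integral_geom_sub_le (h.meas 0) h.aper h.memLp h.mean h.cov (-l)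
  have hD := (covMatrix_det_pos h.memLp h.mean h.cov).1
  set D := (covMatrix P (ζ 0)).det with hDdef
  have hsq : 0 < √D := Real.sqrt_pos.2 hD
  have hpi := Real.pi_pos
  have hmain : Tendsto (fun n => (2 * Real.pi) ^ 2 * (green P ζ (n + 1) l).toReal /
      realHarmonic n) atTop (𝓝 (2 * Real.pi / √D)) := by
    rw [Metric.tendsto_atTop']
    intro ε hε
    obtain ⟨K, hK⟩ := hb (ε / (2 * C)) (by positivity)
    have hlim : Tendsto (fun n => K / realHarmonic n) atTop (𝓝 0) :=
      tendsto_const_nhds.div_atTop tendsto_realHarmonic_atTop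
    have hev := (hlim.eventually (gt_mem_nhds (show (0 : ℝ) < ε / 2 by positivity))).and
      (tendsto_realHarmonic_atTop.eventually_gt_atTop 0)
    obtain ⟨N, hN⟩ := eventually_atTop.1 hev
    refine ⟨N, fun n hn => ?_⟩
    obtain ⟨h1, h2⟩ := hN n hn.le
    have h3 := hK n
    rw [← h.green_toReal] at h3
    have h4 : |(2 * Real.pi) ^ 2 * (green P ζ (n + 1) l).toReal -
        2 * Real.pi / √D * realHarmonic n| ≤ ε / (2 * C) * C * realHarmonic n + K := by
      rw [← Real.norm_eq_abs, ← Complex.norm_real]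
      refine le_trans (le_of_eq ?_) h3
      congr 1
      push_cast [realHarmonic]
      ring
    rw [Real.dist_eq]
    have e : (2 * Real.pi) ^ 2 * (green P ζ (n + 1) l).toReal / realHarmonic n -
        2 * Real.pi / √D = ((2 * Real.pi) ^ 2 * (green P ζ (n + 1) l).toReal -
        2 * Real.pi / √D * realHarmonic n) / realHarmonic n := by field_simp
    rw [e, abs_div, abs_of_pos h2, div_lt_iff₀ h2]
    rw [div_lt_iff₀ h2] at h1
    have e2 : ε / (2 * C) * C = ε / 2 := by field_simp
    rw [e2] at h4
    linarith
  have h5 := hmain.const_mul ((2 * Real.pi) ^ 2)⁻¹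
  have e3 : ((2 * Real.pi) ^ 2)⁻¹ * (2 * Real.pi / √D) = (2 * Real.pi * √D)⁻¹ := by field_simp
  rw [e3] at h5
  refine h5.congr fun n => ?_
  field_simp

/-- The expected number of pairs of times in an interval of length `n` between which the walk makes
the displacement `l`. -/
def meanCount (P : Measure Ω) (ζ : ℕ → Ω → (Fin 2 → ℤ)) (n : ℕ) (l : Fin 2 → ℤ) : ℝ :=
  ∑ j ∈ Finset.range n, ((green P ζ (j + 1) l).toReal + (green P ζ (j + 1) (-l)).toReal -
    if l = 0 then 1 else 0)

/-- The displacements `l` and `-l` each contribute half of `C₀`; the correction at `l = 0` is lost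
against the harmonic sum. -/
theorem tendsto_meanCount (h : IsPlanarWalk P ζ) (l : Fin 2 → ℤ) :
    Tendsto (fun n : ℕ => meanCount P ζ n l / (n * Real.log n)) atTop
      (𝓝 (selfIntersectionConst (covMatrix P (ζ 0)))) := by
  refine tendsto_sum_div_mul_log ?_
  have h1 := ((h.tendsto_green_div l).add (h.tendsto_green_div (-l))).sub
    ((tendsto_const_nhds (x := (if l = 0 then 1 else 0 : ℝ))).div_atTop tendsto_realHarmonic_atTop)
  have e : (2 * Real.pi * √(covMatrix P (ζ 0)).det)⁻¹ +
      (2 * Real.pi * √(covMatrix P (ζ 0)).det)⁻¹ - 0 =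
      selfIntersectionConst (covMatrix P (ζ 0)) := by
    rw [selfIntersectionConst, mul_assoc, mul_inv (2 : ℝ)]
    ring
  rw [e] at h1
  refine h1.congr fun n => ?_
  ring

end IsPlanarWalk

end QuenchedRW

/-! ### Pair counts: algebra, expectation, independence -/

namespace QuenchedRW

open scoped ENNReal

/-- The number of pairs `(i, j) ∈ A × B` with `z i - z j = l`. -/
def pairCount (z : ℕ → Fin 2 → ℤ) (A B : Finset ℕ) (l : Fin 2 → ℤ) : ℝ :=
  ∑ i ∈ A, ∑ j ∈ B, if z i - z j = l then 1 else 0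

theorem pairCount_nonneg (z : ℕ → Fin 2 → ℤ) (A B : Finset ℕ) (l : Fin 2 → ℤ) :
    0 ≤ pairCount z A B l :=
  Finset.sum_nonneg fun _ _ => Finset.sum_nonneg fun _ _ => by split_ifs <;> norm_num

theorem pairCount_le_card (z : ℕ → Fin 2 → ℤ) (A B : Finset ℕ) (l : Fin 2 → ℤ) :
    pairCount z A B l ≤ A.card * B.card := by
  calc pairCount z A B l ≤ ∑ i ∈ A, ∑ j ∈ B, (1 : ℝ) :=
        Finset.sum_le_sum fun _ _ => Finset.sum_le_sum fun _ _ => by split_ifs <;> norm_num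
    _ = _ := by simp

theorem pairCount_mono (z : ℕ → Fin 2 → ℤ) {A A' B B' : Finset ℕ} (hA : A ⊆ A') (hB : B ⊆ B')
    (l : Fin 2 → ℤ) : pairCount z A B l ≤ pairCount z A' B' l := by
  have h0 : ∀ i j, (0 : ℝ) ≤ if z i - z j = l then 1 else 0 := fun i j => by
    split_ifs <;> norm_num
  refine (Finset.sum_le_sum fun i _ =>
    Finset.sum_le_sum_of_subset_of_nonneg hB fun j _ _ => h0 i j).trans ?_
  exact Finset.sum_le_sum_of_subset_of_nonneg hA fun i _ _ => Finset.sum_nonneg fun j _ => h0 i j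

theorem pairCount_swap (z : ℕ → Fin 2 → ℤ) (A B : Finset ℕ) (l : Fin 2 → ℤ) :
    pairCount z B A l = pairCount z A B (-l) := by
  rw [pairCount, Finset.sum_comm, pairCount]
  refine Finset.sum_congr rfl fun i _ => Finset.sum_congr rfl fun j _ => ?_
  have : z j - z i = l ↔ z i - z j = -l := by rw [← neg_sub, neg_eq_iff_eq_neg]
  simp [this]

theorem pairCount_union_left (z : ℕ → Fin 2 → ℤ) {A A' : Finset ℕ} (h : Disjoint A A')
    (B : Finset ℕ) (l : Fin 2 → ℤ) :
    pairCount z (A ∪ A') B l = pairCount z A B l + pairCount z A' B l :=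
  Finset.sum_union h

theorem pairCount_union_right (z : ℕ → Fin 2 → ℤ) (A : Finset ℕ) {B B' : Finset ℕ}
    (h : Disjoint B B') (l : Fin 2 → ℤ) :
    pairCount z A (B ∪ B') l = pairCount z A B l + pairCount z A B' l := by
  simp_rw [pairCount, Finset.sum_union h, Finset.sum_add_distrib]

/-- The trajectory of the walk. -/
def path {Ω : Type*} (ζ : ℕ → Ω → (Fin 2 → ℤ)) (ω : Ω) (n : ℕ) : Fin 2 → ℤ := walk ζ n ω

theorem path_sub_path {Ω : Type*} (ζ : ℕ → Ω → (Fin 2 → ℤ)) (ω : Ω) {i j : ℕ} (hij : i ≤ j) :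
    path ζ ω j - path ζ ω i = ∑ k ∈ Finset.Ico i j, ζ k ω :=
  (Finset.sum_Ico_eq_sub _ hij).symm

namespace IsPlanarWalk

variable {Ω : Type*} [MeasurableSpace Ω] {P : Measure Ω} {ζ : ℕ → Ω → (Fin 2 → ℤ)}

theorem measurableSet_path_sub (h : IsPlanarWalk P ζ) (i j : ℕ) (l : Fin 2 → ℤ) :
    MeasurableSet {ω | path ζ ω i - path ζ ω j = l} :=
  ((h.measurable_walk i).sub (h.measurable_walk j)) (measurableSet_singleton l)

theorem measurable_pairCount (h : IsPlanarWalk P ζ) (A B : Finset ℕ) (l : Fin 2 → ℤ) :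
    Measurable fun ω => pairCount (path ζ ω) A B l :=
  Finset.measurable_fun_sum _ fun i _ => Finset.measurable_fun_sum _ fun j _ =>
    Measurable.ite (h.measurableSet_path_sub i j l) measurable_const measurable_const

theorem memLp_pairCount (h : IsPlanarWalk P ζ) (A B : Finset ℕ) (l : Fin 2 → ℤ) (p : ℝ≥0∞) :
    MemLp (fun ω => pairCount (path ζ ω) A B l) p P := by
  have := h.isProbabilityMeasure
  refine MemLp.of_bound (h.measurable_pairCount A B l).aestronglyMeasurable (A.card * B.card)
    (ae_of_all _ fun ω => ?_)
  rw [Real.norm_of_nonneg (pairCount_nonneg _ _ _ _)]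
  exact pairCount_le_card _ _ _ _

theorem prob_path_sub_of_le (h : IsPlanarWalk P ζ) {i j : ℕ} (hij : i ≤ j) (l : Fin 2 → ℤ) :
    P {ω | path ζ ω j - path ζ ω i = l} = hitProb P ζ (j - i) l := by
  simp_rw [path_sub_path ζ _ hij]
  rw [h.prob_sum, Nat.card_Ico]

theorem prob_path_sub_of_ge (h : IsPlanarWalk P ζ) {i j : ℕ} (hij : i ≤ j) (l : Fin 2 → ℤ) :
    P {ω | path ζ ω i - path ζ ω j = l} = hitProb P ζ (j - i) (-l) := by
  rw [← h.prob_path_sub_of_le hij]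
  congr 1
  ext ω
  change path ζ ω i - path ζ ω j = l ↔ path ζ ω j - path ζ ω i = -l
  rw [← neg_sub, neg_eq_iff_eq_neg]

theorem hitProb_zero [IsProbabilityMeasure P] (l : Fin 2 → ℤ) :
    hitProb P ζ 0 l = if l = 0 then 1 else 0 := by
  split_ifs with h
  · simp [hitProb, walk, h]
  · simp [hitProb, walk, Ne.symm h]

theorem green_toReal_eq_sum [IsProbabilityMeasure P] (n : ℕ) (l : Fin 2 → ℤ) :
    (green P ζ n l).toReal = ∑ m ∈ Finset.range n, (hitProb P ζ m l).toReal := by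
  have : ∀ m, hitProb P ζ m l ≠ ∞ := fun m => measure_ne_top P _
  simp only [green]
  rw [ENNReal.toReal_sum fun m _ => this m]

/-- Appending the time `u + n` adds the pairs in which it comes first, giving the Green function at
`l`, and those in which it comes second, giving the one at `-l`. The diagonal pair would appear in
both, hence the correction when `l = 0`. -/
theorem integral_pairCount_Ico (h : IsPlanarWalk P ζ) (u n : ℕ) (l : Fin 2 → ℤ) :
    ∫ ω, pairCount (path ζ ω) (Finset.Ico u (u + n)) (Finset.Ico u (u + n)) l ∂P =
      meanCount P ζ n l := by
  have := h.isProbabilityMeasure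
  have hind : ∀ i j, ∫ ω, (if path ζ ω i - path ζ ω j = l then (1 : ℝ) else 0) ∂P =
      P.real {ω | path ζ ω i - path ζ ω j = l} := by
    intro i j
    rw [← integral_indicator_one (h.measurableSet_path_sub i j l)]
    exact integral_congr_ae (ae_of_all _ fun ω => by simp [Set.indicator_apply])
  have hint : ∀ i j, Integrable (fun ω => if path ζ ω i - path ζ ω j = l then (1 : ℝ) else 0) P := by
    intro i j
    refine Integrable.of_bound (Measurable.ite (h.measurableSet_path_sub i j l) measurable_const
      measurable_const).aestronglyMeasurable 1 (ae_of_all _ fun ω => ?_)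
    split_ifs <;> simp
  simp_rw [pairCount]
  rw [integral_finsetSum _ fun i _ => integrable_finsetSum _ fun j _ => hint i j]
  simp_rw [integral_finsetSum _ fun j _ => hint _ j, hind]
  simp_rw [Finset.sum_Ico_eq_sum_range, Nat.add_sub_cancel_left]
  rw [meanCount]
  induction n with
  | zero => simp
  | succ n ih =>
    rw [Finset.sum_range_succ]
    simp_rw [Finset.sum_range_succ _ n]
    rw [Finset.sum_add_distrib, ih]
    have h1 : ∑ i ∈ Finset.range n, P.real {ω | path ζ ω (u + i) - path ζ ω (u + n) = l} =
        (green P ζ (n + 1) (-l)).toReal - if l = 0 then 1 else 0 := by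
      rw [green_toReal_eq_sum, Finset.sum_range_succ', hitProb_zero]
      have e : (if -l = 0 then (1 : ℝ≥0∞) else 0).toReal = if l = 0 then 1 else 0 := by
        simp only [neg_eq_zero]; split_ifs <;> simp
      rw [e, add_sub_cancel_right, ← Finset.sum_range_reflect]
      refine Finset.sum_congr rfl fun i hi => ?_
      have hi' := Finset.mem_range.1 hi
      rw [measureReal_def, h.prob_path_sub_of_ge (by omega)]
      congr 2
      omega
    have h2 : ∑ j ∈ Finset.range n, P.real {ω | path ζ ω (u + n) - path ζ ω (u + j) = l} +
        P.real {ω | path ζ ω (u + n) - path ζ ω (u + n) = l} =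
        (green P ζ (n + 1) l).toReal := by
      rw [← Finset.sum_range_succ
        (fun j => P.real {ω | path ζ ω (u + n) - path ζ ω (u + j) = l}),
        green_toReal_eq_sum, ← Finset.sum_range_reflect]
      refine Finset.sum_congr rfl fun i hi => ?_
      have hi' := Finset.mem_range.1 hi
      rw [measureReal_def, h.prob_path_sub_of_le (by omega)]
      congr 2
      omega
    rw [h1, h2]
    ring

/-- Functions of the steps that depend on disjoint sets of times are independent. -/
theorem indepFun_of_dependsOn (h : IsPlanarWalk P ζ) {α β : Type*} [MeasurableSpace α]
    [MeasurableSpace β] {F : (ℕ → Fin 2 → ℤ) → α} {G : (ℕ → Fin 2 → ℤ) → β} {S T : Finset ℕ}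
    (hF : DependsOn F (S : Set ℕ)) (hG : DependsOn G (T : Set ℕ)) (hST : Disjoint S T) :
    IndepFun (fun ω => F fun k => ζ k ω) (fun ω => G fun k => ζ k ω) P := by
  have h1 := h.indep.indepFun_finset S T hST h.meas
  have h2 := h1.comp
    (φ := fun r : S → (Fin 2 → ℤ) => F fun i => if hi : i ∈ S then r ⟨i, hi⟩ else 0)
    (ψ := fun r : T → (Fin 2 → ℤ) => G fun i => if hi : i ∈ T then r ⟨i, hi⟩ else 0)
    (measurable_of_countable _) (measurable_of_countable _)
  convert! h2 using 1
  · funext ω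
    exact hF fun i hi => by simp [Finset.mem_coe.1 hi]
  · funext ω
    exact hG fun i hi => by simp [Finset.mem_coe.1 hi]

end IsPlanarWalk

/-- One of the two intervals is always empty; assuming both inclusions avoids fixing the order of
`i` and `j`. -/
theorem dependsOn_partialSum_sub {S : Finset ℕ} {i j : ℕ} (h : Finset.Ico i j ⊆ S)
    (h' : Finset.Ico j i ⊆ S) :
    DependsOn (fun s : ℕ → Fin 2 → ℤ => ∑ k ∈ Finset.range i, s k - ∑ k ∈ Finset.range j, s k)
      (S : Set ℕ) := by
  intro x y hxy
  rcases le_total i j with hij | hij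
  · have e := fun s : ℕ → Fin 2 → ℤ => Finset.sum_Ico_eq_sub s hij
    have hs : ∑ k ∈ Finset.Ico i j, x k = ∑ k ∈ Finset.Ico i j, y k :=
      Finset.sum_congr rfl fun k hk => hxy k (h hk)
    rw [e, e] at hs
    simp only
    rw [← neg_sub, hs, neg_sub]
  · have e := fun s : ℕ → Fin 2 → ℤ => Finset.sum_Ico_eq_sub s hij
    simp only [← e]
    exact Finset.sum_congr rfl fun k hk => hxy k (h' hk)

theorem dependsOn_pairCount {u v : ℕ} (l : Fin 2 → ℤ) :
    DependsOn (fun s : ℕ → Fin 2 → ℤ =>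
      pairCount (fun n => ∑ k ∈ Finset.range n, s k) (Finset.Ico u v) (Finset.Ico u v) l)
      (Finset.Ico u v : Set ℕ) := by
  intro x y hxy
  refine Finset.sum_congr rfl fun i hi => Finset.sum_congr rfl fun j hj => ?_
  rw [Finset.mem_Ico] at hi hj
  have := dependsOn_partialSum_sub (S := Finset.Ico u v) (i := i) (j := j)
    (Finset.Ico_subset_Ico hi.1 hj.2.le) (Finset.Ico_subset_Ico hj.1 hi.2.le)
    (x := x) (y := y) (by simpa using hxy)
  simp only at this
  rw [this]

end QuenchedRW

/-! ### Two-point functions of the past and of the future -/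

namespace QuenchedRW

open scoped ENNReal

theorem ennreal_mul_le_sq_add_sq (a b : ℝ≥0∞) : a * b ≤ a ^ 2 + b ^ 2 := by
  rcases le_total a b with h | h
  · calc a * b ≤ b * b := by gcongr
      _ = b ^ 2 := (sq b).symm
      _ ≤ _ := le_add_self
  · calc a * b ≤ a * a := by gcongr
      _ = a ^ 2 := (sq a).symm
      _ ≤ _ := le_self_add

theorem ennreal_add_sq_le (a b : ℝ≥0∞) : (a + b) ^ 2 ≤ 3 * (a ^ 2 + b ^ 2) := by
  calc (a + b) ^ 2 = a ^ 2 + b ^ 2 + 2 * (a * b) := by ring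
    _ ≤ a ^ 2 + b ^ 2 + 2 * (a ^ 2 + b ^ 2) := by gcongr; exact ennreal_mul_le_sq_add_sq a b
    _ = _ := by ring

theorem tsum_tsum_sq_mul_sq_shift {G : Type*} [AddCommGroup G] (a b : G → ℝ≥0∞) :
    ∑' x, ∑' y, (a x * b (y - x)) ^ 2 = (∑' x, a x ^ 2) * ∑' x, b x ^ 2 := by
  simp_rw [mul_pow, ENNReal.tsum_mul_left]
  have : ∀ x, ∑' y, b (y - x) ^ 2 = ∑' y, b y ^ 2 := fun x =>
    (Equiv.subRight x).tsum_eq fun y => b y ^ 2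
  simp_rw [this, ENNReal.tsum_mul_right]

/-- Each product is a function of one variable times a function of the difference, so its square sum
factorises after a translation. This reduces the `ℓ²` norm of a two-point function to that of the
Green function; the two products correspond to the two orders of a pair of times. -/
theorem tsum_tsum_sq_le_of_le {G : Type*} [AddCommGroup G] {F : G → G → ℝ≥0∞} {a b : G → ℝ≥0∞}
    (hF : ∀ x y, F x y ≤ a x * b (y - x) + a y * b (x - y)) :
    ∑' x, ∑' y, F x y ^ 2 ≤ 6 * ((∑' x, a x ^ 2) * ∑' x, b x ^ 2) := by
  calc ∑' x, ∑' y, F x y ^ 2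
      ≤ ∑' x, ∑' y, 3 * ((a x * b (y - x)) ^ 2 + (a y * b (x - y)) ^ 2) := by
        refine ENNReal.tsum_le_tsum fun x => ENNReal.tsum_le_tsum fun y => ?_
        exact (pow_le_pow_left₀ zero_le (hF x y) 2).trans (ennreal_add_sq_le _ _)
    _ = 3 * (∑' x, ∑' y, (a x * b (y - x)) ^ 2 + ∑' y, ∑' x, (a y * b (x - y)) ^ 2) := by
        simp_rw [ENNReal.tsum_mul_left, ENNReal.tsum_add]
        rw [ENNReal.tsum_comm (f := fun x y => (a y * b (x - y)) ^ 2)]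
    _ = _ := by
        rw [tsum_tsum_sq_mul_sq_shift]
        ring

theorem sum_Ico_ite_le {g : ℕ → ℝ≥0∞} {v w n j : ℕ} (hj : v ≤ j) (hn : w ≤ v + n) :
    ∑ k ∈ Finset.Ico v w, (if j ≤ k then g (k - j) else 0) ≤ ∑ m ∈ Finset.range n, g m := by
  rw [← Finset.sum_filter]
  have e : (Finset.Ico v w).filter (fun k => j ≤ k) = Finset.Ico j w := by
    ext k; simp only [Finset.mem_filter, Finset.mem_Ico]; omega
  rw [e, Finset.sum_Ico_eq_sum_range]
  simp only [Nat.add_sub_cancel_left]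
  exact Finset.sum_le_sum_of_subset (Finset.range_subset_range.2 (by omega))

theorem sum_Ico_ite_ge {g : ℕ → ℝ≥0∞} {u v n j : ℕ} (hj : j < v) (hn : v ≤ u + n) :
    ∑ k ∈ Finset.Ico u v, (if k ≤ j then g (j - k) else 0) ≤ ∑ m ∈ Finset.range n, g m := by
  rw [← Finset.sum_filter]
  have e : (Finset.Ico u v).filter (fun k => k ≤ j) = Finset.Ico u (j + 1) := by
    ext k; simp only [Finset.mem_filter, Finset.mem_Ico]; omega
  rw [e, Finset.sum_Ico_eq_sum_range, ← Finset.sum_range_reflect]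
  refine le_trans (le_of_eq (Finset.sum_congr rfl fun k hk => ?_))
    (Finset.sum_le_sum_of_subset (Finset.range_subset_range.2 (show j + 1 - u ≤ n by omega)))
  rw [Finset.mem_range] at hk
  congr 1
  omega

namespace IsPlanarWalk

variable {Ω : Type*} [MeasurableSpace Ω] {P : Measure Ω} {ζ : ℕ → Ω → (Fin 2 → ℤ)}

theorem prob_future_le (h : IsPlanarWalk P ζ) {v i j : ℕ} (hi : v ≤ i) (hij : i ≤ j)
    (x y : Fin 2 → ℤ) :
    P {ω | path ζ ω i - path ζ ω v = x ∧ path ζ ω j - path ζ ω v = y} =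
      hitProb P ζ (i - v) x * hitProb P ζ (j - i) (y - x) := by
  rw [← Nat.card_Ico v i, ← Nat.card_Ico i j,
    ← h.prob_sum_inter_sum (Finset.Ico_disjoint_Ico_consecutive v i j)]
  congr 1
  ext ω
  simp only [Set.mem_ofPred_eq, ← path_sub_path ζ ω hi, ← path_sub_path ζ ω hij]
  constructor
  · rintro ⟨rfl, rfl⟩; exact ⟨rfl, by abel⟩
  · rintro ⟨rfl, h2⟩
    refine ⟨rfl, ?_⟩
    rw [eq_comm, sub_eq_iff_eq_add] at h2
    rw [h2]
    abel

/-- Seen backwards from `v`, the walk first makes the displacement `-y` over the steps in `[j, v)`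
and then `y - x` over those in `[i, j)`, which are disjoint sets of steps. -/
theorem prob_past_le (h : IsPlanarWalk P ζ) {v i j : ℕ} (hij : i ≤ j) (hj : j ≤ v)
    (x y : Fin 2 → ℤ) :
    P {ω | path ζ ω i - path ζ ω v = x ∧ path ζ ω j - path ζ ω v = y} =
      hitProb P ζ (v - j) (-y) * hitProb P ζ (j - i) (y - x) := by
  rw [← Nat.card_Ico j v, ← Nat.card_Ico i j,
    ← h.prob_sum_inter_sum (Finset.Ico_disjoint_Ico_consecutive i j v).symm]
  congr 1
  ext ω
  simp only [Set.mem_ofPred_eq, ← path_sub_path ζ ω hj, ← path_sub_path ζ ω hij]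
  constructor
  · rintro ⟨rfl, rfl⟩; exact ⟨by abel, by abel⟩
  · rintro ⟨h1, h2⟩
    have hy : path ζ ω j - path ζ ω v = y := by rw [← neg_sub, h1, neg_neg]
    refine ⟨?_, hy⟩
    rw [← hy] at h2
    have : x = path ζ ω j - path ζ ω v - (path ζ ω j - path ζ ω i) := by rw [h2]; abel
    rw [this]; abel

end IsPlanarWalk

end QuenchedRW

/-! ### Second moment of the counts between adjacent intervals -/

namespace QuenchedRW

open scoped ENNReal

namespace IsPlanarWalk

variable {Ω : Type*} [MeasurableSpace Ω] {P : Measure Ω} {ζ : ℕ → Ω → (Fin 2 → ℤ)}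

theorem green_mono {m n : ℕ} (hmn : m ≤ n) (x : Fin 2 → ℤ) : green P ζ m x ≤ green P ζ n x :=
  Finset.sum_le_sum_of_subset (Finset.range_subset_range.2 hmn)

/-- The pairs of times are split according to their order. Diagonal pairs are counted twice, which
is harmless for an upper bound. -/
theorem sum_prob_future_le (h : IsPlanarWalk P ζ) {v w n : ℕ} (hn : w ≤ v + n)
    (x y : Fin 2 → ℤ) :
    ∑ i ∈ Finset.Ico v w, ∑ j ∈ Finset.Ico v w,
        P {ω | path ζ ω i - path ζ ω v = x ∧ path ζ ω j - path ζ ω v = y} ≤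
      green P ζ n x * green P ζ n (y - x) + green P ζ n y * green P ζ n (x - y) := by
  have hone : ∀ z, ∑ i ∈ Finset.Ico v w, hitProb P ζ (i - v) z ≤ green P ζ n z := by
    intro z
    refine le_trans (Finset.sum_le_sum fun i hi => ?_)
      (sum_Ico_ite_le (g := fun m => hitProb P ζ m z) le_rfl hn)
    rw [if_pos (Finset.mem_Ico.1 hi).1]
  have hhalf : ∀ x y, ∑ i ∈ Finset.Ico v w, ∑ j ∈ Finset.Ico v w,
      hitProb P ζ (i - v) x * (if i ≤ j then hitProb P ζ (j - i) (y - x) else 0) ≤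
      green P ζ n x * green P ζ n (y - x) := by
    intro x y
    simp_rw [← Finset.mul_sum]
    calc _ ≤ ∑ i ∈ Finset.Ico v w, hitProb P ζ (i - v) x * green P ζ n (y - x) := by
          refine Finset.sum_le_sum fun i hi => ?_
          gcongr
          exact sum_Ico_ite_le (g := fun m => hitProb P ζ m (y - x)) (Finset.mem_Ico.1 hi).1 hn
      _ ≤ _ := by rw [← Finset.sum_mul]; gcongr; exact hone x
  refine le_trans ?_ (add_le_add (hhalf x y) (hhalf y x))
  rw [Finset.sum_comm (s := Finset.Ico v w) (t := Finset.Ico v w)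
    (f := fun i j => hitProb P ζ (i - v) y * (if i ≤ j then hitProb P ζ (j - i) (x - y) else 0)),
    ← Finset.sum_add_distrib]
  refine Finset.sum_le_sum fun i hi => ?_
  rw [← Finset.sum_add_distrib]
  refine Finset.sum_le_sum fun j hj => ?_
  rw [Finset.mem_Ico] at hi hj
  rcases le_total i j with hij | hij
  · rw [h.prob_future_le hi.1 hij, if_pos hij]
    exact le_self_add
  · have e : {ω | path ζ ω i - path ζ ω v = x ∧ path ζ ω j - path ζ ω v = y} =
        {ω | path ζ ω j - path ζ ω v = y ∧ path ζ ω i - path ζ ω v = x} := by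
      ext ω; exact and_comm
    rw [e, h.prob_future_le hj.1 hij, if_pos hij]
    exact le_add_self

theorem sum_prob_past_le (h : IsPlanarWalk P ζ) {u v n : ℕ} (hn : v ≤ u + n)
    (x y : Fin 2 → ℤ) :
    ∑ i ∈ Finset.Ico u v, ∑ j ∈ Finset.Ico u v,
        P {ω | path ζ ω i - path ζ ω v = x ∧ path ζ ω j - path ζ ω v = y} ≤
      green P ζ (n + 1) (-x) * green P ζ (n + 1) (-(y - x)) +
        green P ζ (n + 1) (-y) * green P ζ (n + 1) (-(x - y)) := by
  -- The lags `v - i` run from `1` to `n` inclusive, hence the Green function up to `n + 1`.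
  have hone : ∀ z, ∑ i ∈ Finset.Ico u v, hitProb P ζ (v - i) z ≤ green P ζ (n + 1) z := by
    intro z
    refine le_trans (le_trans (Finset.sum_le_sum fun i hi => ?_)
      (Finset.sum_le_sum_of_subset (Finset.Ico_subset_Ico_right (Nat.le_succ v))))
      (sum_Ico_ite_ge (g := fun m => hitProb P ζ m z) (u := u) (v := v + 1) (Nat.lt_succ_self v)
        (by omega))
    rw [if_pos (Finset.mem_Ico.1 hi).2.le]
  have hhalf : ∀ x y, ∑ j ∈ Finset.Ico u v, ∑ i ∈ Finset.Ico u v,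
      hitProb P ζ (v - j) (-y) * (if i ≤ j then hitProb P ζ (j - i) (y - x) else 0) ≤
      green P ζ (n + 1) (-y) * green P ζ (n + 1) (-(x - y)) := by
    intro x y
    rw [neg_sub]
    simp_rw [← Finset.mul_sum]
    calc _ ≤ ∑ j ∈ Finset.Ico u v, hitProb P ζ (v - j) (-y) * green P ζ (n + 1) (y - x) := by
          refine Finset.sum_le_sum fun j hj => ?_
          gcongr
          exact (sum_Ico_ite_ge (g := fun m => hitProb P ζ m (y - x)) (Finset.mem_Ico.1 hj).2
            hn).trans (green_mono (Nat.le_succ n) _)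
      _ ≤ _ := by rw [← Finset.sum_mul]; gcongr; exact hone _
  refine le_trans ?_ (add_le_add (hhalf y x) (hhalf x y))
  rw [Finset.sum_comm (s := Finset.Ico u v) (t := Finset.Ico u v)
    (f := fun j i => hitProb P ζ (v - j) (-y) *
      (if i ≤ j then hitProb P ζ (j - i) (y - x) else 0)), ← Finset.sum_add_distrib]
  refine Finset.sum_le_sum fun i hi => ?_
  rw [← Finset.sum_add_distrib]
  refine Finset.sum_le_sum fun j hj => ?_
  rw [Finset.mem_Ico] at hi hj
  rcases le_total i j with hij | hij
  · rw [h.prob_past_le hij hj.2.le, if_pos hij]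
    exact le_add_self
  · have e : {ω | path ζ ω i - path ζ ω v = x ∧ path ζ ω j - path ζ ω v = y} =
        {ω | path ζ ω j - path ζ ω v = y ∧ path ζ ω i - path ζ ω v = x} := by
      ext ω; exact and_comm
    rw [e, h.prob_past_le hij hi.2.le, if_pos hij]
    exact le_self_add

/-- The sum runs over the positions `z` of the two later times relative to `v`. Given these, the
positions of the two earlier times are prescribed, and past and future of `v` are independent. -/
theorem prob_two_hits_le (h : IsPlanarWalk P ζ) {u v w i i' j j' : ℕ}
    (hi : i ∈ Finset.Ico u v) (hi' : i' ∈ Finset.Ico u v) (hj : j ∈ Finset.Ico v w)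
    (hj' : j' ∈ Finset.Ico v w) (l : Fin 2 → ℤ) :
    P {ω | path ζ ω i - path ζ ω j = l ∧ path ζ ω i' - path ζ ω j' = l} ≤
      ∑' z : (Fin 2 → ℤ) × (Fin 2 → ℤ),
        P {ω | path ζ ω i - path ζ ω v = z.1 + l ∧ path ζ ω i' - path ζ ω v = z.2 + l} *
        P {ω | path ζ ω j - path ζ ω v = z.1 ∧ path ζ ω j' - path ζ ω v = z.2} := by
  rw [Finset.mem_Ico] at hi hi' hj hj'
  have hsub : {ω | path ζ ω i - path ζ ω j = l ∧ path ζ ω i' - path ζ ω j' = l} ⊆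
      ⋃ z : (Fin 2 → ℤ) × (Fin 2 → ℤ),
        {ω | path ζ ω i - path ζ ω v = z.1 + l ∧ path ζ ω i' - path ζ ω v = z.2 + l} ∩
        {ω | path ζ ω j - path ζ ω v = z.1 ∧ path ζ ω j' - path ζ ω v = z.2} := by
    rintro ω ⟨h1, h2⟩
    refine Set.mem_iUnion.2 ⟨(path ζ ω j - path ζ ω v, path ζ ω j' - path ζ ω v), ⟨?_, ?_⟩, rfl, rfl⟩
    · change path ζ ω i - path ζ ω v = path ζ ω j - path ζ ω v + l
      rw [← h1]; abel
    · change path ζ ω i' - path ζ ω v = path ζ ω j' - path ζ ω v + l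
      rw [← h2]; abel
  refine (measure_mono hsub).trans ((measure_iUnion_le _).trans (le_of_eq ?_))
  refine tsum_congr fun z => ?_
  have hF : DependsOn (fun s : ℕ → Fin 2 → ℤ =>
      ((∑ k ∈ Finset.range i, s k - ∑ k ∈ Finset.range v, s k),
        (∑ k ∈ Finset.range i', s k - ∑ k ∈ Finset.range v, s k)))
      (Finset.Ico u v : Set ℕ) := fun x y hxy => Prod.ext
    (dependsOn_partialSum_sub (Finset.Ico_subset_Ico hi.1 le_rfl)
      (by rw [Finset.Ico_eq_empty (by omega)]; exact Finset.empty_subset _) (by simpa using hxy))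
    (dependsOn_partialSum_sub (Finset.Ico_subset_Ico hi'.1 le_rfl)
      (by rw [Finset.Ico_eq_empty (by omega)]; exact Finset.empty_subset _) (by simpa using hxy))
  have hG : DependsOn (fun s : ℕ → Fin 2 → ℤ =>
      ((∑ k ∈ Finset.range j, s k - ∑ k ∈ Finset.range v, s k),
        (∑ k ∈ Finset.range j', s k - ∑ k ∈ Finset.range v, s k)))
      (Finset.Ico v w : Set ℕ) := fun x y hxy => Prod.ext
    (dependsOn_partialSum_sub (by rw [Finset.Ico_eq_empty (by omega)]; exact Finset.empty_subset _)
      (Finset.Ico_subset_Ico le_rfl hj.2.le) (by simpa using hxy))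
    (dependsOn_partialSum_sub (by rw [Finset.Ico_eq_empty (by omega)]; exact Finset.empty_subset _)
      (Finset.Ico_subset_Ico le_rfl hj'.2.le) (by simpa using hxy))
  have hind := h.indepFun_of_dependsOn hF hG (Finset.Ico_disjoint_Ico_consecutive u v w)
  have := hind.measure_inter_preimage_eq_mul {(z.1 + l, z.2 + l)} {z}
    (measurableSet_singleton _) (measurableSet_singleton _)
  convert! this using 3
  · ext ω
    exact (Prod.ext_iff (x := (path ζ ω i - path ζ ω v, path ζ ω i' - path ζ ω v))
      (y := (z.1 + l, z.2 + l))).symm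
  · ext ω
    exact (Prod.ext_iff (x := (path ζ ω j - path ζ ω v, path ζ ω j' - path ζ ω v))
      (y := z)).symm
  · ext ω
    exact (Prod.ext_iff (x := (path ζ ω i - path ζ ω v, path ζ ω i' - path ζ ω v))
      (y := (z.1 + l, z.2 + l))).symm
  · ext ω
    exact (Prod.ext_iff (x := (path ζ ω j - path ζ ω v, path ζ ω j' - path ζ ω v))
      (y := z)).symm

/-- Summed over all times, the bound of `prob_two_hits_le` pairs the two-point function `F` of the
past, shifted by `l`, with that `G` of the future. A Cauchy–Schwarz type inequality removes the
shift and leaves two square sums, each at most six times the square of `∑_x G_n(x)²` for the Green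
function. -/
theorem sum_prob_two_hits_le (h : IsPlanarWalk P ζ) {u v w n : ℕ} (hv : v ≤ u + n)
    (hw : w ≤ v + n) (l : Fin 2 → ℤ) :
    ∑ p ∈ Finset.Ico u v ×ˢ Finset.Ico u v, ∑ q ∈ Finset.Ico v w ×ˢ Finset.Ico v w,
        P {ω | path ζ ω p.1 - path ζ ω q.1 = l ∧ path ζ ω p.2 - path ζ ω q.2 = l} ≤
      12 * (∑' x, green P ζ (n + 1) x ^ 2) ^ 2 := by
  set F : (Fin 2 → ℤ) → (Fin 2 → ℤ) → ℝ≥0∞ := fun x y =>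
    ∑ p ∈ Finset.Ico u v ×ˢ Finset.Ico u v,
      P {ω | path ζ ω p.1 - path ζ ω v = x ∧ path ζ ω p.2 - path ζ ω v = y} with hF
  set G : (Fin 2 → ℤ) → (Fin 2 → ℤ) → ℝ≥0∞ := fun x y =>
    ∑ q ∈ Finset.Ico v w ×ˢ Finset.Ico v w,
      P {ω | path ζ ω q.1 - path ζ ω v = x ∧ path ζ ω q.2 - path ζ ω v = y} with hG
  have hFsq : ∑' x, ∑' y, F x y ^ 2 ≤ 6 * (∑' x, green P ζ (n + 1) x ^ 2) ^ 2 := by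
    have hneg : ∑' x, green P ζ (n + 1) (-x) ^ 2 = ∑' x, green P ζ (n + 1) x ^ 2 :=
      (Equiv.neg (Fin 2 → ℤ)).tsum_eq fun x => green P ζ (n + 1) x ^ 2
    refine (tsum_tsum_sq_le_of_le (a := fun x => green P ζ (n + 1) (-x))
      (b := fun x => green P ζ (n + 1) (-x)) fun x y => ?_).trans ?_
    · rw [hF]
      simp only [Finset.sum_product]
      exact h.sum_prob_past_le hv x y
    · rw [hneg, sq]
  have hGsq : ∑' x, ∑' y, G x y ^ 2 ≤ 6 * (∑' x, green P ζ (n + 1) x ^ 2) ^ 2 := by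
    refine (tsum_tsum_sq_le_of_le (a := green P ζ (n + 1))
      (b := green P ζ (n + 1)) fun x y => ?_).trans ?_
    · rw [hG]
      simp only [Finset.sum_product]
      exact h.sum_prob_future_le (hw.trans (by omega)) x y
    · rw [sq]
  calc _ ≤ ∑ p ∈ Finset.Ico u v ×ˢ Finset.Ico u v, ∑ q ∈ Finset.Ico v w ×ˢ Finset.Ico v w,
        ∑' z : (Fin 2 → ℤ) × (Fin 2 → ℤ),
        P {ω | path ζ ω p.1 - path ζ ω v = z.1 + l ∧ path ζ ω p.2 - path ζ ω v = z.2 + l} *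
        P {ω | path ζ ω q.1 - path ζ ω v = z.1 ∧ path ζ ω q.2 - path ζ ω v = z.2} := by
        refine Finset.sum_le_sum fun p hp => Finset.sum_le_sum fun q hq => ?_
        rw [Finset.mem_product] at hp hq
        exact h.prob_two_hits_le hp.1 hp.2 hq.1 hq.2 l
    _ = ∑' z : (Fin 2 → ℤ) × (Fin 2 → ℤ), F (z.1 + l) (z.2 + l) * G z.1 z.2 := by
        simp_rw [hF, hG, Finset.sum_mul_sum]
        rw [Summable.tsum_finsetSum fun _ _ => ENNReal.summable]
        refine Finset.sum_congr rfl fun p _ => ?_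
        rw [Summable.tsum_finsetSum fun _ _ => ENNReal.summable]
    _ ≤ ∑' z : (Fin 2 → ℤ) × (Fin 2 → ℤ), (F (z.1 + l) (z.2 + l) ^ 2 + G z.1 z.2 ^ 2) :=
        ENNReal.tsum_le_tsum fun z => ennreal_mul_le_sq_add_sq _ _
    _ = ∑' x, ∑' y, F x y ^ 2 + ∑' x, ∑' y, G x y ^ 2 := by
        rw [ENNReal.tsum_add, ENNReal.tsum_prod (f := fun x y => F (x + l) (y + l) ^ 2),
          ENNReal.tsum_prod (f := fun x y => G x y ^ 2)]
        congr 1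
        have e : ∀ x, ∑' y, F (x + l) (y + l) ^ 2 = ∑' y, F (x + l) y ^ 2 := fun x =>
          (Equiv.addRight l).tsum_eq fun y => F (x + l) y ^ 2
        simp_rw [e]
        exact (Equiv.addRight l).tsum_eq fun x => ∑' y, F x y ^ 2
    _ ≤ 6 * (∑' x, green P ζ (n + 1) x ^ 2) ^ 2 + 6 * (∑' x, green P ζ (n + 1) x ^ 2) ^ 2 :=
        add_le_add hFsq hGsq
    _ = _ := by ring

end IsPlanarWalk

end QuenchedRW

/-! ### Quadratic bound for the variance -/

namespace QuenchedRW

open scoped ENNReal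

/-- Nonnegativity of the variance of `X - 2 Y` bounds the covariance. The factor `3 / 2` on the main
term is small enough for the halving recursion, since `3 / 2 * 5 / 9 < 1`. -/
theorem variance_add_le {Ω : Type*} [MeasurableSpace Ω] {P : Measure Ω} [IsProbabilityMeasure P]
    {X Y : Ω → ℝ} (hX : MemLp X 2 P) (hY : MemLp Y 2 P) :
    variance (fun ω => X ω + Y ω) P ≤ 3 / 2 * variance X P + 3 * variance Y P := by
  rw [variance_fun_add hX hY]
  have h1 := variance_nonneg (X - (2 : ℝ) • Y) P
  rw [variance_sub hX (hY.const_smul (2 : ℝ)), covariance_smul_right, variance_smul] at h1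
  linarith

theorem pairCount_Ico_split (z : ℕ → Fin 2 → ℤ) {u v w : ℕ} (huv : u ≤ v) (hvw : v ≤ w)
    (l : Fin 2 → ℤ) :
    pairCount z (Finset.Ico u w) (Finset.Ico u w) l =
      pairCount z (Finset.Ico u v) (Finset.Ico u v) l +
        pairCount z (Finset.Ico v w) (Finset.Ico v w) l +
      (pairCount z (Finset.Ico u v) (Finset.Ico v w) l +
        pairCount z (Finset.Ico u v) (Finset.Ico v w) (-l)) := by
  have hd := Finset.Ico_disjoint_Ico_consecutive u v w
  rw [← Finset.Ico_union_Ico_eq_Ico huv hvw, pairCount_union_left z hd, pairCount_union_right z _ hd,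
    pairCount_union_right z _ hd, pairCount_swap z (Finset.Ico u v) (Finset.Ico v w) l]
  ring

namespace IsPlanarWalk

variable {Ω : Type*} [MeasurableSpace Ω] {P : Measure Ω} {ζ : ℕ → Ω → (Fin 2 → ℤ)}

theorem integral_pairCount_sq_le (h : IsPlanarWalk P ζ) {K : ℝ} (hK : 0 < K)
    (hKb : ∀ n : ℕ, ∑' x, green P ζ n x ^ 2 ≤ ENNReal.ofReal (K * n)) {u v w n : ℕ}
    (hv : v ≤ u + n) (hw : w ≤ v + n) (l : Fin 2 → ℤ) :
    ∫ ω, pairCount (path ζ ω) (Finset.Ico u v) (Finset.Ico v w) l ^ 2 ∂P ≤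
      12 * (K * (n + 1)) ^ 2 := by
  have := h.isProbabilityMeasure
  set A := Finset.Ico u v
  set B := Finset.Ico v w
  have hms : ∀ p q : ℕ × ℕ, MeasurableSet
      {ω | path ζ ω p.1 - path ζ ω q.1 = l ∧ path ζ ω p.2 - path ζ ω q.2 = l} := fun p q =>
    (h.measurableSet_path_sub p.1 q.1 l).inter (h.measurableSet_path_sub p.2 q.2 l)
  have hexp : ∀ ω, pairCount (path ζ ω) A B l ^ 2 = ∑ p ∈ A ×ˢ A, ∑ q ∈ B ×ˢ B,
      Set.indicator {ω | path ζ ω p.1 - path ζ ω q.1 = l ∧ path ζ ω p.2 - path ζ ω q.2 = l}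
        (1 : Ω → ℝ) ω := by
    intro ω
    rw [pairCount, sq, Finset.sum_mul_sum, Finset.sum_product]
    refine Finset.sum_congr rfl fun i _ => Finset.sum_congr rfl fun i' _ => ?_
    rw [Finset.sum_mul_sum, Finset.sum_product]
    refine Finset.sum_congr rfl fun j _ => Finset.sum_congr rfl fun j' _ => ?_
    by_cases h1 : path ζ ω i - path ζ ω j = l <;> by_cases h2 : path ζ ω i' - path ζ ω j' = l <;>
      simp [h1, h2]
  simp_rw [hexp]
  have hint : ∀ p q : ℕ × ℕ, Integrable (Set.indicator
      {ω | path ζ ω p.1 - path ζ ω q.1 = l ∧ path ζ ω p.2 - path ζ ω q.2 = l} (1 : Ω → ℝ)) P :=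
    fun p q => (integrable_const (1 : ℝ)).indicator (hms p q)
  rw [integral_finsetSum _ fun p _ => integrable_finsetSum _ fun q _ => hint p q]
  simp_rw [integral_finsetSum _ fun q _ => hint _ q, integral_indicator_one (hms _ _),
    measureReal_def]
  have hb := (h.sum_prob_two_hits_le hv hw l).trans
    (mul_le_mul_right (pow_le_pow_left₀ zero_le (hKb (n + 1)) 2) 12)
  have hr : (12 : ℝ≥0∞) * ENNReal.ofReal (K * (n + 1 : ℕ)) ^ 2 =
      ENNReal.ofReal (12 * (K * (n + 1)) ^ 2) := by
    rw [ENNReal.ofReal_mul (p := 12) (by norm_num), ENNReal.ofReal_pow (by positivity)]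
    simp
  rw [hr] at hb
  have ht := ENNReal.toReal_mono ENNReal.ofReal_ne_top hb
  rw [ENNReal.toReal_ofReal (by positivity),
    ENNReal.toReal_sum fun p _ => (ENNReal.sum_ne_top.2 fun q _ => measure_ne_top P _)] at ht
  refine le_trans (le_of_eq (Finset.sum_congr rfl fun p _ => ?_)) ht
  rw [ENNReal.toReal_sum fun q _ => measure_ne_top P _]

/-- The number of pairs of times with a given displacement has quadratic variance. -/
theorem exists_variance_pairCount_le (h : IsPlanarWalk P ζ) (l : Fin 2 → ℤ) :
    ∃ K > 0, ∀ n u : ℕ, variance (fun ω =>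
      pairCount (path ζ ω) (Finset.Ico u (u + n)) (Finset.Ico u (u + n)) l) P ≤ K * n ^ 2 := by
  have := h.isProbabilityMeasure
  obtain ⟨K₀, hK₀, hKb⟩ := h.exists_tsum_green_sq_le
  -- With `R = 3 * (4 * (12 * K₀ ^ 2))` the recursion reads `5 / 6 * K + R ≤ K`, that is `K ≥ 6 *
  -- R`. The extra `1` covers `n < 2`.
  refine ⟨1 + 6 * (3 * (4 * (12 * K₀ ^ 2))), by positivity, fun n => ?_⟩
  induction n using Nat.strong_induction_on with
  | _ n ih =>
  intro u
  rcases lt_or_ge n 2 with hn | hn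
  · have hb : ∀ ω, ‖pairCount (path ζ ω) (Finset.Ico u (u + n)) (Finset.Ico u (u + n)) l ^ 2‖ ≤
        (n : ℝ) ^ 2 := by
      intro ω
      have h0 := pairCount_nonneg (path ζ ω) (Finset.Ico u (u + n)) (Finset.Ico u (u + n)) l
      have h1 := pairCount_le_card (path ζ ω) (Finset.Ico u (u + n)) (Finset.Ico u (u + n)) l
      rw [Nat.card_Ico, Nat.add_sub_cancel_left] at h1
      rw [Real.norm_of_nonneg (by positivity)]
      have h2 : (n : ℝ) * n ≤ n := by
        interval_cases n <;> norm_num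
      exact pow_le_pow_left₀ h0 (h1.trans h2) 2
    refine (variance_le_expectation_sq (h.measurable_pairCount _ _ l).aestronglyMeasurable).trans ?_
    refine (Real.le_norm_self _).trans ((norm_integral_le_of_norm_le_const
      (ae_of_all _ hb)).trans ?_)
    rw [probReal_univ, mul_one]
    exact le_mul_of_one_le_left (by positivity) (by nlinarith [sq_nonneg K₀])
  · set a := n / 2 with ha
    set b := n - n / 2 with hb
    have hab : a + b = n := by omega
    set v := u + a with hv
    have hw : u + n = v + b := by omega
    have hVa := ih a (by omega) u
    have hVb := ih b (by omega) v
    rw [hw]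
    set V₁ : Ω → ℝ := fun ω => pairCount (path ζ ω) (Finset.Ico u v) (Finset.Ico u v) l with hV₁
    set V₂ : Ω → ℝ := fun ω =>
      pairCount (path ζ ω) (Finset.Ico v (v + b)) (Finset.Ico v (v + b)) l with hV₂
    set I : (Fin 2 → ℤ) → Ω → ℝ := fun l ω =>
      pairCount (path ζ ω) (Finset.Ico u v) (Finset.Ico v (v + b)) l with hI
    have hsplit : (fun ω => pairCount (path ζ ω) (Finset.Ico u (v + b))
        (Finset.Ico u (v + b)) l) = fun ω => (V₁ + V₂) ω + (I l + I (-l)) ω :=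
      funext fun ω => pairCount_Ico_split _ (by omega) (by omega) l
    have hm₁ : MemLp V₁ 2 P := h.memLp_pairCount _ _ _ _
    have hm₂ : MemLp V₂ 2 P := h.memLp_pairCount _ _ _ _
    have hmI : ∀ l, MemLp (I l) 2 P := fun l => h.memLp_pairCount _ _ _ _
    have hindep : IndepFun V₁ V₂ P := h.indepFun_of_dependsOn
      (F := fun s => pairCount (fun n => ∑ k ∈ Finset.range n, s k)
        (Finset.Ico u v) (Finset.Ico u v) l)
      (G := fun s => pairCount (fun n => ∑ k ∈ Finset.range n, s k)
        (Finset.Ico v (v + b)) (Finset.Ico v (v + b)) l)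
      (by simpa using dependsOn_pairCount (u := u) (v := v) l)
      (by simpa using dependsOn_pairCount (u := v) (v := v + b) l)
      (Finset.Ico_disjoint_Ico_consecutive u v (v + b))
    have hI2 : ∀ l, ∫ ω, I l ω ^ 2 ∂P ≤ 12 * K₀ ^ 2 * n ^ 2 := by
      intro l
      -- For `n ≥ 2` both halves have length at most `n - 1`, so the bound in `(n - 1) + 1` becomes
      -- one in `n`.
      have := h.integral_pairCount_sq_le hK₀ hKb (u := u) (v := v) (w := v + b) (n := n - 1)
        (by omega) (by omega) l
      refine this.trans (le_of_eq ?_)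
      have e : ((n - 1 : ℕ) : ℝ) + 1 = n := by
        have : n - 1 + 1 = n := by omega
        exact_mod_cast this
      rw [e]; ring
    have hR : variance (I l + I (-l)) P ≤ 4 * (12 * K₀ ^ 2) * n ^ 2 := by
      refine (variance_le_expectation_sq ((hmI l).add (hmI (-l))).aestronglyMeasurable).trans ?_
      have hi : ∀ l, Integrable (fun ω => I l ω ^ 2) P := fun l => (hmI l).integrable_sq
      calc ∫ ω, ((I l + I (-l)) ^ 2) ω ∂P ≤ ∫ ω, (2 * I l ω ^ 2 + 2 * I (-l) ω ^ 2) ∂P := by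
            refine integral_mono ((hmI l).add (hmI (-l))).integrable_sq
              (((hi l).const_mul 2).add ((hi (-l)).const_mul 2)) fun ω => ?_
            change (I l ω + I (-l) ω) ^ 2 ≤ 2 * I l ω ^ 2 + 2 * I (-l) ω ^ 2
            nlinarith [sq_nonneg (I l ω - I (-l) ω)]
        _ = 2 * ∫ ω, I l ω ^ 2 ∂P + 2 * ∫ ω, I (-l) ω ^ 2 ∂P := by
            rw [integral_add ((hi l).const_mul 2) ((hi (-l)).const_mul 2), integral_const_mul,
              integral_const_mul]
        _ ≤ _ := by linarith [hI2 l, hI2 (-l)]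
    rw [hsplit]
    refine (variance_add_le (hm₁.add hm₂) ((hmI l).add (hmI (-l)))).trans ?_
    rw [hindep.variance_add hm₁ hm₂]
    -- The halves differ by at most one; the worst case is `n = 3`, split as `1 + 2`.
    have hn2 : ((a : ℝ) ^ 2 + (b : ℝ) ^ 2) ≤ 5 / 9 * (n : ℝ) ^ 2 := by
      have h1 : 9 * (a ^ 2 + b ^ 2) ≤ 5 * n ^ 2 := by
        rcases Nat.even_or_odd n with ⟨k, hk⟩ | ⟨k, hk⟩
        · have e1 : a = k := by omega
          have e2 : b = k := by omega
          rw [e1, e2, hk]; nlinarith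
        · have e1 : a = k := by omega
          have e2 : b = k + 1 := by omega
          have : 1 ≤ k := by omega
          rw [e1, e2, hk]; nlinarith
      have h2 : (9 : ℝ) * ((a : ℝ) ^ 2 + (b : ℝ) ^ 2) ≤ 5 * (n : ℝ) ^ 2 := by exact_mod_cast h1
      linarith
    have hK : (0 : ℝ) < 1 + 6 * (3 * (4 * (12 * K₀ ^ 2))) := by positivity
    have h3 := mul_le_mul_of_nonneg_left hn2 hK.le
    have h4 : (0 : ℝ) ≤ (n : ℝ) ^ 2 := by positivity
    calc 3 / 2 * (variance V₁ P + variance V₂ P) + 3 * variance (I l + I (-l)) P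
        ≤ 3 / 2 * ((1 + 6 * (3 * (4 * (12 * K₀ ^ 2)))) * (a : ℝ) ^ 2 +
          (1 + 6 * (3 * (4 * (12 * K₀ ^ 2)))) * (b : ℝ) ^ 2) +
          3 * (4 * (12 * K₀ ^ 2) * n ^ 2) := by gcongr
      _ ≤ _ := by nlinarith

end IsPlanarWalk

end QuenchedRW

/-! ### Almost sure asymptotics along geometric sequences -/

namespace QuenchedRW

open scoped ENNReal

/-- The series of the squares has finite expectation, so it converges almost surely and its terms
tend to zero. -/
theorem ae_tendsto_zero_of_summable_sq {Ω : Type*} [MeasurableSpace Ω] {P : Measure Ω}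
    {Y : ℕ → Ω → ℝ} (hY : ∀ k, MemLp (Y k) 2 P) {b : ℕ → ℝ} (hb : Summable b)
    (hle : ∀ k, ∫ ω, Y k ω ^ 2 ∂P ≤ b k) :
    ∀ᵐ ω ∂P, Tendsto (fun k => Y k ω) atTop (𝓝 0) := by
  have hfin : ∫⁻ ω, ∑' k, ENNReal.ofReal (Y k ω ^ 2) ∂P ≠ ∞ := by
    rw [lintegral_tsum fun k => ((hY k).aestronglyMeasurable.aemeasurable.pow_const 2).ennreal_ofReal]
    have h1 : ∀ k, ∫⁻ ω, ENNReal.ofReal (Y k ω ^ 2) ∂P ≤ ENNReal.ofReal (b k) := by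
      intro k
      rw [← ofReal_integral_eq_lintegral_ofReal (hY k).integrable_sq
        (ae_of_all _ fun ω => sq_nonneg _)]
      exact ENNReal.ofReal_le_ofReal (hle k)
    refine ne_top_of_le_ne_top ?_ (ENNReal.tsum_le_tsum h1)
    exact hb.tsum_ofReal_ne_top
  have hae := ae_lt_top' (AEMeasurable.tsum fun k =>
    ((hY k).aestronglyMeasurable.aemeasurable.pow_const 2).ennreal_ofReal) hfin
  filter_upwards [hae] with ω hω
  have h2 := ENNReal.tendsto_atTop_zero_of_tsum_ne_top hω.ne
  have h3 : Tendsto (fun k => Y k ω ^ 2) atTop (𝓝 0) := by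
    have := (ENNReal.tendsto_toReal ENNReal.zero_ne_top).comp h2
    simpa [Function.comp_def, ENNReal.toReal_ofReal (sq_nonneg _)] using this
  have h4 := h3.sqrt
  rw [Real.sqrt_zero] at h4
  simp_rw [Real.sqrt_sq_eq_abs] at h4
  exact (tendsto_zero_iff_abs_tendsto_zero _).2 h4

/-- The number of integer points of the dilated block. -/
theorem tendsto_block_length {c : ℝ} (hc : 1 < c) {s t : ℝ} (hs : 0 ≤ s) (hst : s < t) :
    Tendsto (fun k : ℕ => ((⌊c ^ k * t⌋₊ - ⌊c ^ k * s⌋₊ : ℕ) : ℝ) / c ^ k) atTop (𝓝 (t - s)) := by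
  have hpow : Tendsto (fun k : ℕ => c ^ k) atTop atTop := tendsto_pow_atTop_atTop_of_one_lt hc
  have h1 := (tendsto_nat_floor_mul_div_atTop (hs.trans hst.le)).comp hpow
  have h2 := (tendsto_nat_floor_mul_div_atTop hs).comp hpow
  refine (h1.sub h2).congr fun k => ?_
  have hle : ⌊c ^ k * s⌋₊ ≤ ⌊c ^ k * t⌋₊ := Nat.floor_mono (by gcongr)
  simp only [Function.comp]
  rw [Nat.cast_sub hle, sub_div, mul_comm t, mul_comm s]

/-- Since `n k / c ^ k` has a positive limit, `log (n k)` and `log (c ^ k)` are asymptotically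
equal, and only the ratio of lengths survives. -/
theorem tendsto_div_mul_log_block {c : ℝ} (hc : 1 < c) {n : ℕ → ℕ} {r : ℝ} (hr : 0 < r)
    (hn : Tendsto (fun k : ℕ => (n k : ℝ) / c ^ k) atTop (𝓝 r)) {m : ℕ → ℝ} {C : ℝ}
    (hm : Tendsto (fun n : ℕ => m n / (n * Real.log n)) atTop (𝓝 C)) :
    Tendsto (fun k : ℕ => m (n k) / (c ^ k * Real.log (c ^ k))) atTop (𝓝 (C * r)) := by
  have hc0 : 0 < c := by linarith
  have hpow : Tendsto (fun k : ℕ => c ^ k) atTop atTop := tendsto_pow_atTop_atTop_of_one_lt hc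
  have hlogpow : Tendsto (fun k : ℕ => Real.log (c ^ k)) atTop atTop :=
    Real.tendsto_log_atTop.comp hpow
  have hntop : Tendsto n atTop atTop := by
    rw [← tendsto_natCast_atTop_iff (R := ℝ)]
    refine (hn.pos_mul_atTop hr hpow).congr fun k => ?_
    have : c ^ k ≠ 0 := by positivity
    field_simp
  have hlogr : Tendsto (fun k : ℕ => Real.log (n k) / Real.log (c ^ k)) atTop (𝓝 1) := by
    have h1 := ((hn.log hr.ne').div_atTop hlogpow).add_const 1
    rw [zero_add] at h1
    refine h1.congr' ?_
    filter_upwards [hlogpow.eventually_gt_atTop 0, hntop.eventually_gt_atTop 0] with k hk hk'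
    have h2 : (0 : ℝ) < n k := by exact_mod_cast hk'
    have h3 : (0 : ℝ) < c ^ k := by positivity
    rw [Real.log_div h2.ne' h3.ne', sub_div, div_self hk.ne']
    ring
  have h4 := ((hm.comp hntop).mul hn).mul hlogr
  rw [mul_one] at h4
  refine h4.congr' ?_
  filter_upwards [hlogpow.eventually_gt_atTop 0, hntop.eventually_gt_atTop 1] with k hk hk'
  have h2 : (1 : ℝ) < n k := by exact_mod_cast hk'
  have h3 : (0 : ℝ) < c ^ k := by positivity
  have h5 := Real.log_pos h2
  simp only [Function.comp]
  field_simp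

/-- The pair counts of `z` over dilated blocks have the asymptotics of a planar walk along
geometric sequences. -/
def HasGeometricAsymptotics (z : ℕ → Fin 2 → ℤ) (C : ℝ) : Prop :=
  ∀ (l : Fin 2 → ℤ) (c s t : ℚ), 1 < c → 0 ≤ s → s < t →
    Tendsto (fun k : ℕ => pairCount z (Finset.Ico ⌊(c : ℝ) ^ k * s⌋₊ ⌊(c : ℝ) ^ k * t⌋₊)
      (Finset.Ico ⌊(c : ℝ) ^ k * s⌋₊ ⌊(c : ℝ) ^ k * t⌋₊) l /
        ((c : ℝ) ^ k * Real.log ((c : ℝ) ^ k))) atTop (𝓝 (C * ((t : ℝ) - s)))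

namespace IsPlanarWalk

variable {Ω : Type*} [MeasurableSpace Ω] {P : Measure Ω} {ζ : ℕ → Ω → (Fin 2 → ℤ)}

theorem ae_tendsto_pairCount (h : IsPlanarWalk P ζ) (l : Fin 2 → ℤ) {c s t : ℝ} (hc : 1 < c)
    (hs : 0 ≤ s) (hst : s < t) :
    ∀ᵐ ω ∂P, Tendsto (fun k : ℕ =>
      pairCount (path ζ ω) (Finset.Ico ⌊c ^ k * s⌋₊ ⌊c ^ k * t⌋₊)
        (Finset.Ico ⌊c ^ k * s⌋₊ ⌊c ^ k * t⌋₊) l / (c ^ k * Real.log (c ^ k))) atTop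
      (𝓝 (selfIntersectionConst (covMatrix P (ζ 0)) * (t - s))) := by
  have := h.isProbabilityMeasure
  obtain ⟨K, hK, hvar⟩ := h.exists_variance_pairCount_le l
  have hlogc : 0 < Real.log c := Real.log_pos hc
  have hc0 : 0 < c := by linarith
  have ht : 0 < t := by linarith
  set n : ℕ → ℕ := fun k => ⌊c ^ k * t⌋₊ - ⌊c ^ k * s⌋₊ with hn
  have hle : ∀ k, ⌊c ^ k * s⌋₊ ≤ ⌊c ^ k * t⌋₊ := fun k => Nat.floor_mono (by gcongr)
  have hw : ∀ k, ⌊c ^ k * t⌋₊ = ⌊c ^ k * s⌋₊ + n k := fun k => by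
    have := hle k; simp only [hn]; omega
  set V : ℕ → Ω → ℝ := fun k ω => pairCount (path ζ ω) (Finset.Ico ⌊c ^ k * s⌋₊ ⌊c ^ k * t⌋₊)
        (Finset.Ico ⌊c ^ k * s⌋₊ ⌊c ^ k * t⌋₊) l with hV
  set a : ℕ → ℝ := fun k => c ^ k * Real.log (c ^ k) with ha
  have hVm : ∀ k, MemLp (V k) 2 P := fun k => h.memLp_pairCount _ _ _ _
  have hmean : ∀ k, ∫ ω, V k ω ∂P = meanCount P ζ (n k) l := by
    intro k
    simp only [hV]
    rw [hw k]
    exact h.integral_pairCount_Ico _ _ _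
  have hvark : ∀ k, variance (V k) P ≤ K * (n k : ℝ) ^ 2 := by
    intro k
    have := hvar (n k) ⌊c ^ k * s⌋₊
    rw [← hw k] at this
    exact this
  have hfl : ∀ᵐ ω ∂P, Tendsto (fun k => (V k ω - meanCount P ζ (n k) l) / a k) atTop (𝓝 0) := by
    refine ae_tendsto_zero_of_summable_sq
      -- The variance is at most `K (c^k t)²` and the normalisation is `c^k * k * log c`; the
      -- quotient decays like `1 / k²`.
      (b := fun k : ℕ => K * (t / Real.log c) ^ 2 * (1 / (k : ℝ) ^ 2))
      (fun k => ?_) ((Real.summable_one_div_nat_pow.2 (by norm_num)).mul_left _) fun k => ?_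
    · have : (fun ω => (V k ω - meanCount P ζ (n k) l) / a k) =
          fun ω => (a k)⁻¹ * (V k ω - meanCount P ζ (n k) l) := by
        funext ω; rw [div_eq_inv_mul]
      rw [this]
      exact ((hVm k).sub (memLp_const _)).const_mul _
    · have h1 : ∀ ω, ((V k ω - meanCount P ζ (n k) l) / a k) ^ 2 =
          ((a k) ^ 2)⁻¹ * (V k ω - ∫ ω, V k ω ∂P) ^ 2 := by
        intro ω; rw [hmean, div_pow, div_eq_inv_mul]
      simp_rw [h1]
      rw [integral_const_mul, ← variance_eq_integral (hVm k).aestronglyMeasurable.aemeasurable]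
      -- At `k = 0` the normalisation is `log 1 = 0`, and both sides vanish by the convention for
      -- division by zero.
      rcases Nat.eq_zero_or_pos k with rfl | hk
      · simp [ha]
      have hk' : (0 : ℝ) < k := by exact_mod_cast hk
      have hpk : 0 < c ^ k := by positivity
      have hnk : (n k : ℝ) ≤ c ^ k * t := by
        have h2 : n k ≤ ⌊c ^ k * t⌋₊ := Nat.sub_le _ _
        have h3 : (⌊c ^ k * t⌋₊ : ℝ) ≤ c ^ k * t := Nat.floor_le (by positivity)
        have h2' : (n k : ℝ) ≤ ⌊c ^ k * t⌋₊ := by exact_mod_cast h2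
        linarith
      have hak : a k = c ^ k * (k * Real.log c) := by simp only [ha]; rw [Real.log_pow]
      calc ((a k) ^ 2)⁻¹ * variance (V k) P ≤ ((a k) ^ 2)⁻¹ * (K * (c ^ k * t) ^ 2) := by
            gcongr
            refine (hvark k).trans ?_
            gcongr
        _ = _ := by rw [hak]; field_simp
  filter_upwards [hfl] with ω hω
  have hm := tendsto_div_mul_log_block hc (sub_pos.2 hst) (tendsto_block_length hc hs hst)
    (h.tendsto_meanCount l)
  have := hω.add hm
  rw [zero_add] at this
  refine this.congr fun k => ?_
  rw [← add_div, sub_add_cancel]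

/-- Rational parameters keep the union of exceptional sets countable. Real end points and all `n`
are recovered deterministically by monotonicity. -/
theorem ae_hasGeometricAsymptotics (h : IsPlanarWalk P ζ) :
    ∀ᵐ ω ∂P, HasGeometricAsymptotics (path ζ ω)
      (selfIntersectionConst (covMatrix P (ζ 0))) := by
  simp only [HasGeometricAsymptotics]
  refine ae_all_iff.2 fun l => ae_all_iff.2 fun c => ae_all_iff.2 fun s => ae_all_iff.2 fun t => ?_
  by_cases hcond : 1 < c ∧ 0 ≤ s ∧ s < t
  · filter_upwards [h.ae_tendsto_pairCount l (c := c) (s := s) (t := t)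
      (by exact_mod_cast hcond.1) (by exact_mod_cast hcond.2.1) (by exact_mod_cast hcond.2.2)]
      with ω hω _ _ _
    exact hω
  · exact ae_of_all _ fun ω h1 h2 h3 => absurd ⟨h1, h2, h3⟩ hcond

end IsPlanarWalk

end QuenchedRW

/-! ### From geometric scales and rational blocks to all scales and real blocks -/

namespace QuenchedRW

/-- The index of the geometric scale just below `n`. -/
theorem exists_geometric_scale {c : ℝ} (hc : 1 < c) :
    ∃ κ : ℕ → ℕ, Tendsto κ atTop atTop ∧
      ∀ n : ℕ, 1 ≤ n → c ^ κ n ≤ n ∧ (n : ℝ) < c ^ (κ n + 1) := by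
  have h : ∀ n : ℕ, ∃ k : ℕ, 1 ≤ n → c ^ k ≤ n ∧ (n : ℝ) < c ^ (k + 1) := by
    intro n
    by_cases hn : 1 ≤ n
    · obtain ⟨k, hk⟩ := exists_nat_pow_near (x := (n : ℝ)) (by exact_mod_cast hn) hc
      exact ⟨k, fun _ => hk⟩
    · exact ⟨0, fun h => absurd h hn⟩
  choose κ hκ using h
  refine ⟨κ, tendsto_atTop.2 fun m => ?_, hκ⟩
  have hev : ∀ᶠ n : ℕ in atTop, c ^ m ≤ (n : ℝ) :=
    tendsto_natCast_atTop_atTop.eventually_ge_atTop _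
  filter_upwards [hev, eventually_ge_atTop 1] with n hn h1
  have h2 := hn.trans_lt (hκ n h1).2
  have := (pow_lt_pow_iff_right₀ hc).1 h2
  omega

/-- For `c^k ≤ n < c^(k+1)` the condition `c * s ≤ s'` places `[c^k s', c^k t')` inside `[n s, n
t)`. The division by `c` anticipates the change of normalisation from `c^k` to `c^(k+1)`. -/
theorem exists_rat_inner_block {s t e : ℝ} (hs : 0 ≤ s) (hst : s < t) (he : 0 < e) :
    ∃ c s' t' : ℚ, 1 < c ∧ (c : ℝ) * s ≤ s' ∧ s' < t' ∧ (t' : ℝ) ≤ t ∧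
      (t - s) - e ≤ ((t' : ℝ) - s') / c := by
  set e' := min e ((t - s) / 2) with he'
  have he0 : 0 < e' := lt_min he (by linarith)
  -- The budget `e' = δ * (2 + s + t)` pays for rounding `s'`, `t'` and `c` by `δ` each; `e' ≤ (t -
  -- s) / 2` keeps the inner block nonempty.
  set δ := e' / (2 + s + t) with hδ
  have hden : 0 < 2 + s + t := by linarith
  have hδ0 : 0 < δ := by positivity
  have hδe : δ * (2 + s + t) = e' := by rw [hδ]; field_simp
  obtain ⟨c, hc1, hc2⟩ := exists_rat_btwn (show (1 : ℝ) < 1 + δ by linarith)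
  obtain ⟨s', hs1, hs2⟩ := exists_rat_btwn (show (c : ℝ) * s < c * s + δ by linarith)
  obtain ⟨t', ht1, ht2⟩ := exists_rat_btwn (show t - δ < t by linarith)
  have h1 : (c : ℝ) * s ≤ s + δ * s := by nlinarith
  have hee : e' ≤ e := min_le_left _ _
  have hes : e' ≤ (t - s) / 2 := min_le_right _ _
  have ht : 0 < t := by linarith
  have hlt : (s' : ℝ) < t' := by nlinarith [mul_pos hδ0 ht]
  have hc0 : (0 : ℝ) < c := by linarith
  refine ⟨c, s', t', by exact_mod_cast hc1, hs1.le, by exact_mod_cast hlt, ht2.le, ?_⟩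
  rw [le_div_iff₀ hc0]
  have h2 : t - s - e ≤ t - s - e' := by linarith
  have h3 : 0 ≤ t - s - e' := by linarith
  calc (t - s - e) * c ≤ (t - s - e') * c := by gcongr
    _ ≤ (t - s - e') * (1 + δ) := by gcongr
    _ ≤ t' - s' := by nlinarith [mul_nonneg hδ0.le he0.le, mul_nonneg hδ0.le hs]

theorem tendsto_mul_log_pow_succ {c : ℝ} (hc : 1 < c) :
    Tendsto (fun k : ℕ => (c ^ k * Real.log (c ^ k)) / (c ^ (k + 1) * Real.log (c ^ (k + 1))))
      atTop (𝓝 (1 / c)) := by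
  have hc0 : 0 < c := by linarith
  have h1 := (tendsto_natCast_div_add_atTop (1 : ℝ)).const_mul (1 / c)
  rw [mul_one] at h1
  refine h1.congr fun k => ?_
  have hl := Real.log_pos hc
  have : c ^ k ≠ 0 := by positivity
  rw [Real.log_pow, Real.log_pow, pow_succ]
  push_cast
  have : (k : ℝ) + 1 ≠ 0 := by positivity
  field_simp

theorem HasGeometricAsymptotics.eventually_ge {z : ℕ → Fin 2 → ℤ} {C : ℝ}
    (hz : HasGeometricAsymptotics z C) (hC : 0 ≤ C) (l : Fin 2 → ℤ) {s t : ℝ} (hs : 0 ≤ s)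
    (hst : s < t) {ε : ℝ} (hε : 0 < ε) :
    ∀ᶠ n : ℕ in atTop, C * (t - s) - ε ≤
      pairCount z (Finset.Ico ⌊(n : ℝ) * s⌋₊ ⌊(n : ℝ) * t⌋₊)
        (Finset.Ico ⌊(n : ℝ) * s⌋₊ ⌊(n : ℝ) * t⌋₊) l / (n * Real.log n) := by
  obtain ⟨c, s', t', hc, hs', hst', ht', hlow⟩ := exists_rat_inner_block hs hst
    (show 0 < ε / (2 * (C + 1)) by positivity)
  have hcR : (1 : ℝ) < c := by exact_mod_cast hc
  have hc0 : (0 : ℝ) < c := by linarith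
  have hs'0 : 0 ≤ s' := by
    have : (0 : ℝ) ≤ s' := le_trans (by positivity) hs'
    exact_mod_cast this
  obtain ⟨κ, hκ, hκn⟩ := exists_geometric_scale hcR
  have hlim := ((hz l c s' t' hc hs'0 hst').mul (tendsto_mul_log_pow_succ hcR)).comp hκ
  have hval : C * (t - s) - ε < C * ((t' : ℝ) - s') * (1 / c) := by
    have h1 : C * ((t - s) - ε / (2 * (C + 1))) ≤ C * (((t' : ℝ) - s') / c) := by gcongr
    have h2 : C * (ε / (2 * (C + 1))) < ε := by
      rw [mul_div_assoc', div_lt_iff₀ (by positivity)]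
      nlinarith
    have h3 : C * (((t' : ℝ) - s') / c) = C * ((t' : ℝ) - s') * (1 / c) := by ring
    rw [mul_sub] at h1
    linarith
  filter_upwards [hlim.eventually (lt_mem_nhds hval), eventually_ge_atTop 2,
    hκ.eventually_ge_atTop 1] with n hn hn2 hκ1
  obtain ⟨hk1, hk2⟩ := hκn n (by omega)
  have hn1 : (1 : ℝ) < n := by exact_mod_cast hn2
  have hlogn := Real.log_pos hn1
  set k := κ n with hk
  have hck : (0 : ℝ) < (c : ℝ) ^ k := by positivity
  have hsub : Finset.Ico ⌊(c : ℝ) ^ k * s'⌋₊ ⌊(c : ℝ) ^ k * t'⌋₊ ⊆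
      Finset.Ico ⌊(n : ℝ) * s⌋₊ ⌊(n : ℝ) * t⌋₊ := by
    refine Finset.Ico_subset_Ico (Nat.floor_mono ?_) (Nat.floor_mono ?_)
    · calc (n : ℝ) * s ≤ (c : ℝ) ^ (k + 1) * s := by gcongr
        _ = (c : ℝ) ^ k * (c * s) := by ring
        _ ≤ _ := by gcongr
    · have : (0 : ℝ) ≤ t := by linarith
      calc (c : ℝ) ^ k * t' ≤ (c : ℝ) ^ k * t := by gcongr
        _ ≤ _ := by gcongr
  have hmono := pairCount_mono z hsub hsub l
  have hnn := pairCount_nonneg z (Finset.Ico ⌊(c : ℝ) ^ k * s'⌋₊ ⌊(c : ℝ) ^ k * t'⌋₊)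
    (Finset.Ico ⌊(c : ℝ) ^ k * s'⌋₊ ⌊(c : ℝ) ^ k * t'⌋₊) l
  have hlogk : 0 < Real.log ((c : ℝ) ^ k) := Real.log_pos (one_lt_pow₀ hcR (by omega))
  refine hn.le.trans ?_
  simp only [Function.comp]
  rw [← hk, div_mul_div_cancel₀ (by positivity)]
  have hlogle : Real.log n ≤ Real.log ((c : ℝ) ^ (k + 1)) := Real.log_le_log (by linarith) hk2.le
  exact div_le_div₀ (pairCount_nonneg _ _ _ _) hmono (by positivity)
    (mul_le_mul hk2.le hlogle hlogn.le (by positivity))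

/-- The interval `[0, n)` lies in `[0, c^(k+1))`, the block with `s = 0` and `t = c` at scale `k`.
An upper bound is needed only for the full square. -/
theorem HasGeometricAsymptotics.eventually_le {z : ℕ → Fin 2 → ℤ} {C : ℝ}
    (hz : HasGeometricAsymptotics z C) (hC : 0 ≤ C) (l : Fin 2 → ℤ) {ε : ℝ} (hε : 0 < ε) :
    ∀ᶠ n : ℕ in atTop, pairCount z (Finset.Ico 0 n) (Finset.Ico 0 n) l / (n * Real.log n) ≤
      C + ε := by
  obtain ⟨c, hc1, hc2⟩ := exists_rat_btwn (show (1 : ℝ) < 1 + ε / (C + 1) by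
    have : 0 < ε / (C + 1) := by positivity
    linarith)
  have hc : 1 < c := by exact_mod_cast hc1
  have hc0 : (0 : ℝ) < c := by linarith
  obtain ⟨κ, hκ, hκn⟩ := exists_geometric_scale hc1
  have hlim := (hz l c 0 c hc le_rfl (by linarith)).comp hκ
  have hval : C * ((c : ℝ) - (0 : ℚ)) < C + ε := by
    have h1 : C * (c : ℝ) ≤ C * (1 + ε / (C + 1)) := by gcongr
    have h2 : C * (ε / (C + 1)) < ε := by
      rw [mul_div_assoc', div_lt_iff₀ (by positivity)]
      nlinarith
    rw [Rat.cast_zero, sub_zero]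
    linarith
  filter_upwards [hlim.eventually (gt_mem_nhds hval), eventually_ge_atTop 2,
    hκ.eventually_ge_atTop 1] with n hn hn2 hκ1
  obtain ⟨hk1, hk2⟩ := hκn n (by omega)
  have hn1 : (1 : ℝ) < n := by exact_mod_cast hn2
  set k := κ n with hk
  have hsub : Finset.Ico 0 n ⊆
      Finset.Ico ⌊(c : ℝ) ^ k * ((0 : ℚ) : ℝ)⌋₊ ⌊(c : ℝ) ^ k * c⌋₊ := by
    refine Finset.Ico_subset_Ico (by simp) (Nat.le_floor ?_)
    rw [← pow_succ]
    exact hk2.le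
  refine le_trans ?_ hn.le
  simp only [Function.comp]
  have hlogk : 0 < Real.log ((c : ℝ) ^ k) := Real.log_pos (one_lt_pow₀ hc1 (by omega))
  have hlogle : Real.log ((c : ℝ) ^ k) ≤ Real.log n := Real.log_le_log (by positivity) hk1
  exact div_le_div₀ (pairCount_nonneg _ _ _ _) (pairCount_mono z hsub hsub l) (by positivity)
    (mul_le_mul hk1 hlogle hlogk.le (by linarith))

/-- Eventual lower bounds for finitely many sequences together with a matching upper bound for their
sum force convergence. -/
theorem tendsto_of_eventually_ge_of_sum_le {ι : Type*} [Fintype ι] [DecidableEq ι]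
    {u : ι → ℕ → ℝ} {c : ι → ℝ}
    (hlow : ∀ i, ∀ ε > 0, ∀ᶠ n in atTop, c i - ε ≤ u i n)
    (hup : ∀ ε > 0, ∀ᶠ n in atTop, ∑ i, u i n ≤ ∑ i, c i + ε) (i : ι) :
    Tendsto (u i) atTop (𝓝 (c i)) := by
  rw [Metric.tendsto_atTop']
  intro ε hε
  set δ := ε / (2 * (Fintype.card ι + 1)) with hδ
  have hδ0 : 0 < δ := by positivity
  have hδc : δ * (Fintype.card ι + 1) = ε / 2 := by rw [hδ]; field_simp
  have hall : ∀ᶠ n in atTop, ∀ j, c j - δ ≤ u j n := eventually_all.2 fun j => hlow j δ hδ0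
  obtain ⟨N, hN⟩ := eventually_atTop.1 (hall.and (hup δ hδ0))
  refine ⟨N, fun n hn => ?_⟩
  obtain ⟨h1, h2⟩ := hN n hn.le
  have hcard : (0 : ℝ) ≤ Fintype.card ι := Nat.cast_nonneg _
  have h3 : ∑ j ∈ Finset.univ.erase i, (c j - δ) ≤ ∑ j ∈ Finset.univ.erase i, u j n :=
    Finset.sum_le_sum fun j _ => h1 j
  have h4 := Finset.add_sum_erase Finset.univ (fun j => u j n) (Finset.mem_univ i)
  have h5 := Finset.add_sum_erase Finset.univ (fun j => c j) (Finset.mem_univ i)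
  rw [Finset.sum_sub_distrib, Finset.sum_const, nsmul_eq_mul] at h3
  have h6 : ((Finset.univ.erase i).card : ℝ) ≤ Fintype.card ι := by
    exact_mod_cast (Finset.card_le_univ _)
  have h7 := mul_le_mul_of_nonneg_right h6 hδ0.le
  have h8 := h1 i
  rw [Real.dist_eq, abs_lt]
  constructor <;> nlinarith

end QuenchedRW

/-! ### Pair counts between the blocks of a subdivision -/

namespace QuenchedRW

theorem sum_consecutive_Ico {M : Type*} [AddCommMonoid M] (f : ℕ → M) :
    ∀ {s : ℕ} (m : Fin (s + 1) → ℕ), Monotone m →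
      ∑ j : Fin s, ∑ i ∈ Finset.Ico (m j.castSucc) (m j.succ), f i =
        ∑ i ∈ Finset.Ico (m 0) (m (Fin.last s)), f i := by
  intro s
  induction s with
  | zero => intro m _; simp
  | succ s ih =>
    intro m hm
    rw [Fin.sum_univ_castSucc]
    have h1 := ih (fun i => m i.castSucc) fun a b hab => hm (Fin.castSucc_le_castSucc_iff.2 hab)
    simp only [Fin.succ_castSucc] at h1 ⊢
    rw [h1, Fin.succ_last]
    exact Finset.sum_Ico_consecutive f (hm (Fin.zero_le _)) (hm (Fin.le_last _))

theorem sum_sum_pairCount_consecutive (z : ℕ → Fin 2 → ℤ) (l : Fin 2 → ℤ) {s : ℕ}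
    (m : Fin (s + 1) → ℕ) (hm : Monotone m) :
    ∑ p : Fin s × Fin s, pairCount z (Finset.Ico (m p.1.castSucc) (m p.1.succ))
        (Finset.Ico (m p.2.castSucc) (m p.2.succ)) l =
      pairCount z (Finset.Ico (m 0) (m (Fin.last s))) (Finset.Ico (m 0) (m (Fin.last s))) l := by
  rw [Fintype.sum_prod_type]
  simp only [pairCount]
  rw [← sum_consecutive_Ico _ m hm]
  refine Finset.sum_congr rfl fun j _ => ?_
  rw [Finset.sum_comm]
  refine Finset.sum_congr rfl fun i _ => ?_
  exact sum_consecutive_Ico (fun k => if z i - z k = l then (1 : ℝ) else 0) m hm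

/-- Closing the blocks adds one row and one column of pairs, of order `n` and thus negligible
against `n log n`. Half-open blocks tile the square exactly, which the summation argument needs. -/
theorem pairCount_Icc_sub_Ico_le (z : ℕ → Fin 2 → ℤ) (l : Fin 2 → ℤ) {a b a' b' n : ℕ}
    (hab : a ≤ b) (hab' : a' ≤ b') (hb : b ≤ n) (hb' : b' ≤ n) :
    |pairCount z (Finset.Icc a b) (Finset.Icc a' b') l -
      pairCount z (Finset.Ico a b) (Finset.Ico a' b') l| ≤ 2 * n + 1 := by
  have e : ∀ {a b : ℕ}, a ≤ b → Finset.Icc a b = Finset.Ico a b ∪ {b} := by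
    intro a b hab
    ext k; simp only [Finset.mem_Icc, Finset.mem_union, Finset.mem_Ico, Finset.mem_singleton]; omega
  have hd : ∀ a b : ℕ, Disjoint (Finset.Ico a b) {b} := fun a b => by simp
  have h1 : pairCount z (Finset.Icc a b) (Finset.Icc a' b') l =
      pairCount z (Finset.Ico a b) (Finset.Ico a' b') l +
        pairCount z (Finset.Ico a b) {b'} l + pairCount z {b} (Finset.Icc a' b') l := by
    conv_lhs => rw [e hab, pairCount_union_left z (hd a b)]
    conv_lhs => enter [1]; rw [e hab', pairCount_union_right z _ (hd a' b')]
  have h2 := pairCount_le_card z (Finset.Ico a b) {b'} l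
  have h3 := pairCount_le_card z {b} (Finset.Icc a' b') l
  have h4 : ((Finset.Ico a b).card : ℝ) ≤ n := by
    rw [Nat.card_Ico]; exact_mod_cast (by omega : b - a ≤ n)
  have h5 : ((Finset.Icc a' b').card : ℝ) ≤ n + 1 := by
    rw [Nat.card_Icc]; exact_mod_cast (by omega : b' + 1 - a' ≤ n + 1)
  have h6 := pairCount_nonneg z (Finset.Ico a b) {b'} l
  have h7 := pairCount_nonneg z {b} (Finset.Icc a' b') l
  rw [Finset.card_singleton, Nat.cast_one] at h2 h3
  rw [h1, abs_le]
  constructor <;> linarith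

theorem tendsto_linear_div_mul_log :
    Tendsto (fun n : ℕ => (2 * (n : ℝ) + 1) / (n * Real.log n)) atTop (𝓝 0) := by
  have h1 : Tendsto (fun n : ℕ => 3 / Real.log n) atTop (𝓝 0) :=
    tendsto_const_nhds.div_atTop tendsto_log_natCast_atTop
  refine squeeze_zero' ?_ ?_ h1
  · filter_upwards [tendsto_log_natCast_atTop.eventually_gt_atTop 0] with n hn
    positivity
  · filter_upwards [tendsto_log_natCast_atTop.eventually_gt_atTop 0, eventually_ge_atTop 1]
      with n hn hn1
    have : (1 : ℝ) ≤ n := by exact_mod_cast hn1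
    rw [div_le_div_iff₀ (by positivity) hn]
    nlinarith

/-- Asymptotics of the pair counts between the blocks of a subdivision. -/
theorem HasGeometricAsymptotics.tendsto_block {z : ℕ → Fin 2 → ℤ} {C : ℝ}
    (hz : HasGeometricAsymptotics z C) (hC : 0 ≤ C) (l : Fin 2 → ℤ) {s : ℕ} {t : Fin (s + 1) → ℝ}
    (h0 : t 0 = 0) (h1 : t (Fin.last s) = 1) (ht : StrictMono t) (j j' : Fin s) :
    Tendsto (fun n : ℕ =>
      pairCount z (Finset.Icc ⌊(n : ℝ) * t j.castSucc⌋₊ ⌊(n : ℝ) * t j.succ⌋₊)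
        (Finset.Icc ⌊(n : ℝ) * t j'.castSucc⌋₊ ⌊(n : ℝ) * t j'.succ⌋₊) l / (n * Real.log n))
      atTop (𝓝 (if j = j' then C * (t j.succ - t j.castSucc) else 0)) := by
  have htnn : ∀ i, 0 ≤ t i := fun i => h0 ▸ ht.monotone (Fin.zero_le i)
  have htle : ∀ i, t i ≤ 1 := fun i => h1 ▸ ht.monotone (Fin.le_last i)
  have hm : ∀ n : ℕ, Monotone fun i => ⌊(n : ℝ) * t i⌋₊ := fun n a b hab =>
    Nat.floor_mono (mul_le_mul_of_nonneg_left (ht.monotone hab) (Nat.cast_nonneg n))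
  have hlog : ∀ n : ℕ, 0 ≤ (n : ℝ) * Real.log n := fun n =>
    mul_nonneg (Nat.cast_nonneg n) (Real.log_natCast_nonneg n)
  -- Applied to all `s * s` pairs of blocks at once. Diagonal pairs have sharp lower bounds,
  -- off-diagonal ones are merely nonnegative, and the total is at most about `C` because the
  -- lengths add up to `1`. The off-diagonal counts vanish in the limit without any estimate of
  -- their own.
  have hIco := tendsto_of_eventually_ge_of_sum_le
    (u := fun (p : Fin s × Fin s) (n : ℕ) =>
      pairCount z (Finset.Ico ⌊(n : ℝ) * t p.1.castSucc⌋₊ ⌊(n : ℝ) * t p.1.succ⌋₊)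
        (Finset.Ico ⌊(n : ℝ) * t p.2.castSucc⌋₊ ⌊(n : ℝ) * t p.2.succ⌋₊) l / (n * Real.log n))
    (c := fun p => if p.1 = p.2 then C * (t p.1.succ - t p.1.castSucc) else 0)
    (fun p ε hε => by
      obtain ⟨i, i'⟩ := p
      simp only
      split_ifs with hii
      · subst hii
        exact hz.eventually_ge hC l (htnn _) (ht (Fin.castSucc_lt_succ)) hε
      · exact Eventually.of_forall fun n => le_trans (by linarith)
          (div_nonneg (pairCount_nonneg _ _ _ _) (hlog n)))
    (fun ε hε => by
      have hsum : ∑ p : Fin s × Fin s,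
          (if p.1 = p.2 then C * (t p.1.succ - t p.1.castSucc) else 0) = C := by
        rw [Fintype.sum_prod_type]
        simp only [Finset.sum_ite_eq, Finset.mem_univ, if_true, ← Finset.mul_sum]
        have : ∑ i : Fin s, (t i.succ - t i.castSucc) = 1 := by
          rw [Finset.sum_sub_distrib]
          have e1 := Fin.sum_univ_succ t
          have e2 := Fin.sum_univ_castSucc t
          linarith
        rw [this, mul_one]
      rw [hsum]
      filter_upwards [hz.eventually_le hC l hε] with n hn
      rw [← Finset.sum_div, sum_sum_pairCount_consecutive z l (fun i => ⌊(n : ℝ) * t i⌋₊) (hm n)]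
      simpa [h0, h1] using hn)
    (j, j')
  have hdiff : Tendsto (fun n : ℕ =>
      (pairCount z (Finset.Icc ⌊(n : ℝ) * t j.castSucc⌋₊ ⌊(n : ℝ) * t j.succ⌋₊)
        (Finset.Icc ⌊(n : ℝ) * t j'.castSucc⌋₊ ⌊(n : ℝ) * t j'.succ⌋₊) l -
      pairCount z (Finset.Ico ⌊(n : ℝ) * t j.castSucc⌋₊ ⌊(n : ℝ) * t j.succ⌋₊)
        (Finset.Ico ⌊(n : ℝ) * t j'.castSucc⌋₊ ⌊(n : ℝ) * t j'.succ⌋₊) l) / (n * Real.log n))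
      atTop (𝓝 0) := by
    refine squeeze_zero_norm (fun n => ?_) tendsto_linear_div_mul_log
    rw [Real.norm_eq_abs, abs_div, abs_of_nonneg (hlog n)]
    refine div_le_div_of_nonneg_right ?_ (hlog n)
    have hfl : ∀ i, ⌊(n : ℝ) * t i⌋₊ ≤ n := fun i => by
      refine Nat.floor_le_of_le ?_
      exact mul_le_of_le_one_right (Nat.cast_nonneg n) (htle i)
    exact pairCount_Icc_sub_Ico_le z l (hm n (Fin.castSucc_lt_succ).le)
      (hm n (Fin.castSucc_lt_succ).le) (hfl _) (hfl _)
  have := hIco.add hdiff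
  rw [add_zero] at this
  refine this.congr fun n => ?_
  rw [← add_div, add_sub_cancel]

end QuenchedRW

/-! ### Weyl's criterion, the spectral identity and the energies -/

namespace QuenchedRW

open scoped ComplexConjugate

instance : IsProbabilityMeasure torusHaar :=
  inferInstanceAs (IsProbabilityMeasure (Measure.pi fun _ : Fin 2 => AddCircle.haarAddCircle))

theorem integral_fourier (k : ℤ) :
    ∫ x : UnitAddCircle, fourier k x ∂AddCircle.haarAddCircle = if k = 0 then 1 else 0 := by
  split_ifs with h
  · simp [h]
  · exact integral_eq_zero_of_add_right_eq_neg (μ := AddCircle.haarAddCircle)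
      (fourier_add_half_inv_index h one_pos)

theorem integral_mFourier (k : Fin 2 → ℤ) :
    ∫ x, UnitAddTorus.mFourier k x ∂torusHaar = if k = 0 then 1 else 0 := by
  have h : ∫ x, UnitAddTorus.mFourier k x ∂torusHaar =
      ∏ i : Fin 2, ∫ x : UnitAddCircle, fourier (k i) x ∂AddCircle.haarAddCircle :=
    integral_fintype_prod_eq_prod (fun i (x : UnitAddCircle) => (fourier (k i) x : ℂ))
  rw [h, Fin.prod_univ_two, integral_fourier, integral_fourier]
  by_cases h0 : k 0 = 0 <;> by_cases h1 : k 1 = 0 <;>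
    simp [funext_iff, Fin.forall_fin_two, h0, h1]

theorem mFourier_apply_zero (k : Fin 2 → ℤ) : UnitAddTorus.mFourier k 0 = 1 := by
  simp [UnitAddTorus.mFourier]

theorem integrable_torusHaar {F : UnitAddTorus (Fin 2) → ℂ} (hF : Continuous F) :
    Integrable F torusHaar :=
  hF.integrable_of_hasCompactSupport (HasCompactSupport.of_compactSpace F)

/-- Weyl's criterion: nonnegative continuous densities whose Fourier coefficients all converge
to `S` converge weakly to `S` times the point mass at the origin. -/
theorem tendsto_integral_of_tendsto_integral_mFourier {F : ℕ → UnitAddTorus (Fin 2) → ℝ} {S : ℂ}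
    (hF : ∀ n, Continuous (F n)) (h0 : ∀ n t, 0 ≤ F n t)
    (hm : ∀ m : Fin 2 → ℤ,
      Tendsto (fun n => ∫ t, (F n t : ℂ) * UnitAddTorus.mFourier m t ∂torusHaar) atTop (𝓝 S))
    (ψ : C(UnitAddTorus (Fin 2), ℂ)) :
    Tendsto (fun n => ∫ t, (F n t : ℂ) * ψ t ∂torusHaar) atTop (𝓝 (S * ψ 0)) := by
  have hFc : ∀ n, Continuous fun t => (F n t : ℂ) := fun n =>
    Complex.continuous_ofReal.comp (hF n)
  have hint : ∀ n (ψ : C(UnitAddTorus (Fin 2), ℂ)),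
      Integrable (fun t => (F n t : ℂ) * ψ t) torusHaar := fun n ψ =>
    integrable_torusHaar ((hFc n).mul ψ.continuous)
  have hspan : ∀ χ ∈ Submodule.span ℂ (Set.range (UnitAddTorus.mFourier (d := Fin 2))),
      Tendsto (fun n => ∫ t, (F n t : ℂ) * χ t ∂torusHaar) atTop (𝓝 (S * χ 0)) := by
    intro χ hχ
    induction hχ using Submodule.span_induction with
    | mem χ hχ =>
      obtain ⟨m, rfl⟩ := hχ
      simpa [mFourier_apply_zero] using hm m
    | zero => simp
    | add χ χ' _ _ ih ih' =>
      have := ih.add ih'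
      rw [← mul_add] at this
      refine this.congr fun n => ?_
      rw [← integral_add (hint n χ) (hint n χ')]
      simp [mul_add]
    | smul c χ _ ih =>
      have := ih.const_mul c
      rw [show c * (S * χ 0) = S * (c • χ) 0 by simp; ring] at this
      refine this.congr fun n => ?_
      rw [← integral_const_mul]
      refine integral_congr_ae (.of_forall fun t => ?_)
      simp only [ContinuousMap.smul_apply, smul_eq_mul]
      ring
  have hmass : ∀ n, ∫ t, (F n t : ℂ) * UnitAddTorus.mFourier 0 t ∂torusHaar =
      ((∫ t, F n t ∂torusHaar : ℝ) : ℂ) := fun n => by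
    simpa [UnitAddTorus.mFourier_zero] using integral_ofReal (𝕜 := ℂ) (f := F n)
  -- By nonnegativity the zeroth coefficient is the total mass, so its convergence bounds the
  -- densities in `L¹` and allows uniform approximation of `ψ` by trigonometric polynomials.
  have hbdd : ∃ B : ℝ, 0 < B ∧ (∀ᶠ n in atTop, ∫ t, F n t ∂torusHaar ≤ B) ∧ ‖S‖ ≤ B := by
    refine ⟨‖S‖ + 1, by positivity, ?_, by linarith⟩
    have := (hm 0).norm
    filter_upwards [this.eventually_lt_const (lt_add_one ‖S‖)] with n hn
    rw [hmass, Complex.norm_real] at hn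
    exact (le_abs_self _).trans hn.le
  obtain ⟨B, hB, hFB, hSB⟩ := hbdd
  rw [Metric.tendsto_nhds]
  intro ε hε
  have hdense : ψ ∈ closure
      (Submodule.span ℂ (Set.range (UnitAddTorus.mFourier (d := Fin 2))) : Set _) := by
    rw [← Submodule.topologicalClosure_coe, UnitAddTorus.span_mFourier_closure_eq_top]
    trivial
  obtain ⟨χ, hχ, hd⟩ := Metric.mem_closure_iff.1 hdense (ε / (3 * B)) (by positivity)
  rw [dist_eq_norm] at hd
  have hpt : ∀ t, ‖ψ t - χ t‖ ≤ ε / (3 * B) := fun t =>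
    ((ψ - χ).norm_coe_le_norm t).trans hd.le
  filter_upwards [hFB, (Metric.tendsto_nhds.1 (hspan χ hχ)) (ε / 3) (by positivity)] with n hn hc
  have h1 : dist (∫ t, (F n t : ℂ) * ψ t ∂torusHaar) (∫ t, (F n t : ℂ) * χ t ∂torusHaar)
      ≤ ε / 3 := by
    rw [dist_eq_norm, ← integral_sub (hint n ψ) (hint n χ)]
    calc _ ≤ ∫ t, F n t * (ε / (3 * B)) ∂torusHaar := by
          refine norm_integral_le_of_norm_le ?_ (.of_forall fun t => ?_)
          · exact ((hF n).mul continuous_const).integrable_of_hasCompactSupport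
              (HasCompactSupport.of_compactSpace _)
          · rw [← mul_sub, norm_mul, Complex.norm_real, Real.norm_of_nonneg (h0 n t)]
            exact mul_le_mul_of_nonneg_left (hpt t) (h0 n t)
      _ = (∫ t, F n t ∂torusHaar) * (ε / (3 * B)) := integral_mul_const _ _
      _ ≤ B * (ε / (3 * B)) := mul_le_mul_of_nonneg_right hn (by positivity)
      _ = ε / 3 := by field_simp
  have h2 : dist (S * χ 0) (S * ψ 0) ≤ ε / 3 := by
    rw [dist_comm, dist_eq_norm, ← mul_sub, norm_mul]
    calc _ ≤ B * (ε / (3 * B)) := mul_le_mul hSB (hpt 0) (norm_nonneg _) hB.le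
      _ = ε / 3 := by field_simp
  calc _ ≤ _ := dist_triangle4 _ (∫ t, (F n t : ℂ) * χ t ∂torusHaar) (S * χ 0) _
    _ < ε := by linarith

/-- The trigonometric polynomial `∑ c_i e^{2π i ⟨v_i, t⟩}`. -/
def trigPoly {ι : Type*} (A : Finset ι) (c : ι → ℝ) (v : ι → Fin 2 → ℤ)
    (t : UnitAddTorus (Fin 2)) : ℂ :=
  ∑ i ∈ A, (c i : ℂ) * UnitAddTorus.mFourier (v i) t

theorem continuous_trigPoly {ι : Type*} (A : Finset ι) (c : ι → ℝ) (v : ι → Fin 2 → ℤ) :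
    Continuous (trigPoly A c v) :=
  continuous_finsetSum _ fun i _ => continuous_const.mul (UnitAddTorus.mFourier (v i)).continuous

theorem norm_sq_trigPoly {ι : Type*} (A : Finset ι) (c : ι → ℝ) (v : ι → Fin 2 → ℤ)
    (t : UnitAddTorus (Fin 2)) :
    ((‖trigPoly A c v t‖ ^ 2 : ℝ) : ℂ) =
      ∑ i ∈ A, ∑ j ∈ A, ((c i * c j : ℝ) : ℂ) * UnitAddTorus.mFourier (v i - v j) t := by
  rw [Complex.ofReal_pow, ← Complex.mul_conj', trigPoly, map_sum, Finset.sum_mul_sum]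
  refine Finset.sum_congr rfl fun i _ => Finset.sum_congr rfl fun j _ => ?_
  rw [sub_eq_add_neg, UnitAddTorus.mFourier_add, UnitAddTorus.mFourier_neg, map_mul,
    Complex.conj_ofReal]
  push_cast
  ring

theorem integral_norm_sq_trigPoly_mul {ι : Type*} (A : Finset ι) (c : ι → ℝ)
    (v : ι → Fin 2 → ℤ) {ψ : UnitAddTorus (Fin 2) → ℂ} (hψ : Continuous ψ) :
    ∫ t, ((‖trigPoly A c v t‖ ^ 2 : ℝ) : ℂ) * ψ t ∂torusHaar =
      ∑ i ∈ A, ∑ j ∈ A, ((c i * c j : ℝ) : ℂ) *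
        ∫ t, UnitAddTorus.mFourier (v i - v j) t * ψ t ∂torusHaar := by
  have hi : ∀ i j, Integrable
      (fun t => ((c i * c j : ℝ) : ℂ) * (UnitAddTorus.mFourier (v i - v j) t * ψ t)) torusHaar :=
    fun i j => (integrable_torusHaar ((ContinuousMap.continuous _).mul hψ)).const_mul _
  simp_rw [norm_sq_trigPoly, Finset.sum_mul, mul_assoc]
  rw [integral_finsetSum _ fun i _ => integrable_finsetSum _ fun j _ => hi i j]
  refine Finset.sum_congr rfl fun i _ => ?_
  rw [integral_finsetSum _ fun j _ => hi i j]
  exact Finset.sum_congr rfl fun j _ => integral_const_mul _ _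

section Action

variable {E : Type*} [MeasurableSpace E] {μ : Measure E} {T₁ T₂ : E ≃ᵐ E}

theorem zAction_add (hcomm : ∀ x, T₁ (T₂ x) = T₂ (T₁ x)) (k m : Fin 2 → ℤ) (x : E) :
    zAction T₁ T₂ (k + m) x = zAction T₁ T₂ k (zAction T₁ T₂ m x) := by
  have hc : Commute (T₁.toEquiv : Equiv.Perm E) (T₂.toEquiv : Equiv.Perm E) :=
    Equiv.ext hcomm
  have hc' := hc.zpow_zpow (m 0) (k 1)
  simp only [zAction, Pi.add_apply, zpow_add]
  have := congrArg (fun σ : Equiv.Perm E =>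
    ((T₁.toEquiv : Equiv.Perm E) ^ k 0) (σ (((T₂.toEquiv : Equiv.Perm E) ^ m 1) x))) hc'.eq
  simpa [Equiv.Perm.mul_apply] using this

theorem measurePreserving_zpow {T : E ≃ᵐ E} (hT : MeasurePreserving T μ μ) (k : ℤ) :
    MeasurePreserving ((T.toEquiv : Equiv.Perm E) ^ k : Equiv.Perm E) μ μ := by
  induction k with
  | zero => exact MeasurePreserving.id μ
  | succ k ih =>
    rw [zpow_add_one]
    exact ih.comp hT
  | pred k ih =>
    rw [zpow_sub_one]
    exact ih.comp hT.symm

theorem measurePreserving_zAction (hT₁ : MeasurePreserving T₁ μ μ)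
    (hT₂ : MeasurePreserving T₂ μ μ) (l : Fin 2 → ℤ) :
    MeasurePreserving (zAction T₁ T₂ l) μ μ :=
  (measurePreserving_zpow hT₁ (l 0)).comp (measurePreserving_zpow hT₂ (l 1))

theorem integral_zAction_mul_zAction (hT₁ : MeasurePreserving T₁ μ μ)
    (hT₂ : MeasurePreserving T₂ μ μ) (hcomm : ∀ x, T₁ (T₂ x) = T₂ (T₁ x)) {f : E → ℝ}
    (hf : MemLp f 2 μ) (k m : Fin 2 → ℤ) :
    ∫ x, f (zAction T₁ T₂ k x) * f (zAction T₁ T₂ m x) ∂μ =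
      ∫ x, f (zAction T₁ T₂ (k - m) x) * f x ∂μ := by
  have hm := measurePreserving_zAction hT₁ hT₂ m
  have hkm := measurePreserving_zAction hT₁ hT₂ (k - m)
  have hae : AEStronglyMeasurable (fun x => f (zAction T₁ T₂ (k - m) x) * f x)
      (μ.map (zAction T₁ T₂ m)) := by
    rw [hm.map_eq]
    exact (hf.comp_measurePreserving hkm).1.mul hf.1
  conv_rhs => rw [← hm.map_eq]
  rw [integral_map hm.measurable.aemeasurable hae]
  refine integral_congr_ae (.of_forall fun x => ?_)
  simp only [← zAction_add hcomm, sub_add_cancel]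

/-- By invariance the correlations of `T^k f` and `T^m f` depend only on `k - m`, so both sides
expand into the same double sum of Fourier coefficients of `φ`. -/
theorem integral_sq_sum_zAction (hT₁ : MeasurePreserving T₁ μ μ)
    (hT₂ : MeasurePreserving T₂ μ μ) (hcomm : ∀ x, T₁ (T₂ x) = T₂ (T₁ x)) {f : E → ℝ}
    (hf : MemLp f 2 μ) {φ : UnitAddTorus (Fin 2) → ℝ}
    (hφ : IsContinuousSpectralDensity μ T₁ T₂ f φ)
    {ι : Type*} (A : Finset ι) (c : ι → ℝ) (v : ι → Fin 2 → ℤ) :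
    ((∫ x, (∑ i ∈ A, c i * f (zAction T₁ T₂ (v i) x)) ^ 2 ∂μ : ℝ) : ℂ) =
      ∫ t, ((‖trigPoly A c v t‖ ^ 2 : ℝ) : ℂ) * (φ t : ℂ) ∂torusHaar := by
  have hL : ∀ k, MemLp (fun x => f (zAction T₁ T₂ k x)) 2 μ := fun k =>
    hf.comp_measurePreserving (measurePreserving_zAction hT₁ hT₂ k)
  have hi : ∀ i j, Integrable
      (fun x => c i * c j * (f (zAction T₁ T₂ (v i) x) * f (zAction T₁ T₂ (v j) x))) μ :=
    fun i j => ((hL (v i)).integrable_mul (hL (v j))).const_mul _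
  rw [integral_norm_sq_trigPoly_mul A c v (ψ := fun t => (φ t : ℂ))
    (Complex.continuous_ofReal.comp hφ.1)]
  simp_rw [sq, Finset.sum_mul_sum, mul_mul_mul_comm]
  rw [integral_finsetSum _ fun i _ => integrable_finsetSum _ fun j _ => hi i j, Complex.ofReal_sum]
  refine Finset.sum_congr rfl fun i _ => ?_
  rw [integral_finsetSum _ fun j _ => hi i j, Complex.ofReal_sum]
  refine Finset.sum_congr rfl fun j _ => ?_
  rw [integral_const_mul, integral_zAction_mul_zAction hT₁ hT₂ hcomm hf, Complex.ofReal_mul,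
    hφ.2]

end Action

theorem integral_norm_sq_trigPoly_mul_mFourier {ι : Type*} (A : Finset ι) (c : ι → ℝ)
    (v : ι → Fin 2 → ℤ) (m : Fin 2 → ℤ) :
    ∫ t, ((‖trigPoly A c v t‖ ^ 2 : ℝ) : ℂ) * UnitAddTorus.mFourier m t ∂torusHaar =
      ((∑ i ∈ A, ∑ j ∈ A, c i * c j * (if v i - v j = -m then 1 else 0) : ℝ) : ℂ) := by
  rw [integral_norm_sq_trigPoly_mul A c v (ContinuousMap.continuous _)]
  simp_rw [← UnitAddTorus.mFourier_add, integral_mFourier, Complex.ofReal_sum]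
  refine Finset.sum_congr rfl fun i _ => Finset.sum_congr rfl fun j _ => ?_
  simp only [← eq_neg_iff_add_eq_zero]
  split_ifs <;> simp

/-- The index set is the disjoint union of the blocks: adjacent closed blocks share an end point,
and that time must carry both weights. -/
theorem sum_sigma_eq_sum_pairCount {s : ℕ} (z : ℕ → Fin 2 → ℤ) (A : Fin s → Finset ℕ)
    (a : Fin s → ℝ) (l : Fin 2 → ℤ) :
    (∑ p ∈ Finset.univ.sigma A, ∑ q ∈ Finset.univ.sigma A,
      a p.1 * a q.1 * (if z p.2 - z q.2 = l then 1 else 0) : ℝ) =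
      ∑ j, ∑ j', a j * a j' * pairCount z (A j) (A j') l := by
  simp only [Finset.sum_sigma, pairCount, Finset.mul_sum]
  refine Finset.sum_congr rfl fun j _ => ?_
  rw [Finset.sum_comm]

/-- The deterministic form of the theorem: along a path with the geometric asymptotics, the
normalised energies of the block sums converge. -/
theorem HasGeometricAsymptotics.tendsto_energy {z : ℕ → Fin 2 → ℤ} {C : ℝ}
    (hz : HasGeometricAsymptotics z C) (hC : 0 < C)
    {E : Type*} [MeasurableSpace E] {μ : Measure E} {T₁ T₂ : E ≃ᵐ E}
    (hT₁ : MeasurePreserving T₁ μ μ) (hT₂ : MeasurePreserving T₂ μ μ)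
    (hcomm : ∀ x, T₁ (T₂ x) = T₂ (T₁ x)) {f : E → ℝ} (hf : MemLp f 2 μ)
    {φ : UnitAddTorus (Fin 2) → ℝ} (hφ : IsContinuousSpectralDensity μ T₁ T₂ f φ)
    {s : ℕ} (a : Fin s → ℝ) {t : Fin (s + 1) → ℝ} (h0 : t 0 = 0) (h1 : t (Fin.last s) = 1)
    (ht : StrictMono t) :
    Tendsto (fun n : ℕ => (C * (n : ℝ) * Real.log n)⁻¹ *
      ∫ x, (∑ j : Fin s, a j *
        ∑ k ∈ Finset.Icc ⌊(n : ℝ) * t j.castSucc⌋₊ ⌊(n : ℝ) * t j.succ⌋₊,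
          f (zAction T₁ T₂ (z k) x)) ^ 2 ∂μ) atTop
      (𝓝 (φ 0 * ∑ j : Fin s, a j ^ 2 * (t j.succ - t j.castSucc))) := by
  set A : ℕ → Fin s → Finset ℕ := fun n j =>
    Finset.Icc ⌊(n : ℝ) * t j.castSucc⌋₊ ⌊(n : ℝ) * t j.succ⌋₊ with hA
  set w : ℕ → ℝ := fun n => (C * (n : ℝ) * Real.log n)⁻¹ with hw
  have hw0 : ∀ n, 0 ≤ w n := fun n =>
    inv_nonneg.2 (mul_nonneg (mul_nonneg hC.le (Nat.cast_nonneg n)) (Real.log_natCast_nonneg n))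
  set G : ℕ → UnitAddTorus (Fin 2) → ℂ := fun n => trigPoly (Finset.univ.sigma (A n))
    (fun p => a p.1) (fun p => z p.2) with hG
  have hcoeff : ∀ m : Fin 2 → ℤ, Tendsto
      (fun n => ∫ t, ((w n * ‖G n t‖ ^ 2 : ℝ) : ℂ) * UnitAddTorus.mFourier m t ∂torusHaar) atTop
      (𝓝 ((∑ j : Fin s, a j ^ 2 * (t j.succ - t j.castSucc) : ℝ) : ℂ)) := by
    intro m
    have key : Tendsto (fun n : ℕ => C⁻¹ * ∑ j, ∑ j', a j * a j' *
        (pairCount z (A n j) (A n j') (-m) / (n * Real.log n))) atTop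
        (𝓝 (C⁻¹ * ∑ j, ∑ j', a j * a j' *
          (if j = j' then C * (t j.succ - t j.castSucc) else 0))) :=
      (tendsto_finsetSum _ fun j _ => tendsto_finsetSum _ fun j' _ =>
        (hz.tendsto_block hC.le (-m) h0 h1 ht j j').const_mul _).const_mul _
    -- Only diagonal blocks survive, and the value is independent of `m`: all coefficients share one
    -- limit, as for a multiple of the point mass at `0`.
    have hlim : C⁻¹ * ∑ j, ∑ j', a j * a j' *
        (if j = j' then C * (t j.succ - t j.castSucc) else 0) =
        ∑ j : Fin s, a j ^ 2 * (t j.succ - t j.castSucc) := by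
      rw [Finset.mul_sum]
      refine Finset.sum_congr rfl fun j _ => ?_
      simp only [mul_ite, mul_zero, Finset.sum_ite_eq, Finset.mem_univ, if_true]
      field_simp
    rw [hlim] at key
    refine ((Complex.continuous_ofReal.tendsto _).comp key).congr fun n => ?_
    simp only [Function.comp_apply, Complex.ofReal_mul (w n), mul_assoc (w n : ℂ)]
    rw [integral_const_mul, hG, integral_norm_sq_trigPoly_mul_mFourier,
      sum_sigma_eq_sum_pairCount, ← Complex.ofReal_mul, hw, Finset.mul_sum, Finset.mul_sum]
    congr 1
    refine Finset.sum_congr rfl fun j _ => ?_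
    rw [Finset.mul_sum, Finset.mul_sum]
    refine Finset.sum_congr rfl fun j' _ => ?_
    simp only [mul_inv, div_eq_mul_inv]
    ring
  have hlimit := tendsto_integral_of_tendsto_integral_mFourier
    (F := fun n t => w n * ‖G n t‖ ^ 2)
    (fun n => continuous_const.mul ((continuous_trigPoly _ _ _).norm.pow 2))
    (fun n t => mul_nonneg (hw0 n) (sq_nonneg _)) hcoeff
    ⟨fun t => (φ t : ℂ), Complex.continuous_ofReal.comp hφ.1⟩
  have hre := (Complex.continuous_re.tendsto _).comp hlimit
  simp only [ContinuousMap.coe_mk] at hre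
  rw [← Complex.ofReal_mul, Complex.ofReal_re, mul_comm] at hre
  refine hre.congr fun n => ?_
  simp only [Function.comp_apply, Complex.ofReal_mul (w n), mul_assoc (w n : ℂ)]
  rw [integral_const_mul, hG, ← integral_sq_sum_zAction hT₁ hT₂ hcomm hf hφ, ← Complex.ofReal_mul,
    Complex.ofReal_re]
  simp only [Finset.sum_sigma, Finset.mul_sum, hA, hw]

end QuenchedRW

end

theorem lemma1p5
    {Ω : Type*} [MeasurableSpace Ω] (P : Measure Ω) [IsProbabilityMeasure P]
    (ζ : ℕ → Ω → (Fin 2 → ℤ))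
    (hmeas : ∀ i, Measurable (ζ i))
    (hindep : iIndepFun ζ P)
    (hident : ∀ i, IdentDistrib (ζ i) (ζ 0) P P)
    (haper : QuenchedRW.IsAperiodic P (ζ 0))
    (hL2 : ∀ c : Fin 2, MemLp (fun ω => (ζ 0 ω c : ℝ)) 2 P)
    (hmean : ∀ c : Fin 2, ∫ ω, (ζ 0 ω c : ℝ) ∂P = 0)
    (hcov : (QuenchedRW.covMatrix P (ζ 0)).det ≠ 0)
    {E : Type*} [MeasurableSpace E] (μ : Measure E) [IsProbabilityMeasure μ]
    (T₁ T₂ : E ≃ᵐ E)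
    (hT₁ : MeasurePreserving T₁ μ μ) (hT₂ : MeasurePreserving T₂ μ μ)
    (hcomm : ∀ x, T₁ (T₂ x) = T₂ (T₁ x))
    (f : E → ℝ) (hf : MemLp f 2 μ)
    (φ : UnitAddTorus (Fin 2) → ℝ)
    (hφ : QuenchedRW.IsContinuousSpectralDensity μ T₁ T₂ f φ) :
    ∀ᵐ ω ∂P, ∀ (s : ℕ) (a : Fin s → ℝ) (t : Fin (s + 1) → ℝ),
      t 0 = 0 → t (Fin.last s) = 1 → StrictMono t →
      Tendsto
        (fun n : ℕ =>
          (QuenchedRW.selfIntersectionConst (QuenchedRW.covMatrix P (ζ 0)) *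
              (n : ℝ) * Real.log n)⁻¹ *
            ∫ x, (QuenchedRW.blockSum ζ T₁ T₂ f a t n ω x) ^ 2 ∂μ)
        atTop
        (𝓝 (φ 0 * ∑ j : Fin s, a j ^ 2 * (t j.succ - t j.castSucc))) := by
  have h : QuenchedRW.IsPlanarWalk P ζ := ⟨hmeas, hindep, hident, haper, hL2, hmean, hcov⟩
  have hC : 0 < QuenchedRW.selfIntersectionConst (QuenchedRW.covMatrix P (ζ 0)) :=
    inv_pos.2 (mul_pos Real.pi_pos
      (Real.sqrt_pos.2 (QuenchedRW.covMatrix_det_pos hL2 hmean hcov).1))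
  -- The exceptional null set comes from the pair counts of the walk alone, so weights and
  -- subdivision may be chosen after `ω`.
  filter_upwards [h.ae_hasGeometricAsymptotics] with ω hω s a t h0 h1 ht
  exact hω.tendsto_energy hC hT₁ hT₂ hcomm hf hφ a h0 h1 ht
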